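/- Let $\mathbf T^2$ be the torus of side length $2\pi$, $e_k(x)=\frac1{2\pi}e^{ik\cdot x}$ for $k\in\mathbf Z^2$, $\varphi_k=\int_{\mathbf T^2}\varphi\,e_{-k}\,dx$ and $\|\varphi\|_{H^1}^2=\sum_{k\in\mathbf Z^2}(1+|k|^2)|\varphi_k|^2$. Let $\eta$ be real spatial white noise of zero mean on $\mathbf T^2$, with Fourier modes $(\eta_k)_{k\in\mathbf Z^2}$: a centred jointly Gaussian complex family with $\eta_0=0$, $\eta_{-k}=\overline{\eta_k}$ and $\mathbb E[\eta_j\eta_k]=\mathbf 1_{j+k=0}$ for $j,k\neq0$. For $N\in\mathbf N$ and $\ell,m\in\mathbf Z^2\setminus\{0\}$ put $$\mathcal K^N_{\ell,m}=|\ell+m|\,\frac{\ell_2m_2-\ell_1m_1}{|\ell||m|}\,\mathbf 1_{|\ell|_\infty,|m|_\infty,|\ell+m|_\infty\le N},\qquad \mathcal N^N[v](\varphi)=\sum_{\ell,m\ne0}\mathcal K^N_{\ell,m}v_\ell v_m\varphi_{-\ell-m}.$$ Let $C>0$ and let $(\lambda_N)$ be real numbers with $\lambda_N\sim\sqrt{C/\log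 N}$ as $N\to\infty$. Let $\mathcal L^N$ be the closure in $L^2(\eta)$ of the operator given on cylinder functions $F$ (smooth functions, with all derivatives of at most polynomial growth, of finitely many Fourier modes of $v$) by $$\mathcal L^NF(v)=\frac12\sum_{k\in\mathbf Z^2}|k|^2\big(-v_{-k}D_k+D_{-k}D_k\big)F(v)+\lambda_N\sum_{\ell,m\neq0}\mathcal K^N_{m,\ell}\,v_mv_\ell\,D_{-m-\ell}F(v),$$ where $D_kF=\langle DF,e_k\rangle_{L^2(\mathbf T^2;\mathbf C)}$ and $DF$ is the Malliavin derivative of $F$ (so that $D_kv_j=\mathbf 1_{j=-k}$). Then there is a constant $\delta>0$, independent of $N$, $\varphi$ and $\lambda$, such that the following holds. For every real $\varphi\in H^1(\mathbf T^2)$ with $\varphi_0=0$ and every $\Lambda>0$ there is $N_0=N_0(\varphi,\Lambda)$ such that for all $N\ge N_0$ and all $\lambda\in(0,\Lambda]$ the equation $(\lambda-\mathcal L^N)U=\lambda_N\mathcal N^N[\eta](\varphi)$ has a unique solution $U=(\lambda-\mathcal L^N)^{-1}\lambda_N\mathcal N^N[\eta](\varphi)$ in the domain of $\mathcal L^N$,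 and $$\mathbb E\Big[\lambda_N\mathcal N^N[\eta](\varphi)\,(\lambda-\mathcal L^N)^{-1}\lambda_N\mathcal N^N[\eta](\varphi)\Big]\ \ge\ C\pi\delta\,\|\varphi\|_{H^1}^2 .$$ -/

import Mathlib

open MeasureTheory ProbabilityTheory Filter Asymptotics
open scoped Topology ComplexConjugate

noncomputable section

namespace AKPZ

/-! ### The torus, Fourier coefficients and the Sobolev space of order one -/

/-- Wave numbers, i.e. the lattice of integer points of the plane. -/
abbrev Mode := ℤ × ℤ

instance factTwoPiPos : Fact (0 < 2 * Real.pi) := ⟨Real.two_pi_pos⟩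

/-- The two-dimensional torus of side length `2π` (with its Lebesgue measure, of mass `(2π)^2`). -/
abbrev Torus2 := AddCircle (2 * Real.pi) × AddCircle (2 * Real.pi)

/-- The orthonormal Fourier basis `e_k(x) = (2π)⁻¹ exp(i k·x)`. -/
def basisFun (k : Mode) (x : Torus2) : ℂ :=
  ((2 * Real.pi : ℝ) : ℂ)⁻¹ * (fourier k.1 x.1 * fourier k.2 x.2)

/-- The Fourier coefficient `φ_k = ∫ φ(x) e_{-k}(x) dx` of a real function on the torus. -/
def fourierCoef (φ : Torus2 → ℝ) (k : Mode) : ℂ :=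
  ∫ x, (φ x : ℂ) * basisFun (-k) x

/-- `|k|²` for the Euclidean norm. -/
def normSq (k : Mode) : ℝ := (k.1 : ℝ) ^ 2 + (k.2 : ℝ) ^ 2

/-- The Euclidean norm `|k|`. -/
def euclNorm (k : Mode) : ℝ := √(normSq k)

/-- Membership of a real function on the torus in the Sobolev space `H¹`. -/
def MemH1 (φ : Torus2 → ℝ) : Prop :=
  MemLp φ 2 ∧ Summable fun k : Mode => (1 + normSq k) * ‖fourierCoef φ k‖ ^ 2

/-- The squared norm `∑_k (1 + |k|²) |φ_k|²` of `H¹`. -/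
def h1NormSq (φ : Torus2 → ℝ) : ℝ :=
  ∑' k : Mode, (1 + normSq k) * ‖fourierCoef φ k‖ ^ 2

/-! ### Spatial white noise with zero mean, through its Fourier modes -/

/-- The modes `η_k` of zero-mean real spatial white noise on the torus: a centred, jointly Gaussian
family of complex random variables with `η_0 = 0`, `η_{-k}` the conjugate of `η_k`, and
`E[η_j η_k] = 1` if `j + k = 0` (and `k ≠ 0`), `0` otherwise. -/
structure IsWhiteNoise {Ω : Type*} [MeasurableSpace Ω] (P : Measure Ω) (η : Mode → Ω → ℂ) :
    Prop where
  gaussian : IsGaussianProcess η P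
  centred : ∀ k, ∫ ω, η k ω ∂P = 0
  zero_mode : ∀ᵐ ω ∂P, η 0 ω = 0
  conj_mode : ∀ k, ∀ᵐ ω ∂P, η (-k) ω = conj (η k ω)
  covariance : ∀ j k, ∫ ω, η j ω * η k ω ∂P = if j + k = 0 ∧ k ≠ 0 then 1 else 0

/-! ### The nonlinearity -/

/-- The symmetric bilinear form `c(l, m) = l₂ m₂ - l₁ m₁`. -/
def cForm (l m : Mode) : ℝ := (l.2 : ℝ) * (m.2 : ℝ) - (l.1 : ℝ) * (m.1 : ℝ)

/-- The modes with `|k|_∞ ≤ N`. -/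
def box (N : ℕ) : Finset Mode :=
  Finset.Icc (-(N : ℤ)) (N : ℤ) ×ˢ Finset.Icc (-(N : ℤ)) (N : ℤ)

/-- The coefficient `|l + m| c(l, m) / (|l| |m|)`, restricted to non-zero `l`, `m` such that
`l`, `m`, `l + m` all lie in the box of size `N`. -/
def kernel (N : ℕ) (l m : Mode) : ℝ :=
  if l ≠ 0 ∧ m ≠ 0 ∧ l ∈ box N ∧ m ∈ box N ∧ l + m ∈ box N then
    euclNorm (l + m) * cForm l m / (euclNorm l * euclNorm m)
  else 0

/-- The nonlinearity tested against `φ`, as a function of the Fourier modes `v` of its argument: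
`∑_{l, m} K_{l, m} v_l v_m φ_{-l-m}`. -/
def nonlinC (N : ℕ) (φ : Torus2 → ℝ) (v : Mode → ℂ) : ℂ :=
  ∑ l ∈ box N, ∑ m ∈ box N, (kernel N l m : ℂ) * v l * v m * fourierCoef φ (-(l + m))

/-- The same, as a real number (see `ofReal_nonlin`). -/
def nonlin (N : ℕ) (φ : Torus2 → ℝ) (v : Mode → ℂ) : ℝ := (nonlinC N φ v).re

/-! ### Cylinder functions and the generator -/

/-- Cylinder functions of the Fourier modes: smooth functions, all of whose derivatives grow at most
polynomially, of finitely many modes. -/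
def IsCylinder (F : (Mode → ℂ) → ℝ) : Prop :=
  ∃ (S : Finset Mode) (f : (S → ℂ) → ℝ), Function.HasTemperateGrowth f ∧
    ∀ v : Mode → ℂ, F v = f fun k => v k

/-- The Fourier modes of the real part `a_k = (e_k + e_{-k}) / 2` of `e_k`. -/
def reDir (k : Mode) : Mode → ℂ := fun j =>
  ((if j = k then 1 else 0) + (if j = -k then 1 else 0)) / 2

/-- The Fourier modes of the imaginary part `b_k = (e_k - e_{-k}) / (2i)` of `e_k`. -/
def imDir (k : Mode) : Mode → ℂ := fun j =>
  ((if j = k then 1 else 0) - (if j = -k then 1 else 0)) / (2 * Complex.I)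

/-- The derivative `D_k F = ⟨DF, e_k⟩ = ⟨DF, a_k⟩ - i ⟨DF, b_k⟩`; thus `D_k v_j = 1` if `j = -k`
and `0` otherwise. -/
def modeDeriv (k : Mode) (F : (Mode → ℂ) → ℂ) (v : Mode → ℂ) : ℂ :=
  lineDeriv ℝ F v (reDir k) - Complex.I * lineDeriv ℝ F v (imDir k)

/-- The symmetric part `½ ∑_k |k|² (- v_{-k} D_k + D_{-k} D_k) F` of the generator. -/
def genSymC (F : (Mode → ℂ) → ℝ) (v : Mode → ℂ) : ℂ :=
  (1 / 2) * ∑' k : Mode, (normSq k : ℂ) *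
    (-(v (-k)) * modeDeriv k (fun w => (F w : ℂ)) v
      + modeDeriv (-k) (modeDeriv k fun w => (F w : ℂ)) v)

/-- The antisymmetric part `c ∑_{m, l} K_{m, l} v_m v_l D_{-m-l} F` of the generator, where `c` is
the coupling constant. -/
def genAntiC (N : ℕ) (c : ℝ) (F : (Mode → ℂ) → ℝ) (v : Mode → ℂ) : ℂ :=
  (c : ℂ) * ∑ m ∈ box N, ∑ l ∈ box N,
    (kernel N m l : ℂ) * v m * v l * modeDeriv (-(m + l)) (fun w => (F w : ℂ)) v

/-- The generator on real cylinder functions (see `ofReal_gen` for the real part). -/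
def gen (N : ℕ) (c : ℝ) (F : (Mode → ℂ) → ℝ) (v : Mode → ℂ) : ℝ :=
  (genSymC F v + genAntiC N c F v).re

variable {Ω : Type*} [MeasurableSpace Ω]

/-- The graph of the generator on cylinder functions, in `L² × L²`. -/
def genGraphCyl (P : Measure Ω) (η : Mode → Ω → ℂ) (N : ℕ) (c : ℝ) :
    Set (Lp ℝ 2 P × Lp ℝ 2 P) :=
  {p | ∃ G : (Mode → ℂ) → ℝ, IsCylinder G ∧ (p.1 =ᵐ[P] fun ω => G fun k => η k ω) ∧
    p.2 =ᵐ[P] fun ω => gen N c G fun k => η k ω}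

/-- The graph of the generator in `L²`, the closure of its restriction to cylinder functions. -/
def genGraph (P : Measure Ω) (η : Mode → Ω → ℂ) (N : ℕ) (c : ℝ) :
    Set (Lp ℝ 2 P × Lp ℝ 2 P) :=
  closure (genGraphCyl P η N c)

/-- `U` is in the domain of the generator `L` and solves the resolvent equation `r U - L U = F`. -/
def SolvesResolvent (P : Measure Ω) (η : Mode → Ω → ℂ) (N : ℕ) (c r : ℝ) (F : Ω → ℝ)
    (U : Lp ℝ 2 P) : Prop :=
  ∃ W : Lp ℝ 2 P, (U, W) ∈ genGraph P η N c ∧ F =ᵐ[P] fun ω => r * U ω - W ω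

/-! ### The real parts above lose nothing -/

theorem conj_fourierCoef (φ : Torus2 → ℝ) (k : Mode) :
    conj (fourierCoef φ k) = fourierCoef φ (-k) := by
  unfold fourierCoef
  rw [← integral_conj]
  congr 1
  ext x
  have h2 : conj (2 : ℂ) = 2 := map_ofNat _ 2
  simp [basisFun, h2]

theorem neg_mem_box {N : ℕ} {k : Mode} : -k ∈ box N ↔ k ∈ box N := by
  simp only [box, Finset.mem_product, Finset.mem_Icc, Prod.fst_neg, Prod.snd_neg]
  omega

theorem kernel_neg (N : ℕ) (l m : Mode) : kernel N (-l) (-m) = kernel N l m := by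
  have h : -l + -m = -(l + m) := by abel
  have e : ∀ k : Mode, euclNorm (-k) = euclNorm k := fun k => by simp [euclNorm, normSq]
  have hc : cForm (-l) (-m) = cForm l m := by simp [cForm]
  simp only [kernel, h, neg_mem_box, e, hc, ne_eq, neg_eq_zero]

theorem sum_box_neg (N : ℕ) (f : Mode → ℂ) : ∑ k ∈ box N, f (-k) = ∑ k ∈ box N, f k :=
  Finset.sum_equiv (Equiv.neg Mode) (fun _ => by simp [neg_mem_box]) (fun _ _ => by simp)

theorem conj_modeDeriv (F : (Mode → ℂ) → ℂ) (k : Mode) (v : Mode → ℂ) :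
    conj (modeDeriv k F v) = modeDeriv (-k) (fun w => conj (F w)) v := by
  have h1 : reDir (-k) = reDir k := by
    ext j; simp [reDir, add_comm]
  have h2 : imDir (-k) = -imDir k := by
    ext j; simp only [imDir, neg_neg, Pi.neg_apply]; ring
  have h3 : ∀ d, lineDeriv ℝ (fun w => conj (F w)) v d = conj (lineDeriv ℝ F v d) := fun d => by
    exact deriv.star (f := fun t : ℝ => F (v + t • d)) (x := 0)
  rw [modeDeriv, modeDeriv, h1, h2, lineDeriv_neg, h3, h3]
  simp

theorem ofReal_nonlin (N : ℕ) (φ : Torus2 → ℝ) (v : Mode → ℂ) (hv : ∀ k, v (-k) = conj (v k)) :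
    (nonlin N φ v : ℂ) = nonlinC N φ v := by
  refine Complex.conj_eq_iff_re.1 ?_
  unfold nonlinC
  rw [map_sum, ← sum_box_neg]
  refine Finset.sum_congr rfl fun l _ => ?_
  rw [map_sum, ← sum_box_neg]
  refine Finset.sum_congr rfl fun m _ => ?_
  have h : -(l + m) = -l + -m := by abel
  simp [kernel_neg, hv, conj_fourierCoef, h]

theorem ofReal_gen (N : ℕ) (c : ℝ) (F : (Mode → ℂ) → ℝ) (v : Mode → ℂ)
    (hv : ∀ k, v (-k) = conj (v k)) :
    (gen N c F v : ℂ) = genSymC F v + genAntiC N c F v := by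
  refine Complex.conj_eq_iff_re.1 ?_
  rw [map_add]
  congr 1
  · unfold genSymC
    rw [map_mul, Complex.conj_tsum, ← (Equiv.neg Mode).tsum_eq]
    have h2 : conj (2 : ℂ) = 2 := map_ofNat _ 2
    congr 1
    · simp [h2]
    · refine tsum_congr fun k => ?_
      have hn : normSq (-k) = normSq k := by simp [normSq]
      simp [conj_modeDeriv, hn, hv]
  · unfold genAntiC
    rw [map_mul, map_sum, ← sum_box_neg]
    congr 1
    · simp
    · refine Finset.sum_congr rfl fun m _ => ?_
      rw [map_sum, ← sum_box_neg]
      refine Finset.sum_congr rfl fun l _ => ?_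
      have h : -(-m + -l) = m + l := by abel
      have h' : -(m + l) = -m + -l := by abel
      simp [kernel_neg, hv, conj_modeDeriv, h, h']

end AKPZ

end

/-! The bound is a variational one. Write `F` for the right-hand side and `U` for the solution. The
form E[F U] equals r‖U‖² plus the Dirichlet energy when `U` is a cylinder function, because the
antisymmetric part of the generator drops out. Hence if a test function `G` satisfies |E[(r - L)V ·
G]| ≤ κ √(r‖V‖² + energy(V)) for all real cylinder `V`, then E[F G]² ≤ κ² E[F U]; this survives the
closure of the graph (`norm_inner_test_sq_le`). No knowledge of `U` is needed, only one good `G`.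

The choice is the quadratic Wick functional with coefficients c φ_{-(l+m)} K_{l,m} / (|l|² + |m|² +
r), essentially the symmetric resolvent applied to `F`. Its pairing with `F` is 2c² `testEnergy`
(`expect_nonlinCyl_mul`), and `testEnergy` is at least a multiple of ‖φ‖² log N for large N, by
summing over a cone where the kernel does not degenerate (`eventually_le_sum_kernel_sq`). On the
other side, κ² is bounded by a constant times ‖φ‖² (`testConst_le`): integration by parts moves the
antisymmetric part onto `G` and leaves one derivative on `V`, so the result enters only through a
norm of order -1. Each use of the coupling c² comes with one lattice sum of 1/|k|² over the box, of
order log N, and c² log N tends to C. The part of degree one would diverge but for a cancellation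
between two kernels (`abs_kernel_add_kernel_le`).

Solvability: the generator is dissipative, so r - L has closed range, and it remains to see that `F`
is orthogonal to every h orthogonal to the range. Decompose h along the degree of polynomials in the
modes of the box. The symmetric part grows at least linearly in the degree n, while the
antisymmetric part raises the degree by at most one, at cost n^{3/2}. The flux identity between
consecutive degrees then forces a nonsummable lower bound unless all components vanish
(`inner_eq_zero_of_filtered`, `eq_zero_of_growth`). -/

noncomputable section

namespace AKPZ

/-! ### The algebra of complex cylinder functions -/

/-- The cylinder functions of the modes in `S`. -/
def CylinderOn (S : Finset Mode) (F : (Mode → ℂ) → ℂ) : Prop :=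
  ∃ f : (S → ℂ) → ℂ, Function.HasTemperateGrowth f ∧ ∀ v : Mode → ℂ, F v = f fun k => v k

theorem hasTemperateGrowth_fderiv {E F : Type*} [NormedAddCommGroup E] [NormedSpace ℝ E]
    [NormedAddCommGroup F] [NormedSpace ℝ F] {f : E → F} (hf : f.HasTemperateGrowth) :
    (fderiv ℝ f).HasTemperateGrowth := by
  refine ⟨hf.1.fderiv_right (by simp), fun n => ?_⟩
  obtain ⟨k, C, h⟩ := hf.2 (n + 1)
  exact ⟨k, C, fun x => by rw [norm_iteratedFDeriv_fderiv]; exact h x⟩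

theorem CylinderOn.mono {S T : Finset Mode} (h : S ⊆ T) {F : (Mode → ℂ) → ℂ}
    (hF : CylinderOn S F) : CylinderOn T F := by
  obtain ⟨f, hf, hFf⟩ := hF
  let L : (T → ℂ) →L[ℝ] (S → ℂ) :=
    ContinuousLinearMap.pi fun k => ContinuousLinearMap.proj (⟨k, h k.2⟩ : T)
  refine ⟨fun w => f (L w), hf.comp L.hasTemperateGrowth, fun v => ?_⟩
  rw [hFf]
  rfl

theorem CylinderOn.comp₂ {S : Finset Mode} {F G : (Mode → ℂ) → ℂ} {op : ℂ → ℂ → ℂ}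
    (hop : ∀ f g : (S → ℂ) → ℂ, f.HasTemperateGrowth → g.HasTemperateGrowth →
      (fun w => op (f w) (g w)).HasTemperateGrowth)
    (hF : CylinderOn S F) (hG : CylinderOn S G) : CylinderOn S fun v => op (F v) (G v) := by
  obtain ⟨f, hf, hFf⟩ := hF
  obtain ⟨g, hg, hGg⟩ := hG
  exact ⟨_, hop f g hf hg, fun v => by simp only [hFf, hGg]⟩

theorem CylinderOn.conj {S : Finset Mode} {F : (Mode → ℂ) → ℂ} (hF : CylinderOn S F) :
    CylinderOn S fun v => conj (F v) := by
  obtain ⟨f, hf, hFf⟩ := hF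
  exact ⟨fun w => Complex.conjCLE (f w), Complex.conjCLE.hasTemperateGrowth.comp hf,
    fun v => by simp only [hFf]; rfl⟩

theorem CylinderOn.hasLineDerivAt {S : Finset Mode} {F : (Mode → ℂ) → ℂ} {f : (S → ℂ) → ℂ}
    (hf : f.HasTemperateGrowth) (hF : ∀ v : Mode → ℂ, F v = f fun k => v k) (v d : Mode → ℂ) :
    HasLineDerivAt ℝ F (fderiv ℝ f (fun k => v k) fun k => d k) v d := by
  have h := ((hf.1.differentiable (by simp)).differentiableAt
    (x := fun k : S => v k)).hasFDerivAt.hasLineDerivAt (fun k : S => d k)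
  have e : F = fun v : Mode → ℂ => f fun k : S => v k := funext hF
  rw [e]
  exact h

theorem CylinderOn.lineDeriv {S : Finset Mode} {F : (Mode → ℂ) → ℂ} (hF : CylinderOn S F)
    (d : Mode → ℂ) : CylinderOn S fun v => lineDeriv ℝ F v d := by
  obtain ⟨f, hf, hFf⟩ := hF
  refine ⟨fun w => fderiv ℝ f w fun k => d k, ?_,
    fun v => (CylinderOn.hasLineDerivAt hf hFf v d).lineDeriv⟩
  have h := hasTemperateGrowth_fderiv hf
  exact (ContinuousLinearMap.apply ℝ ℂ (fun k : S => d k)).hasTemperateGrowth.comp h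

theorem CylinderOn.lineDifferentiableAt {S : Finset Mode} {F : (Mode → ℂ) → ℂ}
    (hF : CylinderOn S F) (v d : Mode → ℂ) : LineDifferentiableAt ℝ F v d := by
  obtain ⟨f, hf, hFf⟩ := hF
  exact (CylinderOn.hasLineDerivAt hf hFf v d).lineDifferentiableAt

theorem CylinderOn.modeDeriv {S : Finset Mode} {F : (Mode → ℂ) → ℂ} (hF : CylinderOn S F)
    (k : Mode) : CylinderOn S (modeDeriv k F) := by
  refine CylinderOn.comp₂ (op := fun a b => a - Complex.I * b) (fun f g hf hg => by fun_prop)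
    (hF.lineDeriv _) (hF.lineDeriv _)

/-- Both k and -k must avoid `S`, because the two real directions that make up D_k are supported on
the pair {k, -k}. -/
theorem CylinderOn.modeDeriv_eq_zero {S : Finset Mode} {F : (Mode → ℂ) → ℂ} (hF : CylinderOn S F)
    {k : Mode} (hk : k ∉ S) (hk' : -k ∉ S) (v : Mode → ℂ) : AKPZ.modeDeriv k F v = 0 := by
  obtain ⟨f, hf, hFf⟩ := hF
  have e : ∀ j : S, (j : Mode) ≠ k ∧ (j : Mode) ≠ -k :=
    fun j => ⟨fun h => hk (h ▸ j.2), fun h => hk' (h ▸ j.2)⟩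
  have h1 : (fun j : S => reDir k j) = 0 := by
    ext j; simp [reDir, (e j).1, (e j).2]
  have h2 : (fun j : S => imDir k j) = 0 := by
    ext j; simp [imDir, (e j).1, (e j).2]
  rw [AKPZ.modeDeriv, (CylinderOn.hasLineDerivAt hf hFf v _).lineDeriv,
    (CylinderOn.hasLineDerivAt hf hFf v _).lineDeriv, h1, h2]
  simp

/-- The algebra of complex cylinder functions. -/
def cyl : Subalgebra ℂ ((Mode → ℂ) → ℂ) where
  carrier := {F | ∃ S, CylinderOn S F}
  mul_mem' := by
    rintro F G ⟨S, hF⟩ ⟨T, hG⟩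
    exact ⟨S ∪ T, CylinderOn.comp₂ (op := (· * ·)) (fun f g hf hg => hf.mul hg)
      (hF.mono Finset.subset_union_left) (hG.mono Finset.subset_union_right)⟩
  add_mem' := by
    rintro F G ⟨S, hF⟩ ⟨T, hG⟩
    exact ⟨S ∪ T, CylinderOn.comp₂ (op := (· + ·)) (fun f g hf hg => hf.add hg)
      (hF.mono Finset.subset_union_left) (hG.mono Finset.subset_union_right)⟩
  algebraMap_mem' c := ⟨∅, fun _ => c, by fun_prop, fun _ => rfl⟩

theorem lineDifferentiableAt_cyl (F : cyl) (v d : Mode → ℂ) :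
    LineDifferentiableAt ℝ (F : (Mode → ℂ) → ℂ) v d := by
  obtain ⟨S, hS⟩ := F.2
  exact hS.lineDifferentiableAt v d

theorem lineDeriv_mul_cyl (F G : cyl) (v d : Mode → ℂ) :
    lineDeriv ℝ ((F * G : cyl) : (Mode → ℂ) → ℂ) v d =
      F.1 v * lineDeriv ℝ G.1 v d + G.1 v * lineDeriv ℝ F.1 v d := by
  have hF := lineDifferentiableAt_cyl F v d
  have hG := lineDifferentiableAt_cyl G v d
  have h := deriv_fun_mul hF hG
  simp only [zero_smul, add_zero] at h
  unfold lineDeriv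
  refine Eq.trans ?_ (h.trans (by ring))
  rfl

theorem modeDeriv_add_cyl (k : Mode) (F G : cyl) (v : Mode → ℂ) :
    modeDeriv k ((F + G : cyl) : (Mode → ℂ) → ℂ) v = modeDeriv k F.1 v + modeDeriv k G.1 v := by
  have h : ∀ d, lineDeriv ℝ ((F + G : cyl) : (Mode → ℂ) → ℂ) v d =
      lineDeriv ℝ F.1 v d + lineDeriv ℝ G.1 v d := fun d =>
    deriv_fun_add (lineDifferentiableAt_cyl F v d) (lineDifferentiableAt_cyl G v d)
  simp only [modeDeriv, h]
  ring

/-- The derivation `D_k` of the algebra of cylinder functions. -/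
def D (k : Mode) : Derivation ℂ cyl cyl :=
  Derivation.mk'
    { toFun := fun F => ⟨modeDeriv k F, by
        obtain ⟨S, hS⟩ := F.2
        exact ⟨S, hS.modeDeriv k⟩⟩
      map_add' := fun F G => Subtype.ext <| funext fun v => modeDeriv_add_cyl k F G v
      map_smul' := fun c F => Subtype.ext <| funext fun v => by
        have h : ∀ d, lineDeriv ℝ ((c • F : cyl) : (Mode → ℂ) → ℂ) v d =
            c * lineDeriv ℝ F.1 v d := fun d =>
          deriv_const_mul c (lineDifferentiableAt_cyl F v d)
        change modeDeriv k ((c • F : cyl) : (Mode → ℂ) → ℂ) v = c * modeDeriv k F.1 v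
        simp only [modeDeriv, h]
        ring }
    fun F G => Subtype.ext <| funext fun v => by
      change modeDeriv k ((F * G : cyl) : (Mode → ℂ) → ℂ) v =
        F.1 v * modeDeriv k G.1 v + G.1 v * modeDeriv k F.1 v
      simp only [modeDeriv, lineDeriv_mul_cyl]
      ring

theorem D_apply (k : Mode) (F : cyl) (v : Mode → ℂ) : (D k F).1 v = modeDeriv k F.1 v := rfl

/-- The coordinate `v ↦ v_k`. -/
def X (k : Mode) : cyl :=
  ⟨fun v => v k, {k}, fun w => w ⟨k, Finset.mem_singleton_self k⟩,
    (ContinuousLinearMap.proj (R := ℝ) (φ := fun _ : ({k} : Finset Mode) => ℂ)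
      ⟨k, Finset.mem_singleton_self k⟩).hasTemperateGrowth, fun _ => rfl⟩

theorem X_apply (k : Mode) (v : Mode → ℂ) : (X k).1 v = v k := rfl

theorem D_X (k j : Mode) : D k (X j) = if j + k = 0 then 1 else 0 := by
  have h : ∀ v d : Mode → ℂ, lineDeriv ℝ (X j).1 v d = d j := fun v d => by
    have h1 : HasDerivAt (fun t : ℝ => v j + t • d j) (d j) 0 := by
      simpa using ((hasDerivAt_id (0 : ℝ)).smul_const (d j)).const_add (v j)
    exact h1.deriv
  refine Subtype.ext (funext fun v => ?_)
  rw [D_apply, modeDeriv, h, h, reDir, imDir]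
  have e : ((if j + k = 0 then 1 else 0 : cyl) : (Mode → ℂ) → ℂ) v =
      if j = -k then 1 else 0 := by
    simp only [add_eq_zero_iff_eq_neg]
    split_ifs <;> rfl
  rw [e]
  have hI : ∀ z : ℂ, Complex.I * (z / (2 * Complex.I)) = z / 2 := fun z => by
    field_simp [Complex.I_ne_zero]
  rw [hI]
  ring

/-- Complex conjugation of cylinder functions. -/
def cconj (F : cyl) : cyl := ⟨fun v => conj (F.1 v), by
  obtain ⟨S, hS⟩ := F.2
  exact ⟨S, hS.conj⟩⟩

theorem cconj_apply (F : cyl) (v : Mode → ℂ) : (cconj F).1 v = conj (F.1 v) := rfl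

theorem D_cconj (k : Mode) (F : cyl) : D k (cconj F) = cconj (D (-k) F) := by
  refine Subtype.ext (funext fun v => ?_)
  rw [cconj_apply, D_apply, D_apply, conj_modeDeriv, neg_neg]
  rfl

/-- Such a `T` turns the infinite sum in the symmetric part of the generator into a finite one. -/
theorem exists_D_eq_zero (F : cyl) : ∃ T : Finset Mode, ∀ k, k ∉ T → D k F = 0 := by
  obtain ⟨S, hS⟩ := F.2
  refine ⟨S ∪ S.image Neg.neg, fun k hk => Subtype.ext (funext fun v => ?_)⟩
  simp only [Finset.mem_union, Finset.mem_image, not_or, not_exists, not_and] at hk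
  exact hS.modeDeriv_eq_zero hk.1 (fun h => hk.2 _ h (neg_neg k)) v

/-- Real cylinder functions, as complex ones. -/
theorem IsCylinder.mem_cyl {F : (Mode → ℂ) → ℝ} (hF : IsCylinder F) :
    (fun v => (F v : ℂ)) ∈ cyl := by
  obtain ⟨S, f, hf, hFf⟩ := hF
  exact ⟨S, fun w => (f w : ℂ), Complex.ofRealCLM.hasTemperateGrowth.comp hf,
    fun v => by simp only [hFf]⟩

theorem isCylinder_re (F : cyl) : IsCylinder fun v => (F.1 v).re := by
  obtain ⟨S, f, hf, hFf⟩ := F.2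
  exact ⟨S, fun w => (f w).re, Complex.reCLM.hasTemperateGrowth.comp hf, fun v => by simp only [hFf]⟩

/-! ### Gaussian integration by parts -/

/-- The exponent is k + 1 rather than k so that it can be cancelled in 2(k + 1)/(k + 1) even when k
= 0. -/
theorem memLp_two_one_add_pow {Ω E : Type*} [MeasurableSpace Ω] {P : Measure Ω}
    [IsFiniteMeasure P] [NormedAddCommGroup E] {Z : Ω → E} (k : ℕ)
    (hZ : MemLp Z (2 * (k + 1 : ℕ)) P) : MemLp (fun ω => (1 + ‖Z ω‖) ^ (k + 1)) 2 P := by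
  have h0 : ∀ p, MemLp Z p P → MemLp (fun ω => 1 + ‖Z ω‖) p P :=
    fun p h => (memLp_const (1 : ℝ)).add h.norm
  have h1 := h0 _ hZ
  have h2 := h1.norm_rpow_div ((k + 1 : ℕ) : ENNReal)
  rw [ENNReal.mul_div_cancel_right (Nat.cast_ne_zero.2 k.succ_ne_zero)
    (ENNReal.natCast_ne_top _)] at h2
  refine h2.congr_norm ?_ (ae_of_all _ fun ω => ?_)
  · exact (h1.aestronglyMeasurable.pow (k + 1))
  · rw [ENNReal.toReal_natCast, Real.rpow_natCast, norm_pow, norm_pow, norm_norm]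

/-- A Gaussian vector has moments of every order, so polynomial growth is square integrable. -/
theorem memLp_two_temperateGrowth_comp {Ω E F : Type*} [MeasurableSpace Ω] {P : Measure Ω}
    [NormedAddCommGroup E] [NormedSpace ℝ E] [MeasurableSpace E] [BorelSpace E] [CompleteSpace E]
    [SecondCountableTopology E] [NormedAddCommGroup F] [NormedSpace ℝ F]
    {Z : Ω → E} (hZ : HasGaussianLaw Z P)
    {f : E → F} (hf : f.HasTemperateGrowth) : MemLp (fun ω => f (Z ω)) 2 P := by
  have := hZ.isProbabilityMeasure
  obtain ⟨k, C, hC, h⟩ := hf.norm_iteratedFDeriv_le_uniform 0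
  have h2 := memLp_two_one_add_pow k
    (hZ.memLp (ENNReal.mul_ne_top ENNReal.ofNat_ne_top (ENNReal.natCast_ne_top _)))
  refine h2.of_le_mul (c := C)
    (hf.1.continuous.comp_aestronglyMeasurable hZ.aemeasurable.aestronglyMeasurable)
    (ae_of_all _ fun ω => ?_)
  have h3 := h 0 le_rfl (Z ω)
  rw [norm_iteratedFDeriv_zero] at h3
  refine h3.trans (mul_le_mul_of_nonneg_left ?_ hC)
  have h4 : (1 : ℝ) ≤ 1 + ‖Z ω‖ := by linarith [norm_nonneg (Z ω)]
  rw [norm_pow, Real.norm_of_nonneg (by linarith)]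
  exact pow_le_pow_right₀ h4 (Nat.le_succ k)

theorem integral_mul_gaussianReal {s : NNReal} (hs : s ≠ 0) {g : ℝ → ℂ}
    (hg : g.HasTemperateGrowth) :
    ∫ x, (x : ℂ) * g x ∂(gaussianReal 0 s) = s * ∫ x, deriv g x ∂(gaussianReal 0 s) := by
  have hid : HasGaussianLaw (fun x : ℝ => x) (gaussianReal 0 s) := IsGaussian.hasGaussianLaw_id
  have hint : ∀ f : ℝ → ℂ, f.HasTemperateGrowth →
      Integrable (fun x => (gaussianPDFReal 0 s x : ℂ) * f x) := fun f hf => by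
    have h := (memLp_two_temperateGrowth_comp hid hf).integrable (by simp)
    rw [gaussianReal_of_var_ne_zero _ hs, integrable_withDensity_iff_integrable_smul'
      (measurable_gaussianPDF 0 s) (ae_of_all _ fun _ => gaussianPDF_lt_top)] at h
    simpa [toReal_gaussianPDF] using h
  have hg' : (deriv g).HasTemperateGrowth :=
    ((ContinuousLinearMap.apply ℝ ℂ (1 : ℝ)).hasTemperateGrowth.comp
      (hasTemperateGrowth_fderiv hg))
  have hs' : (s : ℝ) ≠ 0 := by exact_mod_cast hs
  -- The density ρ satisfies (-sρ)' = xρ, which reduces the claim to integration by parts on the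
  -- line.
  have hpdf : ∀ x, HasDerivAt (fun x => ((-s * gaussianPDFReal 0 s x : ℝ) : ℂ))
      ((x * gaussianPDFReal 0 s x : ℝ) : ℂ) x := fun x => by
    refine HasDerivAt.ofReal_comp ?_
    have h1 : HasDerivAt (fun x : ℝ => -(x - 0) ^ 2 / (2 * (s : ℝ))) (-(x / s)) x := by
      have := (((hasDerivAt_id x).sub_const 0).pow 2).neg.div_const (2 * (s : ℝ))
      refine this.congr_deriv ?_
      simp
      field_simp
    refine ((h1.exp.const_mul (√(2 * Real.pi * s))⁻¹).const_mul (-(s : ℝ))).congr_deriv ?_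
    rw [gaussianPDFReal]
    field_simp
  have hx : (fun x : ℝ => (x : ℂ)).HasTemperateGrowth := Complex.ofRealCLM.hasTemperateGrowth
  have key := integral_mul_deriv_eq_deriv_mul_of_integrable (u := g) (u' := deriv g)
    (v := fun x => ((-s * gaussianPDFReal 0 s x : ℝ) : ℂ))
    (v' := fun x => ((x * gaussianPDFReal 0 s x : ℝ) : ℂ))
    (fun x _ => ((hg.1.differentiable (by simp)) x).hasDerivAt) (fun x _ => hpdf x)
    ((hint _ (hx.mul hg)).congr (ae_of_all _ fun x => by simp; ring))
    (((hint _ hg').const_mul (-(s : ℂ))).congr (ae_of_all _ fun x => by simp; ring))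
    (((hint _ hg).const_mul (-(s : ℂ))).congr (ae_of_all _ fun x => by simp; ring))
  rw [integral_gaussianReal_eq_integral_smul hs, integral_gaussianReal_eq_integral_smul hs,
    ← integral_const_mul]
  refine Eq.trans (integral_congr_ae (ae_of_all _ fun x => ?_))
    (key.trans (Eq.trans (integral_neg _).symm (integral_congr_ae (ae_of_all _ fun x => ?_))))
  · simp; ring
  · simp; ring

variable {Ω : Type*} [MeasurableSpace Ω] {P : Measure Ω}

/-- Integration by parts with respect to a real component `ξ` of a jointly Gaussian family. -/
theorem integral_mul_gaussian {E : Type*} [NormedAddCommGroup E] [NormedSpace ℝ E]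
    [MeasurableSpace E] [BorelSpace E] [CompleteSpace E] [SecondCountableTopology E]
    {ξ : Ω → ℝ} {Z : Ω → E} (hG : HasGaussianLaw (fun ω => (ξ ω, Z ω)) P)
    (h0 : ∫ ω, ξ ω ∂P = 0) {s : NNReal} (hs : s ≠ 0) (hv : ∫ ω, ξ ω ^ 2 ∂P = s)
    {d : E} (hd : ∫ ω, ξ ω • Z ω ∂P = d) {f : E → ℂ} (hf : f.HasTemperateGrowth) :
    ∫ ω, (ξ ω : ℂ) * f (Z ω) ∂P = ∫ ω, fderiv ℝ f (Z ω) d ∂P := by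
  have := hG.isProbabilityMeasure
  have hs' : (s : ℝ) ≠ 0 := by exact_mod_cast hs
  -- This is the regression coefficient of Z on ξ: the residual Y = Z - ξu is uncorrelated with ξ,
  -- hence independent of it by joint Gaussianity. Freezing Y leaves a one-dimensional integration
  -- by parts in ξ.
  set u : E := (s : ℝ)⁻¹ • d with hu
  have hξ : MemLp ξ 2 P := hG.fst.memLp_two
  have hZ : MemLp Z 2 P := hG.snd.memLp_two
  let Lm : ℝ × E →L[ℝ] ℝ × E :=
    (ContinuousLinearMap.fst ℝ ℝ E).prod
      (ContinuousLinearMap.snd ℝ ℝ E - (ContinuousLinearMap.fst ℝ ℝ E).smulRight u)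
  set Y : Ω → E := fun ω => Z ω - ξ ω • u with hY
  have hGY : HasGaussianLaw (fun ω => (ξ ω, Y ω)) P := hG.map_fun Lm
  have hξZ : Integrable (fun ω => ξ ω • Z ω) P := by
    have := hZ.smul (p := 2) (q := 2) (r := 1) hξ
    exact memLp_one_iff_integrable.1 this
  have hξ2 : Integrable (fun ω => ξ ω ^ 2) P := hξ.integrable_sq
  have hξY : ∫ ω, ξ ω • Y ω ∂P = 0 := by
    have e : ∀ ω, ξ ω • Y ω = ξ ω • Z ω - (ξ ω ^ 2) • u := fun ω => by
      simp only [hY, smul_sub, smul_smul, pow_two]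
    simp_rw [e]
    rw [integral_sub hξZ (hξ2.smul_const u), integral_smul_const, hd, hv, hu, smul_smul,
      mul_inv_cancel₀ hs', one_smul, sub_self]
  have hYm : MemLp Y 2 P := hGY.snd.memLp_two
  have hξYi : Integrable (fun ω => ξ ω • Y ω) P := by
    have := hYm.smul (p := 2) (q := 2) (r := 1) hξ
    exact memLp_one_iff_integrable.1 this
  have hind : IndepFun ξ Y P := by
    refine hGY.indepFun_of_covariance_strongDual fun L₁ L₂ => ?_
    rw [covariance_eq_sub (L₁.comp_memLp' hξ) (L₂.comp_memLp' hYm)]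
    have e1 : ∫ ω, (L₁ ∘ ξ) ω ∂P = 0 := by
      simp only [Function.comp_apply]
      rw [L₁.integral_comp_comm hG.fst.integrable, h0, map_zero]
    have e2 : ∫ ω, (L₁ ∘ ξ * L₂ ∘ Y) ω ∂P = 0 := by
      have e3 : ∀ ω, (L₁ ∘ ξ * L₂ ∘ Y) ω = L₁ 1 * L₂ (ξ ω • Y ω) := fun ω => by
        have : L₁ (ξ ω) = ξ ω * L₁ 1 := by
          rw [← smul_eq_mul, ← map_smul, smul_eq_mul, mul_one]
        simp [this]; ring
      simp_rw [e3]
      rw [integral_const_mul, L₂.integral_comp_comm hξYi, hξY, map_zero, mul_zero]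
    rw [e1, e2, zero_mul, sub_zero]
  have hlaw := (indepFun_iff_map_prod_eq_prod_map_map hG.fst.aemeasurable
    hGY.snd.aemeasurable).1 hind
  have hvar : P.map ξ = gaussianReal 0 s := by
    rw [hG.fst.map_eq_gaussianReal, h0, variance_of_integral_eq_zero hG.fst.aemeasurable h0]
    simp [hv]
  have hZY : ∀ ω, Z ω = ξ ω • u + Y ω := fun ω => by simp [hY]
  have hae : AEMeasurable (fun ω => (ξ ω, Y ω)) P := hGY.aemeasurable
  have step : ∀ g : ℝ × E → ℂ, g.HasTemperateGrowth →
      ∫ ω, g (ξ ω, Y ω) ∂P = ∫ y, ∫ x, g (x, y) ∂(gaussianReal 0 s) ∂(P.map Y) := fun g hg => by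
    have hi : Integrable (fun ω => g (ξ ω, Y ω)) P :=
      (memLp_two_temperateGrowth_comp hGY hg).integrable (by simp)
    have := Measure.isProbabilityMeasure_map (μ := P) hGY.snd.aemeasurable
    have hsm : AEStronglyMeasurable g (P.map fun ω => (ξ ω, Y ω)) :=
      hg.1.continuous.aestronglyMeasurable
    rw [← integral_map hae hsm]
    rw [← hvar, ← integral_prod_symm, ← hlaw]
    rw [← hlaw]
    exact (integrable_map_measure hsm hae).2 hi
  let A : ℝ × E →L[ℝ] E :=
    (ContinuousLinearMap.fst ℝ ℝ E).smulRight u + ContinuousLinearMap.snd ℝ ℝ E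
  have hfA : (fun z => f (A z)).HasTemperateGrowth := hf.comp A.hasTemperateGrowth
  have hx : (fun z : ℝ × E => (z.1 : ℂ)).HasTemperateGrowth :=
    (Complex.ofRealCLM.comp (ContinuousLinearMap.fst ℝ ℝ E)).hasTemperateGrowth
  have hfd : (fun z => fderiv ℝ f (A z) d).HasTemperateGrowth :=
    (ContinuousLinearMap.apply ℝ ℂ d).hasTemperateGrowth.comp
      ((hasTemperateGrowth_fderiv hf).comp A.hasTemperateGrowth)
  have e1 := step _ (hx.mul hfA)
  have e2 := step _ hfd
  have hAZ : ∀ ω, A (ξ ω, Y ω) = Z ω := fun ω => (hZY ω).symm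
  simp only [Pi.mul_apply, hAZ] at e1 e2
  rw [e1, e2]
  refine integral_congr_ae (ae_of_all _ fun y => ?_)
  have hAy : ∀ x, A (x, y) = x • u + y := fun x => rfl
  let B : ℝ →L[ℝ] E := (ContinuousLinearMap.id ℝ ℝ).smulRight u
  have hgy : (fun x : ℝ => f (A (x, y))).HasTemperateGrowth :=
    hf.comp (B.hasTemperateGrowth.add (Function.HasTemperateGrowth.const y))
  have hder : ∀ x, deriv (fun x : ℝ => f (A (x, y))) x = fderiv ℝ f (A (x, y)) u := fun x => by
    have h1 : HasDerivAt (fun x : ℝ => A (x, y)) u x := by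
      simpa [hAy] using ((hasDerivAt_id x).smul_const u).add_const y
    exact ((hf.1.differentiable (by simp) _).hasFDerivAt.comp_hasDerivAt x h1).deriv
  simp only
  -- The variance s produced in one dimension turns the direction u back into s u = d.
  rw [integral_mul_gaussianReal hs hgy, ← integral_const_mul]
  refine integral_congr_ae (ae_of_all _ fun x => ?_)
  simp only [hder]
  rw [hu, map_smul, Complex.real_smul]
  push_cast
  rw [mul_inv_cancel_left₀ (by exact_mod_cast hs')]

/-! ### Expectations of cylinder functions of the white noise -/

/-- The modes of a real function of mean zero. -/
def IsRealMode (v : Mode → ℂ) : Prop := v 0 = 0 ∧ ∀ k, v (-k) = conj (v k)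

/-- The direction `E[Re (w η_k) η]`. -/
def gaussDir (w : ℂ) (k : Mode) : Mode → ℂ := fun j =>
  (w * (if j = -k then 1 else 0) + conj w * (if j = k then 1 else 0)) / 2

section

variable {Ω : Type*} [MeasurableSpace Ω] {P : Measure Ω} {η : Mode → Ω → ℂ}

theorem IsWhiteNoise.ae_isRealMode (hη : IsWhiteNoise P η) :
    ∀ᵐ ω ∂P, IsRealMode fun k => η k ω := by
  filter_upwards [hη.zero_mode, ae_all_iff.2 hη.conj_mode] with ω h0 h using ⟨h0, h⟩

theorem IsWhiteNoise.memLp_cylinderOn (hη : IsWhiteNoise P η) {S : Finset Mode}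
    {F : (Mode → ℂ) → ℂ} (hF : CylinderOn S F) : MemLp (fun ω => F fun k => η k ω) 2 P := by
  obtain ⟨f, hf, hFf⟩ := hF
  simp only [hFf]
  exact memLp_two_temperateGrowth_comp (hη.gaussian.hasGaussianLaw S) hf

theorem IsWhiteNoise.memLp_cyl (hη : IsWhiteNoise P η) (F : cyl) :
    MemLp (fun ω => F.1 fun k => η k ω) 2 P := by
  obtain ⟨S, hS⟩ := F.2
  exact hη.memLp_cylinderOn hS

theorem IsWhiteNoise.memLp_mode (hη : IsWhiteNoise P η) (k : Mode) : MemLp (η k) 2 P :=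
  hη.memLp_cyl (X k)

theorem IsWhiteNoise.integrable_cyl (hη : IsWhiteNoise P η) (F : cyl) :
    Integrable (fun ω => F.1 fun k => η k ω) P := by
  have := hη.gaussian.isProbabilityMeasure
  exact (hη.memLp_cyl F).integrable (by simp)

theorem IsWhiteNoise.integrable_mode_mul (hη : IsWhiteNoise P η) (j k : Mode) :
    Integrable (fun ω => η j ω * η k ω) P := hη.integrable_cyl (X j * X k)

theorem IsWhiteNoise.integral_re_mul (hη : IsWhiteNoise P η) (w : ℂ) {k : Mode} (hk : k ≠ 0)
    (j : Mode) : ∫ ω, (w * η k ω).re • η j ω ∂P = gaussDir w k j := by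
  have e : ∀ᵐ ω ∂P, (w * η k ω).re • η j ω =
      w / 2 * (η k ω * η j ω) + conj w / 2 * (η (-k) ω * η j ω) := by
    filter_upwards [hη.conj_mode k] with ω h
    rw [h, Complex.real_smul, Complex.re_eq_add_conj, map_mul]
    ring
  rw [integral_congr_ae e, integral_add ((hη.integrable_mode_mul _ _).const_mul _)
    ((hη.integrable_mode_mul _ _).const_mul _), integral_const_mul, integral_const_mul,
    hη.covariance, hη.covariance, gaussDir]
  have h1 : (k + j = 0 ∧ j ≠ 0) ↔ j = -k := by
    rw [add_comm, add_eq_zero_iff_eq_neg]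
    exact ⟨fun h => h.1, fun h => ⟨h, by rw [h]; exact neg_ne_zero.2 hk⟩⟩
  have h2 : (-k + j = 0 ∧ j ≠ 0) ↔ j = k := by
    rw [neg_add_eq_zero]
    exact ⟨fun h => h.1.symm, fun h => ⟨h.symm, by rw [h]; exact hk⟩⟩
  simp only [h1, h2]
  ring

/-- For |w| = 1 the variable Re(w η_k) is a real Gaussian of variance 1/2. The cases w = 1 and w = i
give the two real components of η_k, from which D_k is assembled. -/
theorem IsWhiteNoise.integral_lineDeriv (hη : IsWhiteNoise P η) {w : ℂ} (hw : ‖w‖ = 1) {k : Mode}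
    (hk : k ≠ 0) (F : cyl) :
    ∫ ω, ((w * η k ω).re : ℂ) * F.1 (fun j => η j ω) ∂P =
      ∫ ω, lineDeriv ℝ F.1 (fun j => η j ω) (gaussDir w k) ∂P := by
  obtain ⟨S, f, hf, hFf⟩ := F.2
  let T : Finset Mode := insert k S
  have hkT : k ∈ T := Finset.mem_insert_self k S
  have hST : ∀ j : S, (j : Mode) ∈ T := fun j => Finset.mem_insert_of_mem j.2
  let L : (T → ℂ) →L[ℝ] ℝ × (S → ℂ) :=
    (Complex.reCLM.comp ((ContinuousLinearMap.mul ℝ ℂ w).comp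
      (ContinuousLinearMap.proj (R := ℝ) (φ := fun _ : T => ℂ) ⟨k, hkT⟩))).prod
      (ContinuousLinearMap.pi fun j =>
        ContinuousLinearMap.proj (R := ℝ) (φ := fun _ : T => ℂ) ⟨j, hST j⟩)
  have hG : HasGaussianLaw (fun ω => ((w * η k ω).re, fun j : S => η j ω)) P :=
    (hη.gaussian.hasGaussianLaw T).map_fun L
  have hprob := hG.isProbabilityMeasure
  have hm : ∀ j, Integrable (η j) P := fun j => (hη.memLp_mode j).integrable (by simp)
  have hwk : MemLp (fun ω => w * η k ω) 2 P := (hη.memLp_mode k).const_mul w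
  have h0 : ∫ ω, (w * η k ω).re ∂P = 0 := by
    have := integral_re (𝕜 := ℂ) ((hm k).const_mul w)
    rw [integral_const_mul, hη.centred, mul_zero] at this
    simpa using this
  have hre : MemLp (fun ω => (w * η k ω).re) 2 P := hwk.re
  have hint : ∀ j, Integrable (fun ω => (w * η k ω).re • η j ω) P := fun j =>
    memLp_one_iff_integrable.1 ((hη.memLp_mode j).smul (p := 2) (q := 2) (r := 1) hre)
  have hv : ∫ ω, (w * η k ω).re ^ 2 ∂P = ((2⁻¹ : NNReal) : ℝ) := by
    have e : ∀ ω, (w * η k ω).re ^ 2 = (w * ((w * η k ω).re • η k ω)).re := fun ω => by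
      rw [mul_smul_comm, Complex.smul_re, smul_eq_mul, sq]
    simp_rw [e]
    have := integral_re (𝕜 := ℂ) ((hint k).const_mul w)
    simp only [RCLike.re_to_complex] at this
    rw [this, integral_const_mul, hη.integral_re_mul w hk, gaussDir]
    have hkk : k ≠ -k := fun h => hk (by
      have h1 := congrArg Prod.fst h
      have h2 := congrArg Prod.snd h
      simp only [Prod.fst_neg, Prod.snd_neg] at h1 h2
      exact Prod.ext (by simp; omega) (by simp; omega))
    rw [if_neg hkk, if_pos rfl]
    have h3 : w * conj w = 1 := by
      rw [Complex.mul_conj, Complex.normSq_eq_norm_sq, hw]; simp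
    rw [mul_zero, zero_add, mul_one, ← mul_div_assoc, h3]
    norm_num
  have hd : ∫ ω, (w * η k ω).re • (fun j : S => η j ω) ∂P = fun j : S => gaussDir w k j := by
    ext j
    have := eval_integral (μ := P) (f := fun ω => (w * η k ω).re • (fun j : S => η j ω))
      (fun i => hint i) j
    exact this.trans (hη.integral_re_mul w hk j)
  have key := integral_mul_gaussian hG h0 (by norm_num) hv hd hf
  simp only [hFf]
  rw [key]
  refine integral_congr_ae (ae_of_all _ fun ω => ?_)
  exact (CylinderOn.hasLineDerivAt hf hFf (fun j => η j ω) (gaussDir w k)).lineDeriv.symm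

theorem gaussDir_one (k : Mode) : gaussDir 1 k = reDir k := by
  ext j; simp [gaussDir, reDir, add_comm]

theorem gaussDir_I (k : Mode) : gaussDir Complex.I k = imDir k := by
  ext j
  simp only [gaussDir, imDir, Complex.conj_I]
  field_simp [Complex.I_ne_zero]
  rw [Complex.I_sq]
  ring

/-- The expectation of a cylinder function of the white noise. -/
def expect (hη : IsWhiteNoise P η) : cyl →ₗ[ℂ] ℂ where
  toFun F := ∫ ω, F.1 (fun k => η k ω) ∂P
  map_add' F G := integral_add (hη.integrable_cyl F) (hη.integrable_cyl G)
  map_smul' c _ := integral_const_mul c _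

theorem expect_apply (hη : IsWhiteNoise P η) (F : cyl) :
    expect hη F = ∫ ω, F.1 (fun k => η k ω) ∂P := rfl

/-- Integration by parts. -/
theorem expect_D (hη : IsWhiteNoise P η) {k : Mode} (hk : k ≠ 0) (F : cyl) :
    expect hη (D k F) = expect hη (X k * F) := by
  have hi : ∀ d, Integrable (fun ω => lineDeriv ℝ F.1 (fun j => η j ω) d) P := fun d => by
    obtain ⟨S, hS⟩ := F.2
    exact hη.integrable_cyl ⟨_, S, hS.lineDeriv d⟩
  have e1 := hη.integral_lineDeriv (w := 1) (by simp) hk F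
  have e2 := hη.integral_lineDeriv (w := Complex.I) (by simp) hk F
  rw [gaussDir_one] at e1
  rw [gaussDir_I] at e2
  have h1 : Integrable (fun ω => ((1 * η k ω).re : ℂ) * F.1 (fun j => η j ω)) P := by
    have hre : (fun v : Mode → ℂ => ((1 * v k).re : ℂ)) ∈ cyl := by
      have h := isCylinder_re (X k)
      simpa [X_apply] using h.mem_cyl
    exact hη.integrable_cyl (⟨_, hre⟩ * F)
  have h2 : Integrable (fun ω => ((Complex.I * η k ω).re : ℂ) * F.1 (fun j => η j ω)) P := by
    have hre : (fun v : Mode → ℂ => ((Complex.I * v k).re : ℂ)) ∈ cyl :=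
      (isCylinder_re (Complex.I • X k)).mem_cyl
    exact hη.integrable_cyl (⟨_, hre⟩ * F)
  rw [expect_apply, expect_apply]
  simp only [D_apply, modeDeriv]
  rw [integral_sub (hi _) ((hi _).const_mul _), integral_const_mul, ← e1, ← e2,
    ← integral_const_mul, ← integral_sub h1 (h2.const_mul _)]
  refine integral_congr_ae (ae_of_all _ fun ω => ?_)
  change _ = η k ω * F.1 (fun j => η j ω)
  have : ((1 * η k ω).re : ℂ) - Complex.I * ((Complex.I * η k ω).re : ℂ) = η k ω := by
    apply Complex.ext <;> simp
  simp only
  rw [← mul_assoc, ← sub_mul, this]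

/-- The relation v_{-k} = conj v_k does not hold in the algebra `cyl`, only almost surely along the
noise. Identities that use it are available only under the expectation. -/
theorem expect_congr (hη : IsWhiteNoise P η) {F G : cyl}
    (h : ∀ v, IsRealMode v → F.1 v = G.1 v) : expect hη F = expect hη G :=
  integral_congr_ae (hη.ae_isRealMode.mono fun _ hω => h _ hω)

/-- The class in `L²` of a cylinder function of the white noise. -/
def toL2 (hη : IsWhiteNoise P η) : cyl →ₗ[ℂ] Lp ℂ 2 P where
  toFun F := (hη.memLp_cyl F).toLp _
  map_add' F G := MemLp.toLp_add (hη.memLp_cyl F) (hη.memLp_cyl G)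
  map_smul' c F := MemLp.toLp_const_smul c (hη.memLp_cyl F)

theorem coeFn_toL2 (hη : IsWhiteNoise P η) (F : cyl) :
    toL2 hη F =ᵐ[P] fun ω => F.1 fun k => η k ω := MemLp.coeFn_toLp (hη.memLp_cyl F)

theorem inner_toL2 (hη : IsWhiteNoise P η) (F G : cyl) :
    inner ℂ (toL2 hη F) (toL2 hη G) = expect hη (cconj F * G) := by
  rw [L2.inner_def, expect_apply]
  refine integral_congr_ae ?_
  filter_upwards [coeFn_toL2 hη F, coeFn_toL2 hη G] with ω h1 h2
  rw [h1, h2, RCLike.inner_apply']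
  rfl

theorem norm_sq_toL2 (hη : IsWhiteNoise P η) (F : cyl) :
    ((‖toL2 hη F‖ ^ 2 : ℝ) : ℂ) = expect hη (cconj F * F) := by
  rw [← inner_toL2, inner_self_eq_norm_sq_to_K]
  simp

theorem cconj_cconj (F : cyl) : cconj (cconj F) = F :=
  Subtype.ext (funext fun _ => Complex.conj_conj _)

theorem norm_expect_mul_le (hη : IsWhiteNoise P η) (F G : cyl) :
    ‖expect hη (F * G)‖ ≤ ‖toL2 hη (cconj F)‖ * ‖toL2 hη G‖ := by
  have := norm_inner_le_norm (𝕜 := ℂ) (toL2 hη (cconj F)) (toL2 hη G)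
  rwa [inner_toL2, cconj_cconj] at this

theorem norm_toL2_cconj (hη : IsWhiteNoise P η) (F : cyl) :
    ‖toL2 hη (cconj F)‖ = ‖toL2 hη F‖ := by
  have h : (‖toL2 hη (cconj F)‖ ^ 2 : ℝ) = ‖toL2 hη F‖ ^ 2 := by
    have h1 := norm_sq_toL2 hη (cconj F)
    rw [cconj_cconj, mul_comm, ← norm_sq_toL2] at h1
    exact_mod_cast h1
  exact (sq_eq_sq₀ (norm_nonneg _) (norm_nonneg _)).1 h

end

/-! ### The two parts of the generator on complex cylinder functions -/

theorem normSq_neg (k : Mode) : normSq (-k) = normSq k := by simp [normSq]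

theorem euclNorm_neg (k : Mode) : euclNorm (-k) = euclNorm k := by simp [euclNorm, normSq_neg]

theorem normSq_nonneg (k : Mode) : 0 ≤ normSq k := by unfold normSq; positivity

theorem euclNorm_nonneg (k : Mode) : 0 ≤ euclNorm k := Real.sqrt_nonneg _

theorem euclNorm_sq (k : Mode) : euclNorm k ^ 2 = normSq k := Real.sq_sqrt (normSq_nonneg k)

theorem one_le_normSq {k : Mode} (hk : k ≠ 0) : 1 ≤ normSq k := by
  have h : (1 : ℤ) ≤ k.1 ^ 2 + k.2 ^ 2 := by
    by_contra! h
    have h1 : k.1 = 0 := by nlinarith [sq_nonneg k.1, sq_nonneg k.2]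
    have h2 : k.2 = 0 := by nlinarith [sq_nonneg k.1, sq_nonneg k.2]
    exact hk (Prod.ext h1 h2)
  unfold normSq
  exact_mod_cast h

theorem normSq_pos {k : Mode} (hk : k ≠ 0) : 0 < normSq k := lt_of_lt_of_le one_pos (one_le_normSq hk)

theorem euclNorm_pos {k : Mode} (hk : k ≠ 0) : 0 < euclNorm k := Real.sqrt_pos.2 (normSq_pos hk)

theorem normSq_zero : normSq 0 = 0 := by simp [normSq]

theorem euclNorm_zero : euclNorm 0 = 0 := by simp [euclNorm, normSq_zero]

/-- The conditions under which the kernel may be non-zero. -/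
theorem of_kernel_ne_zero {N : ℕ} {l m : Mode} (h : kernel N l m ≠ 0) :
    l ≠ 0 ∧ m ≠ 0 ∧ l + m ≠ 0 ∧ l ∈ box N ∧ m ∈ box N ∧ l + m ∈ box N := by
  unfold kernel at h
  split_ifs at h with hc
  · refine ⟨hc.1, hc.2.1, fun h0 => h ?_, hc.2.2⟩
    rw [h0, euclNorm_zero, zero_mul, zero_div]
  · exact absurd rfl h

/-- The algebraic source of energy conservation; it also drives the kernel cancellation in
`abs_kernel_add_kernel_le`. -/
theorem cForm_cyclic {m l p : Mode} (h : m + l + p = 0) :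
    cForm m l * normSq p + cForm l p * normSq m + cForm p m * normSq l = 0 := by
  have hp : p = -(m + l) := by rw [eq_neg_iff_add_eq_zero, add_comm]; exact h
  subst hp
  simp only [cForm, normSq, Prod.fst_neg, Prod.snd_neg, Prod.fst_add, Prod.snd_add]
  push_cast
  ring

theorem cForm_comm (l m : Mode) : cForm l m = cForm m l := by simp [cForm, mul_comm]

theorem kernel_comm (N : ℕ) (l m : Mode) : kernel N l m = kernel N m l := by
  simp only [kernel, add_comm l m, cForm_comm l m, mul_comm (euclNorm l)]
  congr 1
  simp only [eq_iff_iff]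
  tauto

/-- Evaluation of cylinder functions. -/
def ev (v : Mode → ℂ) : cyl →ₐ[ℂ] ℂ := (Pi.evalAlgHom ℂ (fun _ : Mode → ℂ => ℂ) v).comp cyl.val

theorem ev_apply (v : Mode → ℂ) (F : cyl) : ev v F = F.1 v := rfl

/-- The symmetric part of the generator, restricted to the modes in `T`. -/
def symPart (T : Finset Mode) : cyl →ₗ[ℂ] cyl :=
  (1 / 2 : ℂ) • ∑ k ∈ T, (normSq k : ℂ) •
    ((D (-k)).toLinearMap ∘ₗ (D k).toLinearMap
      - LinearMap.mulLeft ℂ (X (-k)) ∘ₗ (D k).toLinearMap)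

theorem symPart_apply (T : Finset Mode) (F : cyl) :
    symPart T F = (1 / 2 : ℂ) • ∑ k ∈ T, (normSq k : ℂ) • (D (-k) (D k F) - X (-k) * D k F) := by
  simp [symPart, LinearMap.sum_apply]

/-- The antisymmetric part of the generator. -/
def antiPart (N : ℕ) (c : ℝ) : Derivation ℂ cyl cyl :=
  (c : ℂ) • ∑ m ∈ box N, ∑ l ∈ box N, (kernel N m l : ℂ) • ((X m * X l) • D (-(m + l)))

theorem derivation_sum_apply {ι : Type*} (s : Finset ι) (f : ι → Derivation ℂ cyl cyl) (F : cyl) :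
    (∑ i ∈ s, f i) F = ∑ i ∈ s, f i F := by
  classical
  induction s using Finset.induction_on with
  | empty => simp
  | insert a s ha ih => rw [Finset.sum_insert ha, Finset.sum_insert ha, Derivation.add_apply, ih]

theorem antiPart_apply (N : ℕ) (c : ℝ) (F : cyl) :
    antiPart N c F = (c : ℂ) • ∑ m ∈ box N, ∑ l ∈ box N,
      (kernel N m l : ℂ) • (X m * X l * D (-(m + l)) F) := by
  simp only [antiPart, Derivation.smul_apply, derivation_sum_apply, smul_eq_mul]

theorem genSymC_eq {F : (Mode → ℂ) → ℝ} {V : cyl} (hV : V.1 = fun v => (F v : ℂ)) {T : Finset Mode}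
    (hT : ∀ k, k ∉ T → D k V = 0) (v : Mode → ℂ) : genSymC F v = ev v (symPart T V) := by
  rw [genSymC, symPart_apply, ← hV, map_smul, map_sum, smul_eq_mul]
  congr 1
  rw [tsum_eq_sum (s := T)]
  · refine Finset.sum_congr rfl fun k _ => ?_
    rw [map_smul, map_sub, map_mul, smul_eq_mul, ev_apply, ev_apply, ev_apply, D_apply, D_apply,
      X_apply]
    change _ = (normSq k : ℂ) * (modeDeriv (-k) (modeDeriv k V.1) v - _)
    ring
  · intro k hk
    have h1 : modeDeriv k V.1 v = 0 := congrFun (congrArg Subtype.val (hT k hk)) v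
    have h2 : modeDeriv (-k) (modeDeriv k V.1) v = 0 := by
      have := congrFun (congrArg (fun F => (D (-k) F).1) (hT k hk)) v
      simp only [map_zero] at this
      exact this
    rw [h1, h2]
    ring

theorem genAntiC_eq {F : (Mode → ℂ) → ℝ} {V : cyl} (hV : V.1 = fun v => (F v : ℂ)) (N : ℕ) (c : ℝ)
    (v : Mode → ℂ) : genAntiC N c F v = ev v (antiPart N c V) := by
  rw [genAntiC, antiPart_apply, ← hV, map_smul, map_sum, smul_eq_mul]
  congr 1
  refine Finset.sum_congr rfl fun m _ => ?_
  rw [map_sum]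
  refine Finset.sum_congr rfl fun l _ => ?_
  rw [map_smul, map_mul, map_mul, smul_eq_mul, ev_apply, ev_apply, ev_apply, D_apply,
      X_apply, X_apply]
  ring

theorem gen_eq {F : (Mode → ℂ) → ℝ} {V : cyl} (hV : V.1 = fun v => (F v : ℂ)) {T : Finset Mode}
    (hT : ∀ k, k ∉ T → D k V = 0) (N : ℕ) (c : ℝ) {v : Mode → ℂ} (hv : IsRealMode v) :
    (gen N c F v : ℂ) = ev v (symPart T V + antiPart N c V) := by
  rw [ofReal_gen N c F v hv.2, genSymC_eq hV hT, genAntiC_eq hV, map_add]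

/-! ### Energy conservation -/

theorem sum_rotate {ι M : Type*} [AddCommMonoid M] (s : Finset ι) (f : ι → ι → ι → M) :
    ∑ a ∈ s, ∑ b ∈ s, ∑ c ∈ s, f a b c = ∑ a ∈ s, ∑ b ∈ s, ∑ c ∈ s, f b c a := by
  symm
  rw [Finset.sum_comm]
  exact Finset.sum_congr rfl fun b _ => Finset.sum_comm

/-- The coefficient of `v_m v_l v_p` in the energy balance. -/
def triCoef (m l p : Mode) : ℝ :=
  if m + l + p = 0 then cForm m l * normSq p / (euclNorm m * euclNorm l * euclNorm p) else 0

theorem triCoef_cyclic (m l p : Mode) :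
    triCoef m l p + triCoef l p m + triCoef p m l = 0 := by
  have h1 : l + p + m = m + l + p := by abel
  have h2 : p + m + l = m + l + p := by abel
  simp only [triCoef, h1, h2]
  split_ifs with h
  · have e1 : euclNorm l * euclNorm p * euclNorm m = euclNorm m * euclNorm l * euclNorm p := by ring
    have e2 : euclNorm p * euclNorm m * euclNorm l = euclNorm m * euclNorm l * euclNorm p := by ring
    rw [e1, e2, ← add_div, ← add_div, cForm_cyclic h, zero_div]
  · simp

/-- With p = -(m + l) as a free third index in the same box, the three modes play interchangeable
roles: the cutoff on m + l becomes the cutoff on p. -/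
theorem kernel_smul_eq_sum {M : Type*} [AddCommGroup M] [Module ℂ M] (N : ℕ) {m l : Mode}
    (hm : m ∈ box N) (hl : l ∈ box N) (f : Mode → M) :
    (kernel N m l : ℂ) • f (-(m + l)) = ∑ p ∈ box N, (triCoef m l p : ℂ) • f p := by
  by_cases hb : m + l ∈ box N
  · rw [Finset.sum_eq_single_of_mem (-(m + l)) (neg_mem_box.2 hb)]
    · congr 2
      rw [triCoef, if_pos (add_neg_cancel _), normSq_neg, euclNorm_neg]
      -- For vanishing modes the quotient in `triCoef` is a division by zero, hence 0, in agreement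
      -- with the kernel.
      by_cases h0 : m = 0 ∨ l = 0
      · have : ¬(m ≠ 0 ∧ l ≠ 0 ∧ m ∈ box N ∧ l ∈ box N ∧ m + l ∈ box N) := by tauto
        rw [kernel, if_neg this]
        rcases h0 with h0 | h0 <;> simp [h0, euclNorm_zero]
      · push Not at h0
        rw [kernel, if_pos ⟨h0.1, h0.2, hm, hl, hb⟩]
        by_cases h1 : m + l = 0
        · simp [h1, euclNorm_zero]
        · rw [← euclNorm_sq]
          have := (euclNorm_pos h1).ne'
          have := (euclNorm_pos h0.1).ne'
          have := (euclNorm_pos h0.2).ne'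
          field_simp
    · intro p _ hp
      rw [triCoef, if_neg, Complex.ofReal_zero, zero_smul]
      exact fun h => hp (by rw [eq_neg_iff_add_eq_zero, add_comm]; exact h)
  · have h0 : kernel N m l = 0 := by
      by_contra h
      exact hb (of_kernel_ne_zero h).2.2.2.2.2
    rw [h0, Complex.ofReal_zero, zero_smul, Finset.sum_eq_zero]
    intro p hp
    rw [triCoef, if_neg, Complex.ofReal_zero, zero_smul]
    intro h
    refine hb ?_
    rw [← neg_mem_box]
    convert hp using 1
    rw [eq_comm, eq_neg_iff_add_eq_zero, add_comm]
    exact h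

/-- Adding the three cyclic relabellings of the sum replaces each coefficient by the cyclic sum in
`triCoef_cyclic`, which is zero; so three times the sum vanishes. -/
theorem sum_kernel_smul_X (N : ℕ) :
    ∑ m ∈ box N, ∑ l ∈ box N, (kernel N m l : ℂ) • (X m * X l * X (-(m + l))) = 0 := by
  set S := ∑ m ∈ box N, ∑ l ∈ box N, (kernel N m l : ℂ) • (X m * X l * X (-(m + l))) with hS
  set f : Mode → Mode → Mode → cyl := fun m l p => (triCoef m l p : ℂ) • (X m * X l * X p) with hf
  have h1 : S = ∑ m ∈ box N, ∑ l ∈ box N, ∑ p ∈ box N, f m l p :=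
    Finset.sum_congr rfl fun m hm => Finset.sum_congr rfl fun l hl =>
      kernel_smul_eq_sum N hm hl fun p => X m * X l * X p
  have h2 := h1.trans (sum_rotate _ _)
  have h3 := h2.trans (sum_rotate _ _)
  have h4 : S + S + S = 0 := by
    nth_rewrite 1 [h1]
    nth_rewrite 1 [h2]
    rw [h3]
    simp only [← Finset.sum_add_distrib]
    refine Finset.sum_eq_zero fun m _ => Finset.sum_eq_zero fun l _ =>
      Finset.sum_eq_zero fun p _ => ?_
    have e : f m l p + f l p m + f p m l =
        ((triCoef m l p + triCoef l p m + triCoef p m l : ℝ) : ℂ) • (X m * X l * X p) := by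
      simp only [hf]
      rw [show X l * X p * X m = X m * X l * X p by ring,
        show X p * X m * X l = X m * X l * X p by ring, ← add_smul, ← add_smul]
      push_cast
      rfl
    rw [e, triCoef_cyclic, Complex.ofReal_zero, zero_smul]
  have h5 : (3 : ℂ) • S = 0 := by
    rw [← h4]; module
  exact (smul_eq_zero.1 h5).resolve_left (by norm_num)

/-! ### Integration by parts for the two parts -/

section

variable {Ω : Type*} [MeasurableSpace Ω] {P : Measure Ω} {η : Mode → Ω → ℂ}

/-- Integrating the drift X_{-k} by parts cancels the second-order term and leaves the Dirichlet
form. The mode k = 0, where integration by parts is unavailable, has weight |k|² = 0. -/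
theorem expect_mul_symPart (hη : IsWhiteNoise P η) (T : Finset Mode) (F G : cyl) :
    expect hη (G * symPart T F) =
      -(1 / 2 * ∑ k ∈ T, (normSq k : ℂ) * expect hη (D (-k) G * D k F)) := by
  rw [symPart_apply, mul_smul_comm, map_smul, Finset.mul_sum, map_sum, smul_eq_mul, ← mul_neg,
    ← Finset.sum_neg_distrib]
  congr 1
  refine Finset.sum_congr rfl fun k _ => ?_
  rw [mul_smul_comm, map_smul, smul_eq_mul, ← mul_neg]
  by_cases hk : k = 0
  · simp [hk, normSq_zero]
  congr 1
  have h := expect_D hη (neg_ne_zero.2 hk) (G * D k F)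
  rw [Derivation.leibniz, smul_eq_mul, smul_eq_mul, map_add] at h
  rw [mul_sub, map_sub, show G * (X (-k) * D k F) = X (-k) * (G * D k F) by ring, ← h,
    mul_comm (D k F)]
  ring

/-- White noise is invariant under the nonlinear drift. The drift is divergence free, as D_{-(m+l)}
kills X_m and X_l for nonzero l and m, so integration by parts leaves the cubic form of
`sum_kernel_smul_X` times F. -/
theorem expect_antiPart (hη : IsWhiteNoise P η) (N : ℕ) (c : ℝ) (F : cyl) :
    expect hη (antiPart N c F) = 0 := by
  have h : ∀ m l, expect hη ((kernel N m l : ℂ) • (X m * X l * D (-(m + l)) F)) =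
      expect hη ((kernel N m l : ℂ) • (X m * X l * X (-(m + l))) * F) := fun m l => by
    by_cases hK : kernel N m l = 0
    · simp [hK]
    obtain ⟨hm, hl, hml, -⟩ := of_kernel_ne_zero hK
    rw [smul_mul_assoc, map_smul, map_smul]
    congr 1
    have h := expect_D hη (neg_ne_zero.2 hml) (X m * X l * F)
    have hDm : D (-(m + l)) (X m) = 0 := by
      rw [D_X, if_neg]
      intro h0
      exact hl (by rw [← neg_eq_zero, ← h0]; abel)
    have hDl : D (-(m + l)) (X l) = 0 := by
      rw [D_X, if_neg]
      intro h0
      exact hm (by rw [← neg_eq_zero, ← h0]; abel)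
    rw [Derivation.leibniz, Derivation.leibniz, hDm, hDl, smul_zero, smul_zero, add_zero,
      smul_zero, add_zero, smul_eq_mul] at h
    rw [h]
    congr 1
    ring
  rw [antiPart_apply, map_smul, map_sum]
  simp_rw [map_sum, h]
  simp_rw [← map_sum, ← Finset.sum_mul]
  rw [sum_kernel_smul_X, zero_mul, map_zero, smul_zero]

/-- A derivation of mean zero is antisymmetric: apply it to the product F G. -/
theorem expect_mul_antiPart (hη : IsWhiteNoise P η) (N : ℕ) (c : ℝ) (F G : cyl) :
    expect hη (F * antiPart N c G) = -expect hη (G * antiPart N c F) := by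
  have h := expect_antiPart hη N c (F * G)
  rw [Derivation.leibniz, map_add, smul_eq_mul, smul_eq_mul] at h
  exact eq_neg_of_add_eq_zero_left h

end

/-! ### The generator in `L²` -/

theorem symPart_congr {V : cyl} {T T' : Finset Mode} (hT : ∀ k, k ∉ T → D k V = 0) (h : T ⊆ T') :
    symPart T' V = symPart T V := by
  rw [symPart_apply, symPart_apply, Finset.sum_subset h]
  intro k _ hk
  rw [hT k hk, map_zero, mul_zero, sub_zero, smul_zero]

theorem cconj_add (F G : cyl) : cconj (F + G) = cconj F + cconj G :=
  Subtype.ext (funext fun _ => map_add _ _ _)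

theorem cconj_smul (c : ℂ) (F : cyl) : cconj (c • F) = conj c • cconj F :=
  Subtype.ext (funext fun _ => map_mul _ _ _)

section

variable {Ω : Type*} [MeasurableSpace Ω] {P : Measure Ω} {η : Mode → Ω → ℂ}

/-- The inclusion of real square integrable functions in complex ones. -/
def toComplexL2 (P : Measure Ω) : Lp ℝ 2 P →L[ℝ] Lp ℂ 2 P := Complex.ofRealCLM.compLpL 2 P

theorem coeFn_toComplexL2 (f : Lp ℝ 2 P) : toComplexL2 P f =ᵐ[P] fun ω => (f ω : ℂ) :=
  Complex.ofRealCLM.coeFn_compLpL f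

theorem inner_toComplexL2 (f g : Lp ℝ 2 P) :
    inner ℂ (toComplexL2 P f) (toComplexL2 P g) = ((inner ℝ f g : ℝ) : ℂ) := by
  rw [L2.inner_def, L2.inner_def, ← integral_complex_ofReal]
  refine integral_congr_ae ?_
  filter_upwards [coeFn_toComplexL2 f, coeFn_toComplexL2 g] with ω h1 h2
  rw [h1, h2]
  simp [mul_comm]

theorem norm_toComplexL2 (f : Lp ℝ 2 P) : ‖toComplexL2 P f‖ = ‖f‖ := by
  have h := inner_toComplexL2 f f
  rw [inner_self_eq_norm_sq_to_K, real_inner_self_eq_norm_sq] at h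
  have h2 : ‖toComplexL2 P f‖ ^ 2 = ‖f‖ ^ 2 := by
    have h3 : ((‖toComplexL2 P f‖ ^ 2 : ℝ) : ℂ) = ((‖f‖ ^ 2 : ℝ) : ℂ) := by
      rw [← h]; push_cast; rfl
    exact_mod_cast h3
  exact (sq_eq_sq₀ (norm_nonneg _) (norm_nonneg _)).1 h2

/-- The Dirichlet form of a cylinder function. -/
def energy (hη : IsWhiteNoise P η) (T : Finset Mode) (V : cyl) : ℝ :=
  1 / 2 * ∑ k ∈ T, normSq k * ‖toL2 hη (D k V)‖ ^ 2

theorem energy_nonneg (hη : IsWhiteNoise P η) (T : Finset Mode) (V : cyl) :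
    0 ≤ energy hη T V :=
  mul_nonneg (by norm_num) (Finset.sum_nonneg fun _ _ => mul_nonneg (normSq_nonneg _) (sq_nonneg _))

/-- `r - L` on cylinder functions. -/
def resolv (T : Finset Mode) (N : ℕ) (c r : ℝ) : cyl →ₗ[ℂ] cyl :=
  (r : ℂ) • LinearMap.id - (symPart T + (antiPart N c).toLinearMap)

theorem resolv_apply (T : Finset Mode) (N : ℕ) (c r : ℝ) (V : cyl) :
    resolv T N c r V = (r : ℂ) • V - (symPart T V + antiPart N c V) := rfl

theorem expect_resolv_mul_self (hη : IsWhiteNoise P η) (T : Finset Mode) (N : ℕ) (c r : ℝ)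
    {V : cyl} (hV : cconj V = V) :
    expect hη (resolv T N c r V * V) = ((r * ‖toL2 hη V‖ ^ 2 + energy hη T V : ℝ) : ℂ) := by
  have hA : expect hη (V * antiPart N c V) = 0 := by
    have := expect_mul_antiPart hη N c V V
    linear_combination this / 2
  have hD : ∀ k, D (-k) V = cconj (D k V) := fun k => by
    conv_lhs => rw [← hV]
    rw [D_cconj, neg_neg]
  have h0 : expect hη (V * V) = ((‖toL2 hη V‖ ^ 2 : ℝ) : ℂ) := by
    rw [norm_sq_toL2, hV]
  rw [mul_comm, resolv_apply, mul_sub, mul_add, map_sub, map_add, hA, add_zero,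
    expect_mul_symPart, mul_smul_comm, map_smul, h0]
  simp_rw [hD, ← norm_sq_toL2, energy]
  push_cast
  rw [smul_eq_mul]
  ring

/-- The passage from the real operator to the complex algebra `cyl`, where the generator is a finite
expression. -/
theorem mem_genGraphCyl_iff (hη : IsWhiteNoise P η) (N : ℕ) (c : ℝ) (p : Lp ℝ 2 P × Lp ℝ 2 P) :
    p ∈ genGraphCyl P η N c ↔ ∃ (V : cyl) (T : Finset Mode), cconj V = V ∧
      (∀ k, k ∉ T → D k V = 0) ∧ toComplexL2 P p.1 = toL2 hη V ∧
      toComplexL2 P p.2 = toL2 hη (symPart T V + antiPart N c V) := by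
  constructor
  · rintro ⟨G, hG, h1, h2⟩
    let V : cyl := ⟨_, hG.mem_cyl⟩
    obtain ⟨T, hT⟩ := exists_D_eq_zero V
    refine ⟨V, T, Subtype.ext (funext fun v => Complex.conj_ofReal _), hT, ?_, ?_⟩
    · refine Lp.ext ?_
      filter_upwards [h1, coeFn_toComplexL2 p.1, coeFn_toL2 hη V] with ω e1 e2 e3
      rw [e2, e3, e1]
    · refine Lp.ext ?_
      filter_upwards [h2, coeFn_toComplexL2 p.2,
        coeFn_toL2 hη (symPart T V + antiPart N c V), hη.ae_isRealMode] with ω e1 e2 e3 e4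
      rw [e2, e3, e1, gen_eq (V := V) rfl hT N c e4]
      rfl
  · rintro ⟨V, T, hV, hT, h1, h2⟩
    have hre : V.1 = fun v => (((V.1 v).re : ℝ) : ℂ) := funext fun v =>
      (Complex.conj_eq_iff_re.1 (congrFun (congrArg Subtype.val hV) v)).symm
    refine ⟨fun v => (V.1 v).re, isCylinder_re V, ?_, ?_⟩
    · filter_upwards [coeFn_toComplexL2 p.1, coeFn_toL2 hη V] with ω e2 e3
      rw [h1, e3] at e2
      rw [e2, Complex.ofReal_re]
    · filter_upwards [coeFn_toComplexL2 p.2,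
        coeFn_toL2 hη (symPart T V + antiPart N c V), hη.ae_isRealMode] with ω e2 e3 e4
      have h := gen_eq hre hT N c e4
      rw [h2, e3] at e2
      rw [ev_apply, e2] at h
      exact_mod_cast h.symm

/-- The graph of the generator on cylinder functions, as a subspace. -/
def genGraphSub (hη : IsWhiteNoise P η) (N : ℕ) (c : ℝ) : Submodule ℝ (Lp ℝ 2 P × Lp ℝ 2 P) where
  carrier := genGraphCyl P η N c
  zero_mem' := by
    refine (mem_genGraphCyl_iff hη N c _).2 ⟨0, ∅, ?_, by simp, by simp, by simp⟩
    exact Subtype.ext (funext fun _ => map_zero _)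
  add_mem' := by
    intro p q hp hq
    obtain ⟨V, T, hV, hT, h1, h2⟩ := (mem_genGraphCyl_iff hη N c _).1 hp
    obtain ⟨V', T', hV', hT', h1', h2'⟩ := (mem_genGraphCyl_iff hη N c _).1 hq
    refine (mem_genGraphCyl_iff hη N c _).2 ⟨V + V', T ∪ T', by rw [cconj_add, hV, hV'], ?_, ?_, ?_⟩
    · intro k hk
      rw [Finset.mem_union, not_or] at hk
      rw [map_add, hT k hk.1, hT' k hk.2, add_zero]
    · rw [Prod.fst_add, map_add, map_add, h1, h1']
    · rw [Prod.snd_add, map_add, h2, h2', ← map_add, map_add (symPart _), map_add (antiPart _ _),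
        symPart_congr hT Finset.subset_union_left, symPart_congr hT' Finset.subset_union_right]
      congr 1
      abel
  smul_mem' := by
    intro a p hp
    obtain ⟨V, T, hV, hT, h1, h2⟩ := (mem_genGraphCyl_iff hη N c _).1 hp
    refine (mem_genGraphCyl_iff hη N c _).2 ⟨(a : ℂ) • V, T, ?_, ?_, ?_, ?_⟩
    · rw [cconj_smul, hV, Complex.conj_ofReal]
    · intro k hk
      rw [Derivation.map_smul, hT k hk, smul_zero]
    · rw [Prod.smul_fst, map_smul, map_smul, h1]
      rfl
    · rw [Prod.smul_snd, map_smul, map_smul, Derivation.map_smul, ← smul_add, map_smul, h2]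
      rfl

theorem coe_genGraphSub_closure (hη : IsWhiteNoise P η) (N : ℕ) (c : ℝ) :
    ((genGraphSub hη N c).topologicalClosure : Set (Lp ℝ 2 P × Lp ℝ 2 P)) = genGraph P η N c := rfl

theorem toComplexL2_resolv (hη : IsWhiteNoise P η) {N : ℕ} {c : ℝ} (r : ℝ)
    {p : Lp ℝ 2 P × Lp ℝ 2 P} {V : cyl} {T : Finset Mode}
    (h1 : toComplexL2 P p.1 = toL2 hη V)
    (h2 : toComplexL2 P p.2 = toL2 hη (symPart T V + antiPart N c V)) :
    toComplexL2 P (r • p.1 - p.2) = toL2 hη (resolv T N c r V) := by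
  rw [map_sub, map_smul, h1, h2, resolv_apply, map_sub, map_smul]
  rfl

theorem inner_resolv_of_mem (hη : IsWhiteNoise P η) {N : ℕ} {c : ℝ} (r : ℝ)
    {p : Lp ℝ 2 P × Lp ℝ 2 P} {V : cyl} {T : Finset Mode} (hV : cconj V = V)
    (h1 : toComplexL2 P p.1 = toL2 hη V)
    (h2 : toComplexL2 P p.2 = toL2 hη (symPart T V + antiPart N c V)) :
    inner ℝ (r • p.1 - p.2) p.1 = r * ‖toL2 hη V‖ ^ 2 + energy hη T V := by
  have h3 := inner_toComplexL2 p.1 (r • p.1 - p.2)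
  rw [toComplexL2_resolv hη r h1 h2, h1, inner_toL2, hV, mul_comm,
    expect_resolv_mul_self hη T N c r hV] at h3
  rw [real_inner_comm]
  exact_mod_cast h3.symm

/-- Dissipativity. -/
theorem norm_sq_le_inner_resolv (hη : IsWhiteNoise P η) {N : ℕ} {c : ℝ} (r : ℝ)
    {p : Lp ℝ 2 P × Lp ℝ 2 P} (hp : p ∈ genGraph P η N c) :
    r * ‖p.1‖ ^ 2 ≤ inner ℝ (r • p.1 - p.2) p.1 := by
  have hcl : IsClosed {p : Lp ℝ 2 P × Lp ℝ 2 P | r * ‖p.1‖ ^ 2 ≤ inner ℝ (r • p.1 - p.2) p.1} :=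
    isClosed_le (by fun_prop) (by fun_prop)
  refine closure_minimal ?_ hcl hp
  intro q hq
  obtain ⟨V, T, hV, hT, h1, h2⟩ := (mem_genGraphCyl_iff hη N c _).1 hq
  rw [Set.mem_ofPred_eq, inner_resolv_of_mem hη r hV h1 h2, ← norm_toComplexL2, h1]
  linarith [energy_nonneg hη T V]

/-- Gives both uniqueness for the resolvent equation and the closed range of r - L. -/
theorem norm_fst_le (hη : IsWhiteNoise P η) {N : ℕ} {c r : ℝ}
    {p : Lp ℝ 2 P × Lp ℝ 2 P} (hp : p ∈ genGraph P η N c) :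
    r * ‖p.1‖ ≤ ‖r • p.1 - p.2‖ := by
  have h1 := norm_sq_le_inner_resolv hη r hp
  have h2 := real_inner_le_norm (r • p.1 - p.2) p.1
  rcases (norm_nonneg p.1).eq_or_lt with h | h
  · rw [← h, mul_zero]; exact norm_nonneg _
  · refine le_of_mul_le_mul_right ?_ h
    nlinarith

/-- The linear map `(U, W) ↦ r U - W`. -/
def resolvMap (P : Measure Ω) (r : ℝ) : Lp ℝ 2 P × Lp ℝ 2 P →L[ℝ] Lp ℝ 2 P :=
  r • ContinuousLinearMap.fst ℝ _ _ - ContinuousLinearMap.snd ℝ _ _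

/-- The range of the closed dissipative operator `r - L` is closed, so a function orthogonal to
everything that is orthogonal to the image of the cylinder functions belongs to it. -/
theorem exists_resolvMap_eq (hη : IsWhiteNoise P η) {N : ℕ} {c r : ℝ} (hr : 0 < r) (f : Lp ℝ 2 P)
    (hf : ∀ h : Lp ℝ 2 P, (∀ p ∈ genGraphCyl P η N c, inner ℝ h (r • p.1 - p.2) = 0) →
      inner ℝ h f = 0) :
    ∃ p ∈ genGraph P η N c, r • p.1 - p.2 = f := by
  let M := (genGraphSub hη N c).topologicalClosure
  have hMc : IsClosed (M : Set (Lp ℝ 2 P × Lp ℝ 2 P)) := Submodule.isClosed_topologicalClosure _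
  let Φ : M →L[ℝ] Lp ℝ 2 P := (resolvMap P r).comp M.subtypeL
  -- With y = ‖rU - W‖, dissipativity gives ‖U‖ ≤ y/r, and then ‖W‖ ≤ r‖U‖ + y ≤ 2y.
  have hΦ : ∀ p : M, ‖p‖ ≤ (r⁻¹ + 2) * ‖Φ p‖ := fun p => by
    have h1 := norm_fst_le hη (r := r) (p := p.1) p.2
    have h1' : ‖p.1.1‖ ≤ r⁻¹ * ‖r • p.1.1 - p.1.2‖ := by
      rw [← div_eq_inv_mul, le_div_iff₀ hr, mul_comm]; exact h1
    have h2 : ‖p.1.2‖ ≤ ‖r • p.1.1‖ + ‖r • p.1.1 - p.1.2‖ := by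
      have := norm_sub_le (r • p.1.1) (r • p.1.1 - p.1.2)
      rwa [sub_sub_cancel] at this
    rw [norm_smul, Real.norm_of_nonneg hr.le] at h2
    have h3 : 0 ≤ r⁻¹ * ‖r • p.1.1 - p.1.2‖ := by positivity
    change max ‖p.1.1‖ ‖p.1.2‖ ≤ (r⁻¹ + 2) * ‖r • p.1.1 - p.1.2‖
    have h4 := norm_nonneg (r • p.1.1 - p.1.2)
    exact max_le (by linarith) (by linarith)
  have : CompleteSpace M := hMc.completeSpace_coe
  have hanti : AntilipschitzWith (Real.toNNReal (r⁻¹ + 2)) Φ := by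
    refine ContinuousLinearMap.antilipschitz_of_bound Φ fun p => ?_
    rw [Real.coe_toNNReal _ (by positivity)]
    exact hΦ p
  have hcl : IsClosed (Set.range Φ) := hanti.isClosed_range Φ.uniformContinuous
  let K : Submodule ℝ (Lp ℝ 2 P) := LinearMap.range Φ.toLinearMap
  have hK : IsClosed (K : Set (Lp ℝ 2 P)) := hcl
  have : CompleteSpace K := hK.completeSpace_coe
  have hfK : f ∈ Kᗮᗮ := by
    intro h hh
    refine hf h fun p hp => ?_
    rw [real_inner_comm]
    exact hh _ ⟨⟨p, subset_closure hp⟩, rfl⟩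
  rw [Submodule.orthogonal_orthogonal] at hfK
  obtain ⟨p, hp⟩ := hfK
  exact ⟨p.1, p.2, hp⟩

theorem existsUnique_solvesResolvent (hη : IsWhiteNoise P η) {N : ℕ} {c r : ℝ} (hr : 0 < r)
    (f : Lp ℝ 2 P)
    (hf : ∀ h : Lp ℝ 2 P, (∀ p ∈ genGraphCyl P η N c, inner ℝ h (r • p.1 - p.2) = 0) →
      inner ℝ h f = 0) {F : Ω → ℝ} (hF : f =ᵐ[P] F) :
    ∃ p ∈ genGraph P η N c, r • p.1 - p.2 = f ∧
      ∀ V : Lp ℝ 2 P, SolvesResolvent P η N c r F V ↔ V = p.1 := by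
  obtain ⟨p, hp, hpf⟩ := exists_resolvMap_eq hη hr f hf
  have hiff : ∀ U W : Lp ℝ 2 P, (F =ᵐ[P] fun ω => r * U ω - W ω) ↔ r • U - W = f := by
    intro U W
    have h1 : (r • U - W : Lp ℝ 2 P) =ᵐ[P] fun ω => r * U ω - W ω := by
      filter_upwards [Lp.coeFn_sub (r • U) W, Lp.coeFn_smul r U] with ω e1 e2
      rw [e1, Pi.sub_apply, e2, Pi.smul_apply, smul_eq_mul]
    constructor
    · intro h
      exact Lp.ext (h1.trans (h.symm.trans hF.symm))
    · intro h
      rw [h] at h1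
      exact hF.symm.trans h1
  refine ⟨p, hp, hpf, fun V => ⟨?_, ?_⟩⟩
  · rintro ⟨W, hW, hFW⟩
    rw [hiff] at hFW
    have hsub : (V, W) - p ∈ genGraph P η N c := by
      rw [← coe_genGraphSub_closure hη]
      exact Submodule.sub_mem _ (by exact hW) (by exact hp)
    have h := norm_fst_le hη (r := r) hsub
    have e : r • ((V, W) - p).1 - ((V, W) - p).2 = 0 := by
      rw [Prod.fst_sub, Prod.snd_sub, smul_sub]
      rw [show r • V - r • p.1 - (W - p.2) = (r • V - W) - (r • p.1 - p.2) by abel, hFW, hpf,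
        sub_self]
    rw [e, norm_zero] at h
    have h3 : ‖V - p.1‖ = 0 := by
      have : ‖((V, W) - p).1‖ ≤ 0 := nonpos_of_mul_nonpos_right h hr
      exact le_antisymm this (norm_nonneg _)
    exact sub_eq_zero.1 (norm_eq_zero.1 h3)
  · rintro rfl
    exact ⟨p.2, hp, (hiff _ _).2 hpf⟩

/-- A lower bound for the resolvent through a test function. -/
theorem norm_inner_test_sq_le (hη : IsWhiteNoise P η) {N : ℕ} {c r : ℝ} (hr : 0 < r)
    {G : cyl} {κ : ℝ}
    (hG : ∀ (V : cyl) (T : Finset Mode), cconj V = V → (∀ k, k ∉ T → D k V = 0) →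
      ‖expect hη (resolv T N c r V * G)‖ ≤ κ * √(r * ‖toL2 hη V‖ ^ 2 + energy hη T V))
    {p : Lp ℝ 2 P × Lp ℝ 2 P} (hp : p ∈ genGraph P η N c) :
    ‖inner ℂ (toComplexL2 P (r • p.1 - p.2)) (toL2 hη G)‖ ^ 2 ≤
      κ ^ 2 * inner ℝ (r • p.1 - p.2) p.1 := by
  have hcl : IsClosed {p : Lp ℝ 2 P × Lp ℝ 2 P |
      ‖inner ℂ (toComplexL2 P (r • p.1 - p.2)) (toL2 hη G)‖ ^ 2 ≤
      κ ^ 2 * inner ℝ (r • p.1 - p.2) p.1} :=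
    isClosed_le (by fun_prop) (by fun_prop)
  -- Both sides are continuous in the pair, so cylinder functions suffice. There the pairing on the
  -- right is exactly r‖V‖² plus the energy, the quantity under the root in the hypothesis on `G`.
  refine closure_minimal ?_ hcl hp
  intro q hq
  obtain ⟨V, T, hV, hT, h1, h2⟩ := (mem_genGraphCyl_iff hη N c _).1 hq
  have h3 : inner ℂ (toComplexL2 P (r • q.1 - q.2)) (toL2 hη G) =
      expect hη (resolv T N c r V * G) := by
    rw [L2.inner_def, expect_apply]
    refine integral_congr_ae ?_
    have h4 := toComplexL2_resolv hη r h1 h2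
    filter_upwards [coeFn_toComplexL2 (r • q.1 - q.2), coeFn_toL2 hη (resolv T N c r V),
      coeFn_toL2 hη G] with ω e1 e2 e3
    rw [e3, e1, RCLike.inner_apply', Complex.conj_ofReal, ← e1, h4, e2]
    rfl
  rw [Set.mem_ofPred_eq, inner_resolv_of_mem hη r hV h1 h2, h3]
  have h5 := pow_le_pow_left₀ (norm_nonneg _) (hG V T hV hT) 2
  rwa [mul_pow, Real.sq_sqrt] at h5
  have := energy_nonneg hη T V
  positivity

end

/-! ### An abstract density criterion for filtered operators -/

/-- A summable sequence cannot satisfy a growth inequality of order `3/2`. -/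
theorem eq_zero_of_growth {b : ℕ → ℝ} (hb : ∀ n, 0 ≤ b n) (hs : Summable b) {a C : ℝ} (ha : 0 < a)
    (hC : 0 < C) (h : ∀ n : ℕ, a * ∑ j ∈ Finset.range (n + 1), ((j : ℝ) + 1) * b j ≤
      C * (((n : ℝ) + 1) * √((n : ℝ) + 1)) * (b n + b (n + 1))) (m : ℕ) : b m = 0 := by
  -- Bootstrap. Let S n be the weighted partial sums. Once b m > 0, S stays above S m, so the
  -- hypothesis makes (n + 1)(b n + b (n + 1)) at least of order n^{-1/2}; summing, S n grows at
  -- least like √n. Inserted in the hypothesis again, this makes b n + b (n + 1) at least of order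
  -- 1/n, against summability.
  by_contra hm
  have hbm : 0 < b m := lt_of_le_of_ne (hb m) (Ne.symm hm)
  set S : ℕ → ℝ := fun n => ∑ j ∈ Finset.range (n + 1), ((j : ℝ) + 1) * b j with hS
  have hmono : Monotone S := by
    refine monotone_nat_of_le_succ fun n => ?_
    simp only [hS]
    rw [Finset.sum_range_succ _ (n + 1)]
    have := hb (n + 1)
    have : 0 ≤ (((n + 1 : ℕ) : ℝ) + 1) * b (n + 1) := by positivity
    linarith
  have hsm : 0 < S m := by
    refine lt_of_lt_of_le (b := ((m : ℝ) + 1) * b m) (by positivity) ?_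
    exact Finset.single_le_sum (f := fun j : ℕ => ((j : ℝ) + 1) * b j)
      (fun j _ => mul_nonneg (by positivity) (hb j)) (Finset.self_mem_range_succ m)
  have hpos : ∀ n : ℕ, 0 < (n : ℝ) + 1 := fun n => by positivity
  have hstep : ∀ n, S (n + 1) = S n + ((n : ℝ) + 2) * b (n + 1) := fun n => by
    simp only [hS]
    rw [Finset.sum_range_succ _ (n + 1)]
    push_cast
    ring
  have hinc : ∀ n, m ≤ n → a * S m / C / √((n : ℝ) + 1) ≤ ((n : ℝ) + 1) * (b n + b (n + 1)) := by
    intro n hn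
    have h1 := h n
    have h2 : a * S m ≤ a * S n := mul_le_mul_of_nonneg_left (hmono hn) ha.le
    have h3 : 0 < √((n : ℝ) + 1) := Real.sqrt_pos.2 (hpos n)
    rw [div_div, div_le_iff₀ (by positivity)]
    calc a * S m ≤ a * S n := h2
      _ ≤ _ := h1
      _ = _ := by ring
  have hsum : ∀ n, ∑ j ∈ Finset.range n, ((j : ℝ) + 1) * (b j + b (j + 1)) ≤ S n + S n := by
    intro n
    have h1 : ∑ j ∈ Finset.range n, ((j : ℝ) + 1) * b j ≤ S n :=
      Finset.sum_le_sum_of_subset_of_nonneg (Finset.range_subset_range.2 n.le_succ)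
        fun j _ _ => mul_nonneg (hpos j).le (hb j)
    have h2 : ∑ j ∈ Finset.range n, ((j : ℝ) + 1) * b (j + 1) ≤ S n := by
      simp only [hS]
      rw [Finset.sum_range_succ']
      have h3 : 0 ≤ (((0 : ℕ) : ℝ) + 1) * b 0 := mul_nonneg (by positivity) (hb 0)
      refine le_trans (Finset.sum_le_sum fun j _ => ?_) (le_add_of_nonneg_right h3)
      refine mul_le_mul_of_nonneg_right ?_ (hb _)
      push_cast
      linarith
    simp only [mul_add, Finset.sum_add_distrib]
    exact add_le_add h1 h2
  set c := a * S m / C with hc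
  have hc0 : 0 < c := by positivity
  -- The condition 2m ≤ n keeps at least half of the indices below n in the range [m, n) where the
  -- lower bound is available.
  have hgrow : ∀ n : ℕ, 1 ≤ n → 2 * m ≤ n → c * √n ≤ 4 * S n := by
    intro n hn1 hn
    have hn0 : (0 : ℝ) < n := by exact_mod_cast hn1
    have h1 : ∑ j ∈ Finset.Ico m n, c / √n ≤
        ∑ j ∈ Finset.range n, ((j : ℝ) + 1) * (b j + b (j + 1)) := by
      refine le_trans (Finset.sum_le_sum fun j hj => ?_)
        (Finset.sum_le_sum_of_subset_of_nonneg (s := Finset.Ico m n) (fun j hj => ?_)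
          fun j _ _ => mul_nonneg (hpos j).le (add_nonneg (hb _) (hb _)))
      · rw [Finset.mem_Ico] at hj
        refine le_trans ?_ (hinc j hj.1)
        have : (j : ℝ) + 1 ≤ n := by exact_mod_cast hj.2
        gcongr
      · rw [Finset.mem_Ico] at hj
        exact Finset.mem_range.2 hj.2
    rw [Finset.sum_const, Nat.card_Ico, nsmul_eq_mul] at h1
    have h2 : (n : ℝ) / 2 ≤ ((n - m : ℕ) : ℝ) := by
      rw [Nat.cast_sub (by omega)]
      have : (2 : ℝ) * m ≤ n := by exact_mod_cast hn
      linarith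
    have h3 : (n : ℝ) / 2 * (c / √n) ≤ ((n - m : ℕ) : ℝ) * (c / √n) :=
      mul_le_mul_of_nonneg_right h2 (by positivity)
    have h4 : (n : ℝ) / 2 * (c / √n) = c * √n / 2 := by
      have : 0 < √(n : ℝ) := Real.sqrt_pos.2 hn0
      nth_rewrite 1 [← Real.mul_self_sqrt hn0.le]
      field_simp
    linarith [hsum n]
  have hlow : ∀ n : ℕ, 2 * m + 1 ≤ n → a * c / (8 * C) * (1 / ((n : ℝ) + 1)) ≤ b n + b (n + 1) := by
    intro n hn
    have h1 := hgrow n (by omega) (by omega)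
    have h2 := h n
    have h3 : √((n : ℝ) + 1) ≤ 2 * √n := by
      have hn1 : (1 : ℝ) ≤ n := by exact_mod_cast (by omega : 1 ≤ n)
      rw [Real.sqrt_le_left (by positivity), mul_pow, Real.sq_sqrt (by linarith)]
      linarith
    have h4 : 0 < √((n : ℝ) + 1) := Real.sqrt_pos.2 (hpos n)
    have h5 : a * c * √((n : ℝ) + 1) ≤
        8 * C * (((n : ℝ) + 1) * √((n : ℝ) + 1)) * (b n + b (n + 1)) := by
      have h6 : a * (c * √((n : ℝ) + 1)) ≤ a * (c * (2 * √n)) := by gcongr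
      have h7 : a * (c * √n) ≤ a * (4 * S n) := by gcongr
      have h8 : a * S n ≤ _ := h2
      linarith
    have h6 : a * c ≤ 8 * C * ((n : ℝ) + 1) * (b n + b (n + 1)) := by
      refine le_of_mul_le_mul_right ?_ h4
      linarith
    rw [div_mul_div_comm, mul_one, div_le_iff₀ (by have := hpos n; positivity)]
    linarith
  have hsd : Summable fun n => b n + b (n + 1) := hs.add ((summable_nat_add_iff 1).2 hs)
  have hs1 : Summable fun n : ℕ => a * c / (8 * C) * (1 / ((n : ℝ) + 1)) := by
    refine hsd.of_norm_bounded_eventually_nat ?_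
    filter_upwards [eventually_ge_atTop (2 * m + 1)] with n hn
    rw [Real.norm_of_nonneg (by have := hpos n; positivity)]
    exact hlow n hn
  have hs2 := (summable_mul_left_iff (by positivity)).1 hs1
  refine Real.not_summable_one_div_natCast ((summable_nat_add_iff 1).1 ?_)
  simpa using hs2

section Filtered

variable {H M : Type*} [NormedAddCommGroup H] [InnerProductSpace ℂ H] [AddCommGroup M] [Module ℂ M]

/-- The component of order `n` of a vector along a filtration. -/
theorem exists_filtered_decomposition (ι : M →ₗ[ℂ] H) (E : ℕ → Submodule ℂ M) (hE0 : E 0 = ⊥)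
    (hE : Monotone E) (hfin : ∀ n, Module.Finite ℂ (E n)) (h : H) :
    ∃ p : ℕ → M, (∀ n, p n ∈ E (n + 1)) ∧ (∀ n, ∀ q ∈ E n, inner ℂ (ι (p n)) (ι q) = 0) ∧
      ∀ n, ∀ q ∈ E (n + 1), inner ℂ h (ι q) =
        inner ℂ (∑ j ∈ Finset.range (n + 1), ι (p j)) (ι q) := by
  let K : ℕ → Submodule ℂ H := fun n => (E n).map ι
  have hKfin : ∀ n, FiniteDimensional ℂ (K n) := fun n => inferInstance
  have hK : Monotone K := fun m n hmn => Submodule.map_mono (hE hmn)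
  -- The components are the increments of the projections of h onto the finite-dimensional images of
  -- the filtration.
  have hmem : ∀ n, (K (n + 1)).starProjection h - (K n).starProjection h ∈ K (n + 1) := fun n =>
    Submodule.sub_mem _ (Submodule.starProjection_apply_mem _ _)
      (hK n.le_succ (Submodule.starProjection_apply_mem _ _))
  choose p hpE hp using hmem
  have hinner : ∀ n, ∀ x ∈ K n, inner ℂ ((K n).starProjection h) x = inner ℂ h x := fun n x hx => by
    have h1 := Submodule.starProjection_inner_eq_zero (K := K n) h x hx
    rw [inner_sub_left, sub_eq_zero] at h1
    exact h1.symm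
  have hsum : ∀ n, ∑ j ∈ Finset.range n, ι (p j) = (K n).starProjection h := fun n => by
    induction n with
    | zero =>
      have : K 0 = ⊥ := by simp [K, hE0]
      rw [Finset.sum_range_zero]
      have h1 := Submodule.starProjection_apply_mem (K 0) h
      exact ((Submodule.mem_bot ℂ).1 (this.le h1)).symm
    | succ n ih => rw [Finset.sum_range_succ, ih, hp]; abel
  refine ⟨p, hpE, fun n q hq => ?_, fun n q hq => ?_⟩
  · have hqK : ι q ∈ K n := Submodule.mem_map_of_mem hq
    rw [hp, inner_sub_left, hinner n _ hqK, hinner (n + 1) _ (hK n.le_succ hqK), sub_self]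
  · rw [hsum, hinner _ _ (Submodule.mem_map_of_mem hq)]

/-- Test the orthogonality of h against its own truncation g_n = p_0 + ... + p_n. Antisymmetry
removes ⟨g_n, A g_n⟩, and since A raises the order by at most one, what remains is the flux
⟨p_{n+1}, A p_n⟩, bounded by C n^{3/2}‖p_{n+1}‖‖p_n‖ up to a shift of n. The left side is at least
min(r, a) Σ (j + 1)‖p_j‖². The norms ‖p_n‖² are summable by Bessel's inequality, so
`eq_zero_of_growth` applies. -/
theorem inner_eq_zero_of_filtered (ι : M →ₗ[ℂ] H) (E : ℕ → Submodule ℂ M) (hE0 : E 0 = ⊥)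
    (hE : Monotone E) (hfin : ∀ n, Module.Finite ℂ (E n)) (S A : M →ₗ[ℂ] M)
    (hSE : ∀ n, ∀ p ∈ E n, S p ∈ E n) (hAE : ∀ n, ∀ p ∈ E n, A p ∈ E (n + 1))
    (hS : ∀ p q, inner ℂ (ι p) (ι (S q)) = inner ℂ (ι (S p)) (ι q))
    (hA : ∀ p q, inner ℂ (ι p) (ι (A q)) = -inner ℂ (ι (A p)) (ι q)) {a C r : ℝ} (ha : 0 < a)
    (hC : 0 < C) (hr : 0 < r)
    (hSa : ∀ n, ∀ p ∈ E (n + 1), (∀ q ∈ E n, inner ℂ (ι p) (ι q) = 0) →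
      a * n * ‖ι p‖ ^ 2 ≤ -(inner ℂ (ι p) (ι (S p))).re)
    (hAC : ∀ n, ∀ p ∈ E (n + 1), ‖ι (A p)‖ ≤ C * (((n : ℝ) + 1) * √((n : ℝ) + 1)) * ‖ι p‖)
    {h : H} (hh : ∀ n, ∀ p ∈ E n, inner ℂ h (ι ((r : ℂ) • p - (S p + A p))) = 0) :
    ∀ n, ∀ p ∈ E n, inner ℂ h (ι p) = 0 := by
  obtain ⟨p, hpE, hporth, hph⟩ := exists_filtered_decomposition ι E hE0 hE hfin h
  have hpE' : ∀ {i n}, i ≤ n → p i ∈ E (n + 1) := fun hi => hE (by omega) (hpE _)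
  set g : ℕ → M := fun n => ∑ j ∈ Finset.range (n + 1), p j with hg
  have hgE : ∀ n, g n ∈ E (n + 1) := fun n =>
    Submodule.sum_mem _ fun j hj => hpE' (Nat.lt_succ_iff.1 (Finset.mem_range.1 hj))
  have hgs : ∀ n, g (n + 1) = g n + p (n + 1) := fun n => Finset.sum_range_succ _ _
  have hgh : ∀ n, ∀ q ∈ E (n + 1), inner ℂ h (ι q) = inner ℂ (ι (g n)) (ι q) := fun n q hq => by
    rw [hph n q hq, map_sum]
  have hnorm : ∀ n, ‖ι (g n)‖ ^ 2 = ∑ j ∈ Finset.range (n + 1), ‖ι (p j)‖ ^ 2 := fun n => by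
    induction n with
    | zero => simp [hg]
    | succ n ih =>
      have h1 : inner ℂ (ι (p (n + 1))) (ι (g n)) = 0 := hporth _ _ (hgE n)
      have h2 := @norm_add_sq ℂ H _ _ _ (ι (p (n + 1))) (ι (g n))
      rw [h1] at h2
      rw [Finset.sum_range_succ, ← ih, hgs, map_add, add_comm, h2]
      simp
      ring
  have hSg : ∀ n, a * ∑ j ∈ Finset.range (n + 1), (j : ℝ) * ‖ι (p j)‖ ^ 2 ≤
      -(inner ℂ (ι (g n)) (ι (S (g n)))).re := fun n => by
    induction n with
    | zero =>
      have := hSa 0 (p 0) (hpE 0) (hporth 0)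
      simpa [hg] using this
    | succ n ih =>
      have h1 : inner ℂ (ι (p (n + 1))) (ι (S (g n))) = 0 := hporth _ _ (hSE _ _ (hgE n))
      have h2 : inner ℂ (ι (g n)) (ι (S (p (n + 1)))) = 0 := by
        rw [hS, ← inner_conj_symm, hporth _ _ (hSE _ _ (hgE n)), map_zero]
      have h3 := hSa (n + 1) (p (n + 1)) (hpE _) (hporth _)
      rw [Finset.sum_range_succ, mul_add, hgs, map_add S, map_add ι, map_add ι, inner_add_left,
        inner_add_right, inner_add_right, h1, h2]
      simp only [add_zero, zero_add, Complex.add_re]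
      push_cast at h3 ⊢
      linarith
  have hAg : ∀ q : M, (inner ℂ (ι q) (ι (A q))).re = 0 := fun q => by
    have h1 := hA q q
    rw [← inner_conj_symm (ι (A q))] at h1
    have h2 := congrArg Complex.re h1
    rw [Complex.neg_re, Complex.conj_re] at h2
    linarith
  -- Write g_n = g_{n-1} + p_n: A g_{n-1} has too low an order to meet p_{n+1}.
  have hflux : ∀ n, inner ℂ (ι (p (n + 1))) (ι (A (g n))) =
      inner ℂ (ι (p (n + 1))) (ι (A (p n))) := fun n => by
    cases n with
    | zero => simp [hg]
    | succ n =>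
      rw [hgs, map_add, map_add, inner_add_right, hporth _ _ (hAE _ _ (hgE n)), zero_add]
  have hmain : ∀ n, r * ‖ι (g n)‖ ^ 2 - (inner ℂ (ι (g n)) (ι (S (g n)))).re ≤
      C * (((n : ℝ) + 1) * √((n : ℝ) + 1)) * ‖ι (p (n + 1))‖ * ‖ι (p n)‖ := fun n => by
    have h1 := hh _ _ (hgE n)
    have h2 : inner ℂ h (ι (A (g n))) =
        inner ℂ (ι (g n)) (ι (A (g n))) + inner ℂ (ι (p (n + 1))) (ι (A (p n))) := by
      rw [hgh (n + 1) _ (hAE _ _ (hgE n)), hgs, map_add, inner_add_left, hflux]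
    rw [map_sub, map_smul, map_add, inner_sub_right, inner_smul_right, inner_add_right,
      hgh n _ (hgE n), hgh n _ (hSE _ _ (hgE n)), h2, inner_self_eq_norm_sq_to_K] at h1
    have h3 := congrArg Complex.re h1
    have h4 : (((r : ℝ) : ℂ) * ((‖ι (g n)‖ : ℝ) : ℂ) ^ 2).re = r * ‖ι (g n)‖ ^ 2 := by
      rw [← Complex.ofReal_pow, ← Complex.ofReal_mul, Complex.ofReal_re]
    simp only [Complex.sub_re, Complex.add_re, hAg, Complex.coe_algebraMap, h4,
      Complex.zero_re] at h3
    have h5 : (inner ℂ (ι (p (n + 1))) (ι (A (p n)))).re ≤ ‖ι (p (n + 1))‖ * ‖ι (A (p n))‖ :=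
      (Complex.re_le_norm _).trans (norm_inner_le_norm _ _)
    have h6 := mul_le_mul_of_nonneg_left (hAC n (p n) (hpE n)) (norm_nonneg (ι (p (n + 1))))
    linarith
  have hb : ∀ n, ‖ι (p n)‖ ^ 2 = 0 := by
    refine eq_zero_of_growth (a := min r a) (C := C) (fun n => sq_nonneg _) ?_ (lt_min hr ha) hC
      fun n => ?_
    · refine summable_of_sum_range_le (c := ‖h‖ ^ 2) (fun n => sq_nonneg _) fun n => ?_
      have h1 : ‖ι (g n)‖ ≤ ‖h‖ := by
        have h2 := hgh n _ (hgE n)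
        have h3 : ‖ι (g n)‖ ^ 2 ≤ ‖h‖ * ‖ι (g n)‖ := by
          have h4 := norm_inner_le_norm (𝕜 := ℂ) h (ι (g n))
          rw [h2, inner_self_eq_norm_sq_to_K] at h4
          simpa using h4
        rcases (norm_nonneg (ι (g n))).eq_or_lt with h5 | h5
        · rw [← h5]; exact norm_nonneg h
        · exact le_of_mul_le_mul_right (by nlinarith) h5
      refine le_trans ?_ (pow_le_pow_left₀ (norm_nonneg _) h1 2)
      rw [hnorm]
      exact Finset.sum_le_sum_of_subset_of_nonneg (Finset.range_subset_range.2 n.le_succ)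
        fun _ _ _ => sq_nonneg _
    · have h1 := hmain n
      have h2 := hSg n
      rw [hnorm] at h1
      have h3 : min r a * ∑ j ∈ Finset.range (n + 1), ((j : ℝ) + 1) * ‖ι (p j)‖ ^ 2 ≤
          r * ∑ j ∈ Finset.range (n + 1), ‖ι (p j)‖ ^ 2 +
          a * ∑ j ∈ Finset.range (n + 1), (j : ℝ) * ‖ι (p j)‖ ^ 2 := by
        rw [Finset.mul_sum, Finset.mul_sum, Finset.mul_sum, ← Finset.sum_add_distrib]
        refine Finset.sum_le_sum fun j _ => ?_
        have e1 : min r a * ‖ι (p j)‖ ^ 2 ≤ r * ‖ι (p j)‖ ^ 2 :=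
          mul_le_mul_of_nonneg_right (min_le_left _ _) (sq_nonneg _)
        have e2 : min r a * ((j : ℝ) * ‖ι (p j)‖ ^ 2) ≤ a * ((j : ℝ) * ‖ι (p j)‖ ^ 2) :=
          mul_le_mul_of_nonneg_right (min_le_right _ _) (by positivity)
        linarith
      have h4 : ‖ι (p (n + 1))‖ * ‖ι (p n)‖ ≤ ‖ι (p n)‖ ^ 2 + ‖ι (p (n + 1))‖ ^ 2 := by
        nlinarith [sq_nonneg (‖ι (p (n + 1))‖ - ‖ι (p n)‖), sq_nonneg (‖ι (p (n + 1))‖),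
          sq_nonneg (‖ι (p n)‖)]
      have h5 := mul_le_mul_of_nonneg_left h4
        (by positivity : 0 ≤ C * (((n : ℝ) + 1) * √((n : ℝ) + 1)))
      linarith
  have hg0 : ∀ n, ι (g n) = 0 := fun n => by
    have := hnorm n
    simp only [hb, Finset.sum_const_zero] at this
    exact norm_eq_zero.1 (pow_eq_zero_iff (two_ne_zero) |>.1 this)
  intro n q hq
  rw [hgh n q (hE n.le_succ hq), hg0, inner_zero_left]

end Filtered

/-! ### Polynomials in the modes of a box -/

/-- The non-zero modes of the box of size `N`. -/
def modes (N : ℕ) : Finset Mode := (box N).erase 0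

theorem mem_modes {N : ℕ} {k : Mode} : k ∈ modes N ↔ k ≠ 0 ∧ k ∈ box N := Finset.mem_erase

theorem neg_mem_modes {N : ℕ} {k : Mode} : -k ∈ modes N ↔ k ∈ modes N := by
  rw [mem_modes, mem_modes, neg_mem_box, neg_ne_zero]

/-- The polynomials of degree less than `n` in the non-zero modes of the box of size `N`. -/
def polySpace (N : ℕ) : ℕ → Submodule ℂ cyl
  | 0 => ⊥
  | n + 1 => (Submodule.span ℂ {1} ⊔ polySpace N n) ⊔
      ⨆ k ∈ modes N, (polySpace N n).map (LinearMap.mulLeft ℂ (X k))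

theorem polySpace_succ_le {N n : ℕ} {Q : Submodule ℂ cyl} (h1 : 1 ∈ Q)
    (h2 : ∀ p ∈ polySpace N n, p ∈ Q) (h3 : ∀ k ∈ modes N, ∀ p ∈ polySpace N n, X k * p ∈ Q) :
    polySpace N (n + 1) ≤ Q := by
  refine sup_le (sup_le ?_ h2) (iSup₂_le fun k hk => ?_)
  · rw [Submodule.span_le, Set.singleton_subset_iff]; exact h1
  · rintro _ ⟨p, hp, rfl⟩
    exact h3 k hk p hp

theorem one_mem_polySpace (N n : ℕ) : 1 ∈ polySpace N (n + 1) :=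
  Submodule.mem_sup_left (Submodule.mem_sup_left (Submodule.mem_span_singleton_self 1))

theorem polySpace_mono (N : ℕ) : Monotone (polySpace N) :=
  monotone_nat_of_le_succ fun _ => le_sup_of_le_left le_sup_right

theorem X_mul_mem_polySpace {N n : ℕ} {k : Mode} (hk : k ∈ modes N) {p : cyl}
    (hp : p ∈ polySpace N n) : X k * p ∈ polySpace N (n + 1) := by
  refine Submodule.mem_sup_right ?_
  exact (le_iSup₂ (f := fun k (_ : k ∈ modes N) => (polySpace N n).map (LinearMap.mulLeft ℂ (X k)))
    k hk) ⟨p, hp, rfl⟩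

theorem finite_polySpace (N n : ℕ) : Module.Finite ℂ (polySpace N n) := by
  rw [Module.Finite.iff_fg]
  induction n with
  | zero => exact Submodule.fg_bot
  | succ n ih =>
    exact ((Submodule.fg_span_singleton _).sup ih).sup
      (Submodule.fg_biSup _ _ fun k _ => ih.map _)

theorem D_mem_polySpace {N : ℕ} (k : Mode) {n : ℕ} {p : cyl} (hp : p ∈ polySpace N (n + 1)) :
    D k p ∈ polySpace N n := by
  -- Truncated subtraction lets the induction start at the zero space.
  have key : ∀ n, (∀ q ∈ polySpace N n, D k q ∈ polySpace N (n - 1)) := by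
    intro n
    induction n with
    | zero => intro q hq; rw [(Submodule.mem_bot ℂ).1 hq, map_zero]; exact Submodule.zero_mem _
    | succ n ih =>
      intro q hq
      refine polySpace_succ_le (Q := (polySpace N n).comap (D k).toLinearMap) ?_ ?_ ?_ hq
      · simp
      · intro q hq
        exact polySpace_mono N (Nat.sub_le n 1) (ih q hq)
      · intro j hj q hq
        simp only [Submodule.mem_comap, Derivation.coeFn_coe,
          Derivation.leibniz, smul_eq_mul, D_X]
        refine Submodule.add_mem _ ?_ ?_
        · rcases n with _ | n
          · rw [(Submodule.mem_bot ℂ).1 hq, map_zero, mul_zero]; exact Submodule.zero_mem _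
          · exact X_mul_mem_polySpace hj (ih q hq)
        · split_ifs
          · rwa [mul_one]
          · rw [mul_zero]; exact Submodule.zero_mem _
  exact key (n + 1) p hp

theorem D_eq_zero_of_mem_polySpace {N : ℕ} {k : Mode} (hk : k ∉ modes N) {n : ℕ} {p : cyl}
    (hp : p ∈ polySpace N n) : D k p = 0 := by
  induction n generalizing p with
  | zero => rw [(Submodule.mem_bot ℂ).1 hp, map_zero]
  | succ n ih =>
    refine polySpace_succ_le (Q := LinearMap.ker (D k).toLinearMap) ?_ ?_ ?_ hp
    · simp
    · intro q hq; exact ih hq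
    · intro j hj q hq
      simp only [LinearMap.mem_ker, Derivation.coeFn_coe,
        Derivation.leibniz, smul_eq_mul, D_X, ih hq]
      rw [if_neg, mul_zero, mul_zero, add_zero]
      intro h
      rw [add_comm, add_eq_zero_iff_eq_neg] at h
      exact hk (h ▸ neg_mem_modes.2 hj)

/-- The Euler derivation. -/
def euler (N : ℕ) : Derivation ℂ cyl cyl := ∑ k ∈ modes N, X (-k) • D k

theorem euler_apply (N : ℕ) (F : cyl) : euler N F = ∑ k ∈ modes N, X (-k) * D k F := by
  rw [euler, derivation_sum_apply]
  rfl

theorem euler_X {N : ℕ} {j : Mode} (hj : j ∈ modes N) : euler N (X j) = X j := by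
  rw [euler_apply, Finset.sum_eq_single_of_mem (-j) (neg_mem_modes.2 hj)]
  · rw [neg_neg, D_X, add_neg_cancel, if_pos rfl, mul_one]
  · intro k _ hk
    rw [D_X, if_neg, mul_zero]
    intro h
    rw [add_comm, add_eq_zero_iff_eq_neg] at h
    exact hk h

/-- The Euler derivation multiplies the part of top degree n by n. The number operator differs from
it by second derivatives, which lower the degree, so it inherits this. -/
theorem euler_sub_mem {N n : ℕ} {p : cyl} (hp : p ∈ polySpace N (n + 1)) :
    euler N p - (n : ℂ) • p ∈ polySpace N n := by
  induction n generalizing p with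
  | zero =>
    have : ∀ k, D k p = 0 := fun k => (Submodule.mem_bot ℂ).1 (D_mem_polySpace k hp)
    simp [euler_apply, this]
  | succ n ih =>
    refine polySpace_succ_le (Q := (polySpace N (n + 1)).comap
      ((euler N).toLinearMap - ((n + 1 : ℕ) : ℂ) • LinearMap.id)) ?_ ?_ ?_ hp
    · have h : euler N 1 - ((n + 1 : ℕ) : ℂ) • (1 : cyl) ∈ polySpace N (n + 1) := by
        rw [Derivation.map_one_eq_zero]
        exact Submodule.sub_mem _ (Submodule.zero_mem _)
          (Submodule.smul_mem _ _ (one_mem_polySpace N n))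
      exact h
    · intro q hq
      have h : euler N q - ((n + 1 : ℕ) : ℂ) • q ∈ polySpace N (n + 1) := by
        have e : euler N q - ((n + 1 : ℕ) : ℂ) • q = (euler N q - (n : ℂ) • q) - q := by
          push_cast; module
        rw [e]
        exact Submodule.sub_mem _ (polySpace_mono N n.le_succ (ih hq)) hq
      exact h
    · intro j hj q hq
      have h : euler N (X j * q) - ((n + 1 : ℕ) : ℂ) • (X j * q) ∈ polySpace N (n + 1) := by
        have e : euler N (X j * q) - ((n + 1 : ℕ) : ℂ) • (X j * q) =
            X j * (euler N q - (n : ℂ) • q) := by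
          rw [Derivation.leibniz, euler_X hj, smul_eq_mul, smul_eq_mul, mul_sub, mul_smul_comm]
          push_cast
          rw [mul_comm q]
          module
        rw [e]
        exact X_mul_mem_polySpace hj (ih hq)
      exact h

/-- The number operator. -/
def numOp (N : ℕ) : cyl →ₗ[ℂ] cyl :=
  ∑ k ∈ modes N, (LinearMap.mulLeft ℂ (X (-k)) ∘ₗ (D k).toLinearMap
    - (D (-k)).toLinearMap ∘ₗ (D k).toLinearMap)

theorem numOp_apply (N : ℕ) (F : cyl) :
    numOp N F = ∑ k ∈ modes N, (X (-k) * D k F - D (-k) (D k F)) := by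
  simp [numOp, LinearMap.sum_apply]

theorem numOp_sub_mem {N n : ℕ} {p : cyl} (hp : p ∈ polySpace N (n + 1)) :
    numOp N p - (n : ℂ) • p ∈ polySpace N n := by
  have e : numOp N p - (n : ℂ) • p =
      (euler N p - (n : ℂ) • p) - ∑ k ∈ modes N, D (-k) (D k p) := by
    rw [numOp_apply, euler_apply, Finset.sum_sub_distrib]
    abel
  rw [e]
  refine Submodule.sub_mem _ (euler_sub_mem hp) (Submodule.sum_mem _ fun k _ => ?_)
  exact D_mem_polySpace _ (polySpace_mono N n.le_succ (D_mem_polySpace k hp))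

theorem numOp_mem {N n : ℕ} {p : cyl} (hp : p ∈ polySpace N n) : numOp N p ∈ polySpace N n := by
  cases n with
  | zero => rw [(Submodule.mem_bot ℂ).1 hp, map_zero]; exact Submodule.zero_mem _
  | succ n =>
    have h := Submodule.add_mem _ (polySpace_mono N n.le_succ (numOp_sub_mem hp))
      (Submodule.smul_mem _ (n : ℂ) hp)
    rwa [sub_add_cancel] at h

theorem symPart_mem {N n : ℕ} {p : cyl} (hp : p ∈ polySpace N n) :
    symPart (box N) p ∈ polySpace N n := by
  cases n with
  | zero => rw [(Submodule.mem_bot ℂ).1 hp, map_zero]; exact Submodule.zero_mem _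
  | succ n =>
    rw [symPart_apply]
    refine Submodule.smul_mem _ _ (Submodule.sum_mem _ fun k hk => ?_)
    by_cases hk0 : k = 0
    · rw [hk0, normSq_zero, Complex.ofReal_zero, zero_smul]; exact Submodule.zero_mem _
    · have h := D_mem_polySpace k hp
      refine Submodule.smul_mem _ _ (Submodule.sub_mem _ ?_ ?_)
      · exact polySpace_mono N n.le_succ (D_mem_polySpace _ (polySpace_mono N n.le_succ h))
      · exact X_mul_mem_polySpace (neg_mem_modes.2 (mem_modes.2 ⟨hk0, hk⟩)) h

theorem antiPart_mem {N n : ℕ} {c : ℝ} {p : cyl} (hp : p ∈ polySpace N n) :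
    antiPart N c p ∈ polySpace N (n + 1) := by
  cases n with
  | zero => rw [(Submodule.mem_bot ℂ).1 hp, map_zero]; exact Submodule.zero_mem _
  | succ n =>
    rw [antiPart_apply]
    refine Submodule.smul_mem _ _ (Submodule.sum_mem _ fun m _ => Submodule.sum_mem _ fun l _ => ?_)
    by_cases hK : kernel N m l = 0
    · rw [hK, Complex.ofReal_zero, zero_smul]; exact Submodule.zero_mem _
    · obtain ⟨hm, hl, -, hm', hl', -⟩ := of_kernel_ne_zero hK
      rw [mul_assoc]
      exact Submodule.smul_mem _ _ (X_mul_mem_polySpace (mem_modes.2 ⟨hm, hm'⟩)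
        (X_mul_mem_polySpace (mem_modes.2 ⟨hl, hl'⟩) (D_mem_polySpace _ hp)))

section

variable {Ω : Type*} [MeasurableSpace Ω] {P : Measure Ω} {η : Mode → Ω → ℂ}

theorem expect_mul_numOp (hη : IsWhiteNoise P η) (N : ℕ) (F G : cyl) :
    expect hη (G * numOp N F) = ∑ k ∈ modes N, expect hη (D (-k) G * D k F) := by
  rw [numOp_apply, Finset.mul_sum, map_sum]
  refine Finset.sum_congr rfl fun k hk => ?_
  have h := expect_D hη (neg_ne_zero.2 (mem_modes.1 hk).1) (G * D k F)
  rw [Derivation.leibniz, smul_eq_mul, smul_eq_mul, map_add] at h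
  rw [mul_sub, map_sub, show G * (X (-k) * D k F) = X (-k) * (G * D k F) by ring, ← h,
    mul_comm (D k F)]
  ring

theorem D_neg_cconj (k : Mode) (F : cyl) : D (-k) (cconj F) = cconj (D k F) := by
  rw [D_cconj, neg_neg]

theorem inner_numOp (hη : IsWhiteNoise P η) (N : ℕ) (F G : cyl) :
    inner ℂ (toL2 hη F) (toL2 hη (numOp N G)) =
      ∑ k ∈ modes N, inner ℂ (toL2 hη (D k F)) (toL2 hη (D k G)) := by
  rw [inner_toL2, expect_mul_numOp]
  simp_rw [D_neg_cconj, inner_toL2]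

theorem inner_symPart (hη : IsWhiteNoise P η) (T : Finset Mode) (F G : cyl) :
    inner ℂ (toL2 hη F) (toL2 hη (symPart T G)) =
      -(1 / 2 * ∑ k ∈ T, (normSq k : ℂ) * inner ℂ (toL2 hη (D k F)) (toL2 hη (D k G))) := by
  rw [inner_toL2, expect_mul_symPart]
  simp_rw [D_neg_cconj, inner_toL2]

theorem inner_symPart_left (hη : IsWhiteNoise P η) (T : Finset Mode) (F G : cyl) :
    inner ℂ (toL2 hη F) (toL2 hη (symPart T G)) =
      inner ℂ (toL2 hη (symPart T F)) (toL2 hη G) := by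
  rw [← inner_conj_symm (toL2 hη (symPart T F)), inner_symPart, inner_symPart]
  simp only [map_neg, map_mul, map_sum, Complex.conj_ofReal, inner_conj_symm]
  congr 2
  have h2 : conj (2 : ℂ) = 2 := map_ofNat _ 2
  simp [h2]

theorem ev_cconj (v : Mode → ℂ) (F : cyl) : ev v (cconj F) = conj (ev v F) := rfl

theorem ev_X (v : Mode → ℂ) (k : Mode) : ev v (X k) = v k := rfl

theorem ev_antiPart_cconj (N : ℕ) (c : ℝ) (F : cyl) {v : Mode → ℂ} (hv : IsRealMode v) :
    ev v (antiPart N c (cconj F)) = conj (ev v (antiPart N c F)) := by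
  rw [antiPart_apply, antiPart_apply, map_smul, map_smul, smul_eq_mul, smul_eq_mul, map_mul,
    Complex.conj_ofReal, map_sum, map_sum, map_sum, ← sum_box_neg]
  congr 1
  refine Finset.sum_congr rfl fun m _ => ?_
  rw [map_sum, map_sum, map_sum, ← sum_box_neg]
  refine Finset.sum_congr rfl fun l _ => ?_
  have h : -(-m + -l) = - -(m + l) := by abel
  rw [h, D_neg_cconj, kernel_neg]
  simp only [map_smul, smul_eq_mul, map_mul, ev_cconj, ev_X, hv.2, Complex.conj_ofReal]

theorem inner_antiPart (hη : IsWhiteNoise P η) (N : ℕ) (c : ℝ) (F G : cyl) :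
    inner ℂ (toL2 hη F) (toL2 hη (antiPart N c G)) =
      -inner ℂ (toL2 hη (antiPart N c F)) (toL2 hη G) := by
  rw [inner_toL2, inner_toL2, expect_mul_antiPart]
  congr 1
  refine expect_congr hη fun v hv => ?_
  change ev v (G * antiPart N c (cconj F)) = ev v (cconj (antiPart N c F) * G)
  rw [map_mul, map_mul, ev_antiPart_cconj N c F hv, ev_cconj, mul_comm]

/-! ### Estimates on polynomials of bounded degree -/

/-- The left side is ⟨p, numOp p⟩. Modulo lower degrees, to which p is orthogonal, `numOp` acts as
multiplication by n. -/
theorem sum_norm_D_sq_of_orthogonal (hη : IsWhiteNoise P η) {N n : ℕ} {p : cyl}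
    (hp : p ∈ polySpace N (n + 1))
    (ho : ∀ q ∈ polySpace N n, inner ℂ (toL2 hη p) (toL2 hη q) = 0) :
    ∑ k ∈ modes N, ‖toL2 hη (D k p)‖ ^ 2 = n * ‖toL2 hη p‖ ^ 2 := by
  have h1 := inner_numOp hη N p p
  have h2 := ho _ (numOp_sub_mem hp)
  rw [map_sub, map_smul, inner_sub_right, sub_eq_zero, inner_smul_right] at h2
  rw [h2] at h1
  simp_rw [inner_self_eq_norm_sq_to_K] at h1
  simp only [Complex.coe_algebraMap] at h1
  exact_mod_cast h1.symm

/-- Split off the projection s of p on lower degrees. Cross terms vanish because `numOp` maps s to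
lower degrees again, and the induction applies to s. -/
theorem sum_norm_D_sq_le (hη : IsWhiteNoise P η) {N n : ℕ} {p : cyl}
    (hp : p ∈ polySpace N (n + 1)) :
    ∑ k ∈ modes N, ‖toL2 hη (D k p)‖ ^ 2 ≤ n * ‖toL2 hη p‖ ^ 2 := by
  induction n generalizing p with
  | zero =>
    refine (sum_norm_D_sq_of_orthogonal hη hp fun q hq => ?_).le
    rw [(Submodule.mem_bot ℂ).1 hq, map_zero, inner_zero_right]
  | succ n ih =>
    let K : Submodule ℂ (Lp ℂ 2 P) := (polySpace N (n + 1)).map (toL2 hη)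
    have : Module.Finite ℂ (polySpace N (n + 1)) := finite_polySpace N (n + 1)
    have hKfin : FiniteDimensional ℂ K := inferInstance
    obtain ⟨s, hs, hsp⟩ := Submodule.starProjection_apply_mem K (toL2 hη p)
    set q := p - s with hq
    have hqm : q ∈ polySpace N (n + 2) :=
      Submodule.sub_mem _ hp (polySpace_mono N (n + 1).le_succ hs)
    have hqo : ∀ t ∈ polySpace N (n + 1), inner ℂ (toL2 hη q) (toL2 hη t) = 0 := fun t ht => by
      rw [hq, map_sub, hsp]
      exact Submodule.starProjection_inner_eq_zero _ _ (Submodule.mem_map_of_mem ht)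
    have e1 := sum_norm_D_sq_of_orthogonal hη hqm hqo
    have e2 := ih hs
    have hps : p = q + s := by rw [hq, sub_add_cancel]
    have e3 : inner ℂ (toL2 hη q) (toL2 hη s) = 0 := hqo s hs
    have e4 : ∑ k ∈ modes N, inner ℂ (toL2 hη (D k q)) (toL2 hη (D k s)) = 0 := by
      rw [← inner_numOp]; exact hqo _ (numOp_mem hs)
    have e5 : ∑ k ∈ modes N, ‖toL2 hη (D k p)‖ ^ 2 =
        ∑ k ∈ modes N, ‖toL2 hη (D k q)‖ ^ 2 + ∑ k ∈ modes N, ‖toL2 hη (D k s)‖ ^ 2 := by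
      have e6 := congrArg Complex.re e4
      rw [Complex.re_sum, Complex.zero_re] at e6
      have e7 : ∀ k, ‖toL2 hη (D k p)‖ ^ 2 = ‖toL2 hη (D k q)‖ ^ 2 + ‖toL2 hη (D k s)‖ ^ 2 +
          2 * (inner ℂ (toL2 hη (D k q)) (toL2 hη (D k s))).re := fun k => by
        rw [hps, map_add, map_add, @norm_add_sq ℂ]
        simp only [RCLike.re_to_complex]
        ring
      simp_rw [e7, Finset.sum_add_distrib, ← Finset.mul_sum, e6]
      ring
    have e8 : ‖toL2 hη p‖ ^ 2 = ‖toL2 hη q‖ ^ 2 + ‖toL2 hη s‖ ^ 2 := by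
      rw [hps, map_add, @norm_add_sq ℂ, e3]
      simp
    rw [e5, e1, e8]
    push_cast
    nlinarith [sq_nonneg ‖toL2 hη s‖]

theorem norm_D_le (hη : IsWhiteNoise P η) {N n : ℕ} {p : cyl} (hp : p ∈ polySpace N (n + 1))
    (k : Mode) : ‖toL2 hη (D k p)‖ ≤ √(n : ℝ) * ‖toL2 hη p‖ := by
  by_cases hk : k ∈ modes N
  · have h := (Finset.single_le_sum (f := fun k => ‖toL2 hη (D k p)‖ ^ 2)
      (fun _ _ => sq_nonneg _) hk).trans (sum_norm_D_sq_le hη hp)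
    refine le_of_sq_le_sq ?_ (by positivity)
    rw [mul_pow, Real.sq_sqrt (Nat.cast_nonneg n)]
    exact h
  · rw [D_eq_zero_of_mem_polySpace hk hp, map_zero, norm_zero]
    positivity

theorem norm_X_mul_sq (hη : IsWhiteNoise P η) (k : Mode) (p : cyl) :
    ((‖toL2 hη (X k * p)‖ ^ 2 : ℝ) : ℂ) = expect hη (X k * (X (-k) * (cconj p * p))) := by
  rw [norm_sq_toL2]
  refine expect_congr hη fun v hv => ?_
  change ev v (cconj (X k * p) * (X k * p)) = ev v (X k * (X (-k) * (cconj p * p)))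
  simp only [map_mul, ev_cconj, ev_X, hv.2]
  ring

theorem norm_X_neg_mul (hη : IsWhiteNoise P η) (k : Mode) (p : cyl) :
    ‖toL2 hη (X (-k) * p)‖ = ‖toL2 hη (X k * p)‖ := by
  have h1 := norm_X_mul_sq hη (-k) p
  have h2 := norm_X_mul_sq hη k p
  rw [neg_neg, show X (-k) * (X k * (cconj p * p)) = X k * (X (-k) * (cconj p * p)) by ring,
    ← h2] at h1
  exact (sq_eq_sq₀ (norm_nonneg _) (norm_nonneg _)).1 (by exact_mod_cast h1)

/-- With x and y the norms of X_k p and p, integration by parts gives x² ≤ y² + 2√n x y: the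
derivative falls on X_{-k} or on one of the two copies of p, where `norm_D_le` costs √n. -/
theorem norm_X_mul_le (hη : IsWhiteNoise P η) {N n : ℕ} {p : cyl} (hp : p ∈ polySpace N (n + 1))
    {k : Mode} (hk : k ≠ 0) : ‖toL2 hη (X k * p)‖ ≤ 2 * √((n : ℝ) + 1) * ‖toL2 hη p‖ := by
  set x := ‖toL2 hη (X k * p)‖ with hx
  have h1 := norm_X_mul_sq hη k p
  have e1 : D k (X (-k) * (cconj p * p)) =
      cconj p * p + X (-k) * p * cconj (D (-k) p) + X (-k) * cconj p * D k p := by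
    rw [Derivation.leibniz, Derivation.leibniz, D_X, neg_add_cancel, if_pos rfl, D_cconj]
    simp only [smul_eq_mul]
    ring
  rw [← expect_D hη hk, e1, map_add, map_add, ← norm_sq_toL2] at h1
  have h2 : ‖expect hη (X (-k) * p * cconj (D (-k) p))‖ ≤ x * (√(n : ℝ) * ‖toL2 hη p‖) := by
    refine (norm_expect_mul_le hη _ _).trans ?_
    rw [norm_toL2_cconj, norm_toL2_cconj, norm_X_neg_mul]
    exact mul_le_mul_of_nonneg_left (norm_D_le hη hp _) (norm_nonneg _)
  have h3 : ‖expect hη (X (-k) * cconj p * D k p)‖ ≤ x * (√(n : ℝ) * ‖toL2 hη p‖) := by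
    have e2 : expect hη (X (-k) * cconj p * D k p) = expect hη (cconj (X k * p) * D k p) := by
      refine expect_congr hη fun v hv => ?_
      change ev v (X (-k) * cconj p * D k p) = ev v (cconj (X k * p) * D k p)
      simp only [map_mul, ev_cconj, ev_X, hv.2]
    rw [e2]
    refine (norm_expect_mul_le hη _ _).trans ?_
    rw [norm_toL2_cconj, norm_toL2_cconj]
    exact mul_le_mul_of_nonneg_left (norm_D_le hη hp _) (norm_nonneg _)
  have h4 : x ^ 2 ≤ ‖toL2 hη p‖ ^ 2 + x * (√(n : ℝ) * ‖toL2 hη p‖) +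
      x * (√(n : ℝ) * ‖toL2 hη p‖) := by
    have h5 := congrArg (fun z : ℂ => ‖z‖) h1
    simp only [Complex.norm_real, Real.norm_of_nonneg (sq_nonneg _)] at h5
    rw [h5]
    refine (norm_add₃_le).trans (add_le_add_three ?_ h2 h3)
    rw [Complex.norm_real, Real.norm_of_nonneg (sq_nonneg _)]
  set y := ‖toL2 hη p‖ with hy
  have hy0 : 0 ≤ y := norm_nonneg _
  have hn : √(n : ℝ) ≤ √((n : ℝ) + 1) := Real.sqrt_le_sqrt (by linarith)
  -- Completing the square in x.
  have h6 : (x - √(n : ℝ) * y) ^ 2 ≤ (√((n : ℝ) + 1) * y) ^ 2 := by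
    have e5 : √(n : ℝ) ^ 2 = n := Real.sq_sqrt (Nat.cast_nonneg n)
    have e6 : √((n : ℝ) + 1) ^ 2 = n + 1 := Real.sq_sqrt (by positivity)
    rw [mul_pow, e6, sub_sq, mul_pow, e5]
    nlinarith
  have h7 := le_of_sq_le_sq h6 (by positivity)
  nlinarith [mul_le_mul_of_nonneg_right hn hy0]

/-- One derivative and two multiplications each cost the square root of the degree, whence the power
3/2. The constant depends on N, which is harmless since it serves only solvability at fixed N. -/
theorem norm_antiPart_le (hη : IsWhiteNoise P η) (N : ℕ) (c : ℝ) :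
    ∃ C : ℝ, 0 < C ∧ ∀ (n : ℕ), ∀ p ∈ polySpace N (n + 1),
      ‖toL2 hη (antiPart N c p)‖ ≤ C * (((n : ℝ) + 1) * √((n : ℝ) + 1)) * ‖toL2 hη p‖ := by
  refine ⟨|c| * ((∑ m ∈ box N, ∑ l ∈ box N, |kernel N m l|) * 4) + 1, by positivity, ?_⟩
  intro n p hp
  have key : ∀ m l, ‖toL2 hη ((kernel N m l : ℂ) • (X m * X l * D (-(m + l)) p))‖ ≤
      |kernel N m l| * 4 * ((((n : ℝ) + 1) * √((n : ℝ) + 1)) * ‖toL2 hη p‖) := by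
    intro m l
    by_cases hK : kernel N m l = 0
    · simp [hK]
    obtain ⟨hm, hl, -, hm', hl', -⟩ := of_kernel_ne_zero hK
    rw [map_smul, norm_smul, Complex.norm_real, Real.norm_eq_abs, mul_assoc (|kernel N m l|)]
    refine mul_le_mul_of_nonneg_left ?_ (abs_nonneg _)
    have hD := D_mem_polySpace (-(m + l)) hp
    have hDn := norm_D_le hη hp (-(m + l))
    cases n with
    | zero =>
      rw [(Submodule.mem_bot ℂ).1 hD, mul_zero, map_zero, norm_zero]
      positivity
    | succ n =>
      have h1 := norm_X_mul_le hη hD hl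
      have h2 := norm_X_mul_le hη (X_mul_mem_polySpace (mem_modes.2 ⟨hl, hl'⟩) hD) hm
      rw [mul_assoc]
      push_cast at h1 h2 hDn ⊢
      have e1 : √((n : ℝ) + 1) ≤ √((n : ℝ) + 1 + 1) := Real.sqrt_le_sqrt (by linarith)
      have e2 : √((n : ℝ) + 1 + 1) * √((n : ℝ) + 1 + 1) = (n : ℝ) + 1 + 1 :=
        Real.mul_self_sqrt (by positivity)
      calc _ ≤ 2 * √((n : ℝ) + 1 + 1) * (2 * √((n : ℝ) + 1) *
            (√((n : ℝ) + 1) * ‖toL2 hη p‖)) := by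
            refine h2.trans (mul_le_mul_of_nonneg_left (h1.trans ?_) (by positivity))
            exact mul_le_mul_of_nonneg_left hDn (by positivity)
        _ ≤ 2 * √((n : ℝ) + 1 + 1) * (2 * √((n : ℝ) + 1 + 1) *
            (√((n : ℝ) + 1 + 1) * ‖toL2 hη p‖)) := by gcongr
        _ = 4 * ((√((n : ℝ) + 1 + 1) * √((n : ℝ) + 1 + 1)) * √((n : ℝ) + 1 + 1) *
            ‖toL2 hη p‖) := by ring
        _ = _ := by rw [e2]
  rw [antiPart_apply, map_smul, norm_smul, Complex.norm_real, Real.norm_eq_abs, map_sum]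
  have h1 : ‖∑ m ∈ box N, toL2 hη (∑ l ∈ box N,
      (kernel N m l : ℂ) • (X m * X l * D (-(m + l)) p))‖ ≤
      ∑ m ∈ box N, ∑ l ∈ box N,
        |kernel N m l| * 4 * ((((n : ℝ) + 1) * √((n : ℝ) + 1)) * ‖toL2 hη p‖) := by
    refine (norm_sum_le _ _).trans (Finset.sum_le_sum fun m _ => ?_)
    rw [map_sum]
    exact (norm_sum_le _ _).trans (Finset.sum_le_sum fun l _ => key m l)
  simp_rw [← Finset.sum_mul] at h1
  have h2 := mul_le_mul_of_nonneg_left h1 (abs_nonneg c)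
  have h3 : 0 ≤ (((n : ℝ) + 1) * √((n : ℝ) + 1)) * ‖toL2 hη p‖ := by positivity
  linarith

end

/-! ### Solvability of the resolvent equation for polynomials -/

section

variable {Ω : Type*} [MeasurableSpace Ω] {P : Measure Ω} {η : Mode → Ω → ℂ}

theorem exists_toComplexL2_eq (hη : IsWhiteNoise P η) {F : cyl}
    (hF : ∀ v, IsRealMode v → conj (ev v F) = ev v F) :
    ∃ f : Lp ℝ 2 P, toComplexL2 P f = toL2 hη F ∧ f =ᵐ[P] fun ω => (ev (fun k => η k ω) F).re := by
  have hm : MemLp (fun ω => (ev (fun k => η k ω) F).re) 2 P := (hη.memLp_cyl F).re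
  refine ⟨hm.toLp _, Lp.ext ?_, hm.coeFn_toLp⟩
  filter_upwards [coeFn_toComplexL2 (hm.toLp _), hm.coeFn_toLp, coeFn_toL2 hη F,
    hη.ae_isRealMode] with ω h1 h2 h3 h4
  rw [h1, h2, h3]
  exact Complex.conj_eq_iff_re.1 (hF _ h4)

theorem conj_ev_generator {V : cyl} (hV : cconj V = V) {T : Finset Mode}
    (hT : ∀ k, k ∉ T → D k V = 0) (N : ℕ) (c : ℝ) {v : Mode → ℂ} (hv : IsRealMode v) :
    conj (ev v (symPart T V + antiPart N c V)) = ev v (symPart T V + antiPart N c V) := by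
  have hre : V.1 = fun v => (((V.1 v).re : ℝ) : ℂ) := funext fun v =>
    (Complex.conj_eq_iff_re.1 (congrFun (congrArg Subtype.val hV) v)).symm
  rw [← gen_eq hre hT N c hv, Complex.conj_ofReal]

theorem inner_resolv_eq_zero_of_real (hη : IsWhiteNoise P η) {N : ℕ} {c r : ℝ} {h : Lp ℝ 2 P}
    (hh : ∀ p ∈ genGraphCyl P η N c, inner ℝ h (r • p.1 - p.2) = 0) {V : cyl} (hV : cconj V = V)
    {T : Finset Mode} (hT : ∀ k, k ∉ T → D k V = 0) :
    inner ℂ (toComplexL2 P h) (toL2 hη (resolv T N c r V)) = 0 := by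
  obtain ⟨f, hf, -⟩ := exists_toComplexL2_eq hη (F := V) fun v _ => by rw [← ev_cconj, hV]
  obtain ⟨g, hg, -⟩ := exists_toComplexL2_eq hη (F := symPart T V + antiPart N c V) fun v hv =>
    conj_ev_generator hV hT N c hv
  have h1 := hh (f, g) ((mem_genGraphCyl_iff hη N c _).2 ⟨V, T, hV, hT, hf, hg⟩)
  rw [← toComplexL2_resolv (p := (f, g)) hη r hf hg, inner_toComplexL2, h1, Complex.ofReal_zero]

/-- The hypothesis on h concerns real cylinder functions only; F is split into its real and
imaginary parts. The box is stable under k ↦ -k, so both still depend only on its modes. -/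
theorem inner_resolv_eq_zero (hη : IsWhiteNoise P η) {N : ℕ} {c r : ℝ} {h : Lp ℝ 2 P}
    (hh : ∀ p ∈ genGraphCyl P η N c, inner ℝ h (r • p.1 - p.2) = 0) {F : cyl}
    (hT : ∀ k, k ∉ box N → D k F = 0) :
    inner ℂ (toComplexL2 P h) (toL2 hη (resolv (box N) N c r F)) = 0 := by
  have hT' : ∀ k, k ∉ box N → D k (cconj F) = 0 := fun k hk => by
    rw [D_cconj, hT _ (fun h => hk (neg_mem_box.1 h))]
    exact Subtype.ext (funext fun _ => map_zero _)
  have h2 : conj (2 : ℂ) = 2 := map_ofNat _ 2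
  set V := (1 / 2 : ℂ) • F + (1 / 2 : ℂ) • cconj F with hV
  set W := (-Complex.I / 2) • F + (Complex.I / 2) • cconj F with hW
  have hVc : cconj V = V := by
    rw [hV, cconj_add, cconj_smul, cconj_smul, cconj_cconj, add_comm]
    simp [h2]
  have hWc : cconj W = W := by
    rw [hW, cconj_add, cconj_smul, cconj_smul, cconj_cconj, add_comm]
    simp [h2]
  have hF : F = V + Complex.I • W := by
    have hI : Complex.I * (-Complex.I / 2) = 1 / 2 := by
      linear_combination (-1 / 2) * Complex.I_mul_I
    have hI' : Complex.I * (Complex.I / 2) = -1 / 2 := by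
      linear_combination (1 / 2) * Complex.I_mul_I
    rw [hV, hW, smul_add, smul_smul, smul_smul, hI, hI']
    module
  have hVT : ∀ k, k ∉ box N → D k V = 0 := fun k hk => by
    rw [hV, map_add, Derivation.map_smul, Derivation.map_smul, hT k hk, hT' k hk]; simp
  have hWT : ∀ k, k ∉ box N → D k W = 0 := fun k hk => by
    rw [hW, map_add, Derivation.map_smul, Derivation.map_smul, hT k hk, hT' k hk]; simp
  rw [hF, map_add, map_smul, map_add, map_smul, inner_add_right, inner_smul_right,
    inner_resolv_eq_zero_of_real hη hh hVc hVT, inner_resolv_eq_zero_of_real hη hh hWc hWT,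
    mul_zero, add_zero]

/-- The abstract criterion applies with a = 1/2, because |k|² ≥ 1 on nonzero modes makes the
symmetric part dominate half the number operator. -/
theorem inner_polySpace_eq_zero (hη : IsWhiteNoise P η) {N : ℕ} {c r : ℝ} (hr : 0 < r)
    {h : Lp ℝ 2 P} (hh : ∀ p ∈ genGraphCyl P η N c, inner ℝ h (r • p.1 - p.2) = 0) {n : ℕ}
    {p : cyl} (hp : p ∈ polySpace N n) : inner ℂ (toComplexL2 P h) (toL2 hη p) = 0 := by
  obtain ⟨C, hC, hA⟩ := norm_antiPart_le hη N c
  refine inner_eq_zero_of_filtered (toL2 hη) (polySpace N) rfl (polySpace_mono N)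
    (finite_polySpace N) (symPart (box N)) (antiPart N c).toLinearMap
    (fun n p hp => symPart_mem hp) (fun n p hp => antiPart_mem hp)
    (fun p q => inner_symPart_left hη _ p q) (fun p q => inner_antiPart hη N c p q)
    (a := 1 / 2) (by norm_num) hC hr (fun n p hp ho => ?_) hA (fun n p hp => ?_) n p hp
  · rw [inner_symPart]
    simp_rw [inner_self_eq_norm_sq_to_K]
    have e : (1 / 2 * ∑ k ∈ box N, (normSq k : ℂ) *
        ((‖toL2 hη (D k p)‖ : ℝ) : ℂ) ^ 2) =
        ((1 / 2 * ∑ k ∈ box N, normSq k * ‖toL2 hη (D k p)‖ ^ 2 : ℝ) : ℂ) := by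
      push_cast; rfl
    simp only [Complex.coe_algebraMap]
    rw [e, Complex.neg_re, Complex.ofReal_re, neg_neg, mul_assoc,
      ← sum_norm_D_sq_of_orthogonal hη hp ho]
    refine mul_le_mul_of_nonneg_left ?_ (by norm_num)
    refine (Finset.sum_le_sum fun k hk => ?_).trans
      (Finset.sum_le_sum_of_subset_of_nonneg (Finset.erase_subset 0 (box N)) fun k _ _ =>
        mul_nonneg (normSq_nonneg k) (sq_nonneg _))
    exact le_mul_of_one_le_left (sq_nonneg _) (one_le_normSq (mem_modes.1 hk).1)
  · refine inner_resolv_eq_zero hη hh fun k hk => D_eq_zero_of_mem_polySpace (fun h => ?_) hp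
    exact hk (mem_modes.1 h).2

theorem inner_eq_zero_of_polySpace (hη : IsWhiteNoise P η) {N : ℕ} {c r : ℝ} (hr : 0 < r) {n : ℕ}
    {p : cyl} (hp : p ∈ polySpace N n) {f : Lp ℝ 2 P} (hf : toComplexL2 P f = toL2 hη p)
    (h : Lp ℝ 2 P) (hh : ∀ q ∈ genGraphCyl P η N c, inner ℝ h (r • q.1 - q.2) = 0) :
    inner ℝ h f = 0 := by
  have h1 := inner_polySpace_eq_zero hη hr hh hp
  rw [← hf, inner_toComplexL2] at h1
  exact_mod_cast h1

/-- The nonlinearity tested against a function, as a cylinder function. -/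
def nonlinCyl (N : ℕ) (φ : Torus2 → ℝ) : cyl :=
  ∑ l ∈ box N, ∑ m ∈ box N, ((kernel N l m : ℂ) * fourierCoef φ (-(l + m))) • (X l * X m)

theorem ev_nonlinCyl (N : ℕ) (φ : Torus2 → ℝ) (v : Mode → ℂ) :
    ev v (nonlinCyl N φ) = nonlinC N φ v := by
  rw [nonlinCyl, nonlinC, map_sum]
  refine Finset.sum_congr rfl fun l _ => ?_
  rw [map_sum]
  refine Finset.sum_congr rfl fun m _ => ?_
  rw [map_smul, map_mul, ev_X, ev_X, smul_eq_mul]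
  ring

theorem nonlinCyl_mem (N : ℕ) (φ : Torus2 → ℝ) : nonlinCyl N φ ∈ polySpace N 3 := by
  refine Submodule.sum_mem _ fun l _ => Submodule.sum_mem _ fun m _ => ?_
  by_cases hK : kernel N l m = 0
  · rw [hK, Complex.ofReal_zero, zero_mul, zero_smul]; exact Submodule.zero_mem _
  · obtain ⟨hl, hm, -, hl', hm', -⟩ := of_kernel_ne_zero hK
    rw [← mul_one (X l * X m), mul_assoc]
    exact Submodule.smul_mem _ _ (X_mul_mem_polySpace (mem_modes.2 ⟨hl, hl'⟩)
      (X_mul_mem_polySpace (mem_modes.2 ⟨hm, hm'⟩) (one_mem_polySpace N 0)))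

/-- The resolvent equation for the nonlinearity has exactly one solution; its pairing with the
right-hand side dominates every test function estimate. -/
theorem exists_resolvent_nonlin (hη : IsWhiteNoise P η) (N : ℕ) (c : ℝ) {r : ℝ} (hr : 0 < r)
    (φ : Torus2 → ℝ) :
    ∃ U : Lp ℝ 2 P,
      (∀ V : Lp ℝ 2 P, SolvesResolvent P η N c r (fun ω => c * nonlin N φ fun k => η k ω) V ↔
        V = U) ∧
      ∀ (G : cyl) (κ : ℝ), (∀ (V : cyl) (T : Finset Mode), cconj V = V →
        (∀ k, k ∉ T → D k V = 0) →
        ‖expect hη (resolv T N c r V * G)‖ ≤ κ * √(r * ‖toL2 hη V‖ ^ 2 + energy hη T V)) →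
        ‖expect hη ((c : ℂ) • nonlinCyl N φ * G)‖ ^ 2 ≤
          κ ^ 2 * ∫ ω, (c * nonlin N φ fun k => η k ω) * U ω ∂P := by
  set F : cyl := (c : ℂ) • nonlinCyl N φ with hF
  have hFev : ∀ v, IsRealMode v → ev v F = ((c * nonlin N φ v : ℝ) : ℂ) := fun v hv => by
    rw [hF, map_smul, ev_nonlinCyl, ← ofReal_nonlin N φ v hv.2, smul_eq_mul, Complex.ofReal_mul]
  have hFreal : ∀ v, IsRealMode v → conj (ev v F) = ev v F := fun v hv => by
    rw [hFev v hv, Complex.conj_ofReal]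
  obtain ⟨f, hf, hfae⟩ := exists_toComplexL2_eq hη hFreal
  have hfF : f =ᵐ[P] fun ω => c * nonlin N φ fun k => η k ω := by
    filter_upwards [hfae, hη.ae_isRealMode] with ω h1 h2
    rw [h1, hFev _ h2, Complex.ofReal_re]
  obtain ⟨p, hp, hpf, hu⟩ := existsUnique_solvesResolvent hη hr f
    (inner_eq_zero_of_polySpace hη hr (Submodule.smul_mem _ _ (nonlinCyl_mem N φ)) hf) hfF
  refine ⟨p.1, hu, fun G κ hG => ?_⟩
  have h1 := norm_inner_test_sq_le hη hr hG hp
  rw [hpf] at h1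
  have h2 : inner ℝ f p.1 = ∫ ω, (c * nonlin N φ fun k => η k ω) * p.1 ω ∂P := by
    rw [L2.inner_def]
    refine integral_congr_ae ?_
    filter_upwards [hfF] with ω h
    rw [h, RCLike.inner_apply', conj_trivial]
  have h3 : inner ℂ (toComplexL2 P f) (toL2 hη G) = expect hη (F * G) := by
    rw [hf, inner_toL2]
    refine expect_congr hη fun v hv => ?_
    change ev v (cconj F * G) = ev v (F * G)
    rw [map_mul, map_mul, ev_cconj, hFreal v hv]
  rwa [h2, h3] at h1

end

/-! ### Quadratic functionals of the white noise -/

theorem expect_one {Ω : Type*} [MeasurableSpace Ω] {P : Measure Ω} {η : Mode → Ω → ℂ}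
    (hη : IsWhiteNoise P η) : expect hη 1 = 1 := by
  have := hη.gaussian.isProbabilityMeasure
  rw [expect_apply]
  change ∫ _, (1 : ℂ) ∂P = 1
  simp

/-- The Wick product of two modes. -/
def wick (l m : Mode) : cyl := X l * X m - if l + m = 0 then 1 else 0

/-- A quadratic functional in the Wick products. -/
def wickQuad (N : ℕ) (a : Mode → Mode → ℂ) : cyl :=
  ∑ l ∈ modes N, ∑ m ∈ modes N, a l m • wick l m

theorem D_wick (k l m : Mode) :
    D k (wick l m) = (if m + k = 0 then (1 : ℂ) else 0) • X l
      + (if l + k = 0 then (1 : ℂ) else 0) • X m := by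
  have h1 : D k (if l + m = 0 then (1 : cyl) else 0) = 0 := by split_ifs <;> simp
  rw [wick, map_sub, h1, sub_zero, Derivation.leibniz, D_X, D_X, smul_eq_mul, smul_eq_mul]
  congr 1 <;> split_ifs <;> simp

theorem D_D_wick (j k l m : Mode) :
    D j (D k (wick l m)) = ((if l = -j then if m = -k then (1 : ℂ) else 0 else 0)
      + (if l = -k then if m = -j then (1 : ℂ) else 0 else 0)) • (1 : cyl) := by
  rw [D_wick, map_add, Derivation.map_smul, Derivation.map_smul, D_X, D_X]
  simp only [add_eq_zero_iff_eq_neg]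
  split_ifs <;> simp [add_smul]

section

variable {Ω : Type*} [MeasurableSpace Ω] {P : Measure Ω} {η : Mode → Ω → ℂ}

theorem expect_congr_ev (hη : IsWhiteNoise P η) {F G : cyl}
    (h : ∀ v, IsRealMode v → ev v F = ev v G) : expect hη F = expect hη G := expect_congr hη h

/-- The constant in the Wick product cancels the contraction of the two modes, so both derivatives
land on F. -/
theorem expect_wick_mul (hη : IsWhiteNoise P η) {l m : Mode} (hl : l ≠ 0) (hm : m ≠ 0) (F : cyl) :
    expect hη (wick l m * F) = expect hη (D m (D l F)) := by
  have h1 := expect_D hη hl (X m * F)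
  have h2 := expect_D hη hm (D l F)
  rw [Derivation.leibniz, D_X, map_add, smul_eq_mul, smul_eq_mul, ← h2] at h1
  have h3 : wick l m * F = X l * (X m * F) - F * if m + l = 0 then 1 else 0 := by
    rw [wick, add_comm m l]
    ring
  rw [h3, map_sub, ← h1]
  ring

theorem expect_wick_mul_wickQuad (hη : IsWhiteNoise P η) {N : ℕ} {l m : Mode} (hl : l ∈ modes N)
    (hm : m ∈ modes N) (a : Mode → Mode → ℂ) :
    expect hη (wick l m * wickQuad N a) = a (-m) (-l) + a (-l) (-m) := by
  rw [expect_wick_mul hη (mem_modes.1 hl).1 (mem_modes.1 hm).1, wickQuad]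
  simp only [map_sum, Derivation.map_smul, D_D_wick, map_smul, expect_one, smul_eq_mul, mul_one,
    mul_add, Finset.sum_add_distrib, mul_ite, mul_zero]
  have h : ∀ i j : Mode, i ∈ modes N → j ∈ modes N →
      ∑ x ∈ modes N, ∑ y ∈ modes N, (if x = -i then if y = -j then a x y else 0 else 0) =
        a (-i) (-j) := fun i j hi hj => by
    rw [Finset.sum_eq_single_of_mem (-i) (neg_mem_modes.2 hi)]
    · rw [Finset.sum_eq_single_of_mem (-j) (neg_mem_modes.2 hj)]
      · simp
      · intro y _ hy
        rw [if_pos rfl, if_neg hy]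
    · intro x _ hx
      simp [hx]
  rw [h m l hm hl, h l m hl hm]

theorem ev_cconj_wick (l m : Mode) {v : Mode → ℂ} (hv : IsRealMode v) :
    ev v (cconj (wick l m)) = ev v (wick (-l) (-m)) := by
  have h : (-l + -m = 0) ↔ (l + m = 0) := by
    rw [← neg_add, neg_eq_zero, add_comm, add_comm m]
  rw [ev_cconj, wick, wick, map_sub, map_sub, map_sub, map_mul, map_mul, map_mul, ev_X, ev_X, ev_X,
    ev_X, hv.2, hv.2]
  simp only [h]
  split_ifs <;> simp

theorem ev_cconj_wickQuad (N : ℕ) (a : Mode → Mode → ℂ) {v : Mode → ℂ} (hv : IsRealMode v) :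
    ev v (cconj (wickQuad N a)) =
      ev v (∑ l ∈ modes N, ∑ m ∈ modes N, conj (a l m) • wick (-l) (-m)) := by
  rw [ev_cconj, wickQuad]
  simp only [map_sum, map_smul, smul_eq_mul, map_mul, ← ev_cconj_wick _ _ hv, ev_cconj]

/-- No symmetry of the coefficients is assumed, since those of `antiQuad` have none; this costs an
inequality in place of an identity. -/
theorem norm_wickQuad_sq_le (hη : IsWhiteNoise P η) (N : ℕ) (a : Mode → Mode → ℂ) :
    ‖toL2 hη (wickQuad N a)‖ ^ 2 ≤ 2 * ∑ l ∈ modes N, ∑ m ∈ modes N, ‖a l m‖ ^ 2 := by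
  have h1 := norm_sq_toL2 hη (wickQuad N a)
  have h2 : expect hη (cconj (wickQuad N a) * wickQuad N a) =
      ∑ l ∈ modes N, ∑ m ∈ modes N, conj (a l m) * (a m l + a l m) := by
    rw [expect_congr_ev hη (G := (∑ l ∈ modes N, ∑ m ∈ modes N, conj (a l m) • wick (-l) (-m)) *
      wickQuad N a)]
    · simp only [Finset.sum_mul, map_sum, smul_mul_assoc, map_smul, smul_eq_mul]
      refine Finset.sum_congr rfl fun l hl => Finset.sum_congr rfl fun m hm => ?_
      rw [expect_wick_mul_wickQuad hη (neg_mem_modes.2 hl) (neg_mem_modes.2 hm), neg_neg, neg_neg]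
    · intro v hv
      rw [map_mul, map_mul, ev_cconj_wickQuad N a hv]
  rw [h2] at h1
  have h3 := congrArg (fun z : ℂ => ‖z‖) h1
  simp only [Complex.norm_real, Real.norm_of_nonneg (sq_nonneg _)] at h3
  rw [h3]
  have h4 : ∀ l m, ‖conj (a l m) * (a m l + a l m)‖ ≤
      (1 / 2) * ‖a m l‖ ^ 2 + (3 / 2) * ‖a l m‖ ^ 2 := fun l m => by
    rw [norm_mul, RCLike.norm_conj]
    have := mul_le_mul_of_nonneg_left (norm_add_le (a m l) (a l m)) (norm_nonneg (a l m))
    nlinarith [sq_nonneg (‖a m l‖ - ‖a l m‖)]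
  calc _ ≤ ∑ l ∈ modes N, ∑ m ∈ modes N, ‖conj (a l m) * (a m l + a l m)‖ :=
        (norm_sum_le _ _).trans (Finset.sum_le_sum fun l _ => norm_sum_le _ _)
    _ ≤ ∑ l ∈ modes N, ∑ m ∈ modes N, ((1 / 2) * ‖a m l‖ ^ 2 + (3 / 2) * ‖a l m‖ ^ 2) :=
        Finset.sum_le_sum fun l _ => Finset.sum_le_sum fun m _ => h4 l m
    _ = _ := by
        simp only [Finset.sum_add_distrib, ← Finset.mul_sum]
        rw [Finset.sum_comm]
        ring

theorem norm_linear_sq (hη : IsWhiteNoise P η) (N : ℕ) (b : Mode → ℂ) :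
    ‖toL2 hη (∑ m ∈ modes N, b m • X m)‖ ^ 2 = ∑ m ∈ modes N, ‖b m‖ ^ 2 := by
  have h1 := norm_sq_toL2 hη (∑ m ∈ modes N, b m • X m)
  have hXX : ∀ m ∈ modes N, ∀ j, expect hη (X (-m) * X j) = if j = m then 1 else 0 :=
    fun m hm j => by
      rw [← expect_D hη (neg_ne_zero.2 (mem_modes.1 hm).1), D_X]
      simp only [add_neg_eq_zero]
      split_ifs
      · exact expect_one hη
      · exact map_zero _
  have h2 : expect hη (cconj (∑ m ∈ modes N, b m • X m) * ∑ m ∈ modes N, b m • X m) =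
      ∑ m ∈ modes N, conj (b m) * b m := by
    rw [expect_congr_ev hη (G := (∑ m ∈ modes N, conj (b m) • X (-m)) * ∑ m ∈ modes N, b m • X m)]
    · simp only [Finset.sum_mul, Finset.mul_sum, map_sum, smul_mul_assoc, mul_smul_comm, map_smul,
        smul_eq_mul]
      refine Finset.sum_congr rfl fun m hm => ?_
      rw [Finset.sum_eq_single_of_mem m hm]
      · rw [hXX m hm, if_pos rfl, mul_one]; ring
      · intro j hj' hj
        rw [hXX j hj', if_neg hj.symm]
        simp
    · intro v hv
      simp only [map_mul, ev_cconj, map_sum, map_smul, smul_eq_mul, ev_X, hv.2]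
  rw [h2] at h1
  have h3 : ∀ m, conj (b m) * b m = ((‖b m‖ ^ 2 : ℝ) : ℂ) := fun m => by
    rw [mul_comm, Complex.mul_conj, Complex.normSq_eq_norm_sq]
  simp_rw [h3, ← Complex.ofReal_sum] at h1
  exact_mod_cast h1

theorem D_wickQuad (N : ℕ) {a : Mode → Mode → ℂ} (ha : ∀ l m, a l m = a m l) {k : Mode}
    (hk : k ∈ modes N) :
    D k (wickQuad N a) = ∑ m ∈ modes N, (2 * a (-k) m) • X m := by
  rw [wickQuad]
  simp only [map_sum, Derivation.map_smul, D_wick, smul_add, Finset.sum_add_distrib,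
    add_eq_zero_iff_eq_neg, ite_smul, one_smul, zero_smul, smul_ite, smul_zero]
  have h1 : ∑ x ∈ modes N, ∑ y ∈ modes N, (if y = -k then a x y • X x else 0) =
      ∑ m ∈ modes N, a (-k) m • X m := by
    refine Finset.sum_congr rfl fun x _ => ?_
    rw [Finset.sum_ite_eq' , if_pos (neg_mem_modes.2 hk), ha]
  have h2 : ∑ x ∈ modes N, ∑ y ∈ modes N, (if x = -k then a x y • X y else 0) =
      ∑ m ∈ modes N, a (-k) m • X m := by
    rw [Finset.sum_comm]
    refine Finset.sum_congr rfl fun x _ => ?_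
    rw [Finset.sum_ite_eq' , if_pos (neg_mem_modes.2 hk)]
  rw [h1, h2, ← Finset.sum_add_distrib]
  refine Finset.sum_congr rfl fun m _ => ?_
  rw [← add_smul, two_mul]

theorem D_wickQuad_eq_zero (N : ℕ) (a : Mode → Mode → ℂ) {k : Mode}
    (hk : k ∉ modes N) : D k (wickQuad N a) = 0 := by
  have h : ∀ j ∈ modes N, j ≠ -k := fun j hj h => hk (neg_mem_modes.1 (h ▸ hj))
  rw [wickQuad]
  simp only [map_sum, Derivation.map_smul, D_wick]
  refine Finset.sum_eq_zero fun l hl => Finset.sum_eq_zero fun m hm => ?_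
  simp [add_eq_zero_iff_eq_neg, h l hl, h m hm]

theorem norm_D_wickQuad_sq (hη : IsWhiteNoise P η) (N : ℕ) {a : Mode → Mode → ℂ}
    (ha : ∀ l m, a l m = a m l) {k : Mode} (hk : k ∈ modes N) :
    ‖toL2 hη (D k (wickQuad N a))‖ ^ 2 = 4 * ∑ m ∈ modes N, ‖a (-k) m‖ ^ 2 := by
  rw [D_wickQuad N ha hk, norm_linear_sq, Finset.mul_sum]
  refine Finset.sum_congr rfl fun m _ => ?_
  rw [norm_mul, mul_pow]
  norm_num

/-- Integration by parts against a product of three modes. -/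
theorem expect_mul_three (hη : IsWhiteNoise P η) {i j m : Mode} (hi : i ≠ 0) (hj : j ≠ 0)
    (hij : i + j ≠ 0) (V : cyl) :
    expect hη (V * (X i * X j * X m)) = expect hη (D i V * wick j m)
      + (if m = -j then expect hη (D i V) else 0) + (if m = -i then expect hη (D j V) else 0) := by
  have h1 := expect_D hη hi (V * (X j * X m))
  have e1 : D i (X j) = 0 := by rw [D_X, if_neg]; rwa [add_comm]
  have e2 : D i (X m) = if m = -i then 1 else 0 := by
    rw [D_X]; simp only [add_eq_zero_iff_eq_neg]
  rw [Derivation.leibniz, Derivation.leibniz, e1, e2, smul_zero, add_zero, map_add] at h1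
  simp only [smul_eq_mul] at h1
  have h2 : expect hη (V * (X j * if m = -i then 1 else 0)) =
      if m = -i then expect hη (D j V) else 0 := by
    split_ifs
    · rw [mul_one, expect_D hη hj, mul_comm]
    · rw [mul_zero, mul_zero, map_zero]
  have h3 : expect hη (X j * X m * D i V) = expect hη (D i V * wick j m) +
      if m = -j then expect hη (D i V) else 0 := by
    have e3 : j + m = 0 ↔ m = -j := by rw [add_comm, add_eq_zero_iff_eq_neg]
    rw [wick, mul_sub, map_sub]
    simp only [e3]
    split_ifs
    · rw [mul_one, sub_add_cancel, mul_comm]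
    · rw [mul_zero, map_zero, sub_zero, add_zero, mul_comm]
  rw [show V * (X i * X j * X m) = X i * (V * (X j * X m)) by ring, ← h1, h2, h3]
  ring

end

/-! ### The test function estimate -/

theorem sum_box_eq_sum_modes {M : Type*} [AddCommMonoid M] {N : ℕ} {f : Mode → M} (h : f 0 = 0) :
    ∑ k ∈ box N, f k = ∑ k ∈ modes N, f k := (Finset.sum_erase _ h).symm

theorem kernel_zero_left (N : ℕ) (m : Mode) : kernel N 0 m = 0 := by
  simp [kernel]

theorem kernel_zero_right (N : ℕ) (m : Mode) : kernel N m 0 = 0 := by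
  simp [kernel]

theorem add_mem_modes_of_kernel_ne_zero {N : ℕ} {l m : Mode} (h : kernel N l m ≠ 0) :
    l + m ∈ modes N := by
  obtain ⟨-, -, h1, -, -, h2⟩ := of_kernel_ne_zero h
  exact mem_modes.2 ⟨h1, h2⟩

/-- The coefficients of the first chaos component of the antisymmetric part applied to a
quadratic functional. -/
def contraction (N : ℕ) (g : Mode → Mode → ℂ) (j : Mode) : ℂ :=
  ∑ i ∈ modes N, (kernel N i j : ℂ) * g (i + j) (-i)

/-- The third chaos component of the antisymmetric part applied to a quadratic functional is the
adjoint of `D_i` applied to these functionals. -/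
def antiQuad (N : ℕ) (g : Mode → Mode → ℂ) (i : Mode) : cyl :=
  wickQuad N fun j m => (kernel N i j : ℂ) * g (i + j) m

theorem antiPart_wickQuad (N : ℕ) (c : ℝ) {g : Mode → Mode → ℂ} (hg : ∀ l m, g l m = g m l) :
    antiPart N c (wickQuad N g) = (2 * c : ℂ) • ∑ i ∈ modes N, ∑ j ∈ modes N, ∑ m ∈ modes N,
      ((kernel N i j : ℂ) * g (i + j) m) • (X i * X j * X m) := by
  have h1 : ∀ i j, (kernel N i j : ℂ) • (X i * X j * D (-(i + j)) (wickQuad N g)) =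
      (2 : ℂ) • ∑ m ∈ modes N, ((kernel N i j : ℂ) * g (i + j) m) • (X i * X j * X m) := by
    intro i j
    by_cases hK : kernel N i j = 0
    · simp [hK]
    rw [D_wickQuad N hg (neg_mem_modes.2 (add_mem_modes_of_kernel_ne_zero hK)), neg_neg,
      Finset.mul_sum, Finset.smul_sum, Finset.smul_sum]
    refine Finset.sum_congr rfl fun m _ => ?_
    rw [mul_smul_comm, smul_smul, smul_smul]
    congr 1
    ring
  rw [antiPart_apply]
  simp_rw [h1]
  rw [sum_box_eq_sum_modes]
  · rw [mul_comm, mul_smul, Finset.smul_sum (r := (2 : ℂ))]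
    congr 1
    refine Finset.sum_congr rfl fun i _ => ?_
    rw [sum_box_eq_sum_modes]
    · rw [Finset.smul_sum]
    · simp [kernel_zero_right]
  · simp [kernel_zero_left]

section

variable {Ω : Type*} [MeasurableSpace Ω] {P : Measure Ω} {η : Mode → Ω → ℂ}

/-- Only one of the three modes is integrated by parts onto V, apart from the contractions, so a
single derivative of V appears, which is what the energy controls. The contractions m = -j and m =
-i give equal sums by the symmetry of the kernel, whence the factor 2. -/
theorem expect_mul_antiPart_wickQuad (hη : IsWhiteNoise P η) (N : ℕ) (c : ℝ)
    {g : Mode → Mode → ℂ} (hg : ∀ l m, g l m = g m l) (V : cyl) :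
    expect hη (V * antiPart N c (wickQuad N g)) =
      2 * c * ∑ i ∈ modes N, (expect hη (D i V * antiQuad N g i)
        + 2 * (contraction N g i * expect hη (D i V))) := by
  have h1 : ∀ i ∈ modes N, ∀ j ∈ modes N, ∀ m,
      expect hη (V * (((kernel N i j : ℂ) * g (i + j) m) • (X i * X j * X m))) =
        (kernel N i j : ℂ) * g (i + j) m * expect hη (D i V * wick j m) +
        ((if m = -j then (kernel N i j : ℂ) * g (i + j) m * expect hη (D i V) else 0) +
        (if m = -i then (kernel N i j : ℂ) * g (i + j) m * expect hη (D j V) else 0)) := by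
    intro i hi j hj m
    by_cases hK : kernel N i j = 0
    · simp [hK]
    rw [mul_smul_comm, map_smul, smul_eq_mul, expect_mul_three hη (mem_modes.1 hi).1
      (mem_modes.1 hj).1 (of_kernel_ne_zero hK).2.2.1]
    split_ifs <;> ring
  have h2 : ∀ i, expect hη (D i V * antiQuad N g i) = ∑ j ∈ modes N, ∑ m ∈ modes N,
      (kernel N i j : ℂ) * g (i + j) m * expect hη (D i V * wick j m) := fun i => by
    simp only [antiQuad, wickQuad, Finset.mul_sum, map_sum, mul_smul_comm, map_smul, smul_eq_mul]
  have h3 : ∑ i ∈ modes N, ∑ j ∈ modes N, ∑ m ∈ modes N,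
      (if m = -j then (kernel N i j : ℂ) * g (i + j) m * expect hη (D i V) else 0) =
      ∑ i ∈ modes N, contraction N g i * expect hη (D i V) := by
    refine Finset.sum_congr rfl fun i _ => ?_
    rw [contraction, Finset.sum_mul]
    refine Finset.sum_congr rfl fun j hj => ?_
    rw [Finset.sum_ite_eq', if_pos (neg_mem_modes.2 hj), kernel_comm, add_comm i j]
  have h4 : ∑ i ∈ modes N, ∑ j ∈ modes N, ∑ m ∈ modes N,
      (if m = -i then (kernel N i j : ℂ) * g (i + j) m * expect hη (D j V) else 0) =
      ∑ i ∈ modes N, contraction N g i * expect hη (D i V) := by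
    rw [Finset.sum_comm]
    refine Finset.sum_congr rfl fun j _ => ?_
    rw [contraction, Finset.sum_mul]
    refine Finset.sum_congr rfl fun i hi => ?_
    rw [Finset.sum_ite_eq', if_pos (neg_mem_modes.2 hi)]
  rw [antiPart_wickQuad N c hg, mul_smul_comm, map_smul, smul_eq_mul]
  congr 1
  simp only [Finset.mul_sum, map_sum]
  rw [Finset.sum_congr rfl fun i hi => Finset.sum_congr rfl fun j hj =>
    Finset.sum_congr rfl fun m _ => h1 i hi j hj m]
  simp only [Finset.sum_add_distrib]
  rw [h3, h4, Finset.sum_congr rfl fun i _ => (h2 i).symm, ← Finset.mul_sum, two_mul]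

theorem norm_expect_mul_antiPart_le (hη : IsWhiteNoise P η) (N : ℕ) (c : ℝ)
    {g : Mode → Mode → ℂ} (hg : ∀ l m, g l m = g m l) (V : cyl) :
    ‖expect hη (V * antiPart N c (wickQuad N g))‖ ≤
      ∑ i ∈ modes N, ‖toL2 hη (D i V)‖ *
        (2 * |c| * (‖toL2 hη (antiQuad N g i)‖ + 2 * ‖contraction N g i‖)) := by
  rw [expect_mul_antiPart_wickQuad hη N c hg, Finset.mul_sum]
  refine (norm_sum_le _ _).trans (Finset.sum_le_sum fun i _ => ?_)
  have h1 : ‖(2 * c : ℂ)‖ = 2 * |c| := by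
    rw [norm_mul, Complex.norm_real, Real.norm_eq_abs]; norm_num
  have h2 := norm_expect_mul_le hη (D i V) (antiQuad N g i)
  have h3 : ‖expect hη (D i V)‖ ≤ ‖toL2 hη (D i V)‖ := by
    have h4 := norm_expect_mul_le hη (D i V) 1
    have h5 : ‖toL2 hη (1 : cyl)‖ = 1 := by
      have h6 := norm_sq_toL2 hη 1
      have h7 : cconj 1 * 1 = (1 : cyl) := by
        rw [mul_one]; exact Subtype.ext (funext fun _ => map_one _)
      rw [h7, expect_one] at h6
      have h8 : ‖toL2 hη (1 : cyl)‖ ^ 2 = 1 := by exact_mod_cast h6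
      nlinarith [norm_nonneg (toL2 hη (1 : cyl))]
    rwa [mul_one, h5, mul_one, norm_toL2_cconj] at h4
  rw [norm_toL2_cconj] at h2
  rw [norm_mul, h1]
  have h6 : ‖expect hη (D i V * antiQuad N g i) + 2 * (contraction N g i * expect hη (D i V))‖ ≤
      ‖toL2 hη (D i V)‖ * (‖toL2 hη (antiQuad N g i)‖ + 2 * ‖contraction N g i‖) := by
    refine (norm_add_le _ _).trans ?_
    rw [norm_mul, norm_mul, mul_add]
    refine add_le_add h2 ?_
    have := mul_le_mul_of_nonneg_left h3 (norm_nonneg (contraction N g i))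
    norm_num
    linarith
  calc _ ≤ 2 * |c| * _ := mul_le_mul_of_nonneg_left h6 (by positivity)
    _ = _ := by ring

/-- The squared constant of the test function estimate. -/
def testConst (hη : IsWhiteNoise P η) (N : ℕ) (c r : ℝ) (g : Mode → Mode → ℂ) : ℝ :=
  r * ‖toL2 hη (wickQuad N g)‖ ^ 2
    + ∑ k ∈ modes N, normSq k * ‖toL2 hη (D k (wickQuad N g))‖ ^ 2
    + 32 * c ^ 2 * ∑ k ∈ modes N, ‖toL2 hη (antiQuad N g k)‖ ^ 2 / normSq k
    + 128 * c ^ 2 * ∑ k ∈ modes N, ‖contraction N g k‖ ^ 2 / normSq k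

/-- Move the antisymmetric part onto the test function and apply Cauchy–Schwarz over k with weight
|k|² on D_k V and 1/|k|² on the other factor. The antisymmetric contributions are thereby measured
in a norm of order -1. -/
theorem norm_expect_resolv_mul_le (hη : IsWhiteNoise P η) (N : ℕ) (c : ℝ) {r : ℝ} (hr : 0 < r)
    {g : Mode → Mode → ℂ} (hg : ∀ l m, g l m = g m l) {V : cyl} {T : Finset Mode}
    (hV : cconj V = V) (hT : ∀ k, k ∉ T → D k V = 0) :
    ‖expect hη (resolv T N c r V * wickQuad N g)‖ ≤
      √(testConst hη N c r g) * √(r * ‖toL2 hη V‖ ^ 2 + energy hη T V) := by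
  set G := wickQuad N g with hG
  set x : Mode → ℝ := fun k => ‖toL2 hη (D k V)‖ with hx
  set d : Mode → ℝ := fun k => ‖toL2 hη (D (-k) G)‖ with hd
  set θ : Mode → ℝ := fun k =>
    2 * |c| * (‖toL2 hη (antiQuad N g k)‖ + 2 * ‖contraction N g k‖) with hθ
  set y : Mode → ℝ := fun k => 1 / 2 * normSq k * d k + θ k with hy
  have hsplit : expect hη (resolv T N c r V * G) = r * expect hη (V * G)
      + 1 / 2 * ∑ k ∈ T, (normSq k : ℂ) * expect hη (D (-k) G * D k V)
      + expect hη (V * antiPart N c G) := by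
    rw [resolv_apply, sub_mul, add_mul, map_sub, map_add, smul_mul_assoc, map_smul, smul_eq_mul,
      mul_comm (symPart T V), mul_comm (antiPart N c V), expect_mul_symPart,
      expect_mul_antiPart hη N c G V]
    ring
  have h1 : ‖(r : ℂ) * expect hη (V * G)‖ ≤ r * ‖toL2 hη V‖ * ‖toL2 hη G‖ := by
    rw [norm_mul, Complex.norm_real, Real.norm_of_nonneg hr.le, mul_assoc]
    have := norm_expect_mul_le hη V G
    rw [hV] at this
    exact mul_le_mul_of_nonneg_left this hr.le
  have h2 : ‖1 / 2 * ∑ k ∈ T, (normSq k : ℂ) * expect hη (D (-k) G * D k V)‖ ≤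
      ∑ k ∈ modes N, x k * (1 / 2 * normSq k * d k) := by
    have e1 : ∑ k ∈ T, (normSq k : ℂ) * expect hη (D (-k) G * D k V) =
        ∑ k ∈ modes N, (normSq k : ℂ) * expect hη (D (-k) G * D k V) := by
      refine (Finset.sum_subset (Finset.subset_union_left (s₁ := T) (s₂ := modes N))
        fun k _ hk => ?_).trans (Finset.sum_subset
          (Finset.subset_union_right (s₁ := T) (s₂ := modes N)) fun k _ hk => ?_).symm
      · rw [hT k hk, mul_zero, map_zero, mul_zero]
      · rw [hG, D_wickQuad_eq_zero N g (fun h => hk (neg_mem_modes.1 h)), zero_mul, map_zero,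
          mul_zero]
    rw [e1, norm_mul, show ‖(1 / 2 : ℂ)‖ = 1 / 2 by norm_num]
    have e2 : ‖∑ k ∈ modes N, (normSq k : ℂ) * expect hη (D (-k) G * D k V)‖ ≤
        ∑ k ∈ modes N, normSq k * (d k * x k) := by
      refine (norm_sum_le _ _).trans (Finset.sum_le_sum fun k _ => ?_)
      rw [norm_mul, Complex.norm_real, Real.norm_of_nonneg (normSq_nonneg k)]
      have := norm_expect_mul_le hη (D (-k) G) (D k V)
      rw [norm_toL2_cconj] at this
      exact mul_le_mul_of_nonneg_left this (normSq_nonneg k)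
    refine (mul_le_mul_of_nonneg_left e2 (by norm_num)).trans (le_of_eq ?_)
    rw [Finset.mul_sum]
    exact Finset.sum_congr rfl fun k _ => by ring
  have h3 := norm_expect_mul_antiPart_le hη N c hg V
  have h4 : ‖expect hη (resolv T N c r V * G)‖ ≤
      r * ‖toL2 hη V‖ * ‖toL2 hη G‖ + ∑ k ∈ modes N, x k * y k := by
    rw [hsplit]
    refine (norm_add₃_le).trans ?_
    have e : ∑ k ∈ modes N, x k * y k =
        ∑ k ∈ modes N, x k * (1 / 2 * normSq k * d k) + ∑ k ∈ modes N, x k * θ k := by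
      rw [← Finset.sum_add_distrib]
      exact Finset.sum_congr rfl fun k _ => by rw [hy]; ring
    rw [e, ← add_assoc]
    exact add_le_add_three h1 h2 h3
  -- A carries the factor 1/2 of the energy; B carries the compensating 2.
  set A := 1 / 2 * ∑ k ∈ modes N, normSq k * x k ^ 2 with hA
  set B := 2 * ∑ k ∈ modes N, y k ^ 2 / normSq k with hB
  have hA0 : 0 ≤ A := mul_nonneg (by norm_num)
    (Finset.sum_nonneg fun k _ => mul_nonneg (normSq_nonneg k) (sq_nonneg _))
  have hB0 : 0 ≤ B := mul_nonneg (by norm_num)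
    (Finset.sum_nonneg fun k _ => div_nonneg (sq_nonneg _) (normSq_nonneg k))
  have h5 : ∑ k ∈ modes N, x k * y k ≤ √A * √B := by
    rw [← Real.sqrt_mul hA0]
    refine Real.le_sqrt_of_sq_le ?_
    have := Finset.sum_sq_le_sum_mul_sum_of_sq_le_mul (modes N) (r := fun k => x k * y k)
      (f := fun k => normSq k * x k ^ 2) (g := fun k => y k ^ 2 / normSq k)
      (fun k _ => mul_nonneg (normSq_nonneg k) (sq_nonneg _))
      (fun k _ => div_nonneg (sq_nonneg _) (normSq_nonneg k)) (fun k hk => by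
        have := (normSq_pos (mem_modes.1 hk).1).ne'
        exact le_of_eq (by field_simp))
    refine this.trans (le_of_eq ?_)
    rw [hA, hB]
    ring
  have hAE : A ≤ energy hη T V := by
    rw [hA, energy]
    refine mul_le_mul_of_nonneg_left ?_ (by norm_num)
    rw [Finset.sum_subset (Finset.subset_union_left (s₁ := T) (s₂ := modes N))
      (fun k _ hk => by rw [hT k hk, map_zero, norm_zero]; ring)]
    exact Finset.sum_le_sum_of_subset_of_nonneg Finset.subset_union_right
      fun k _ _ => mul_nonneg (normSq_nonneg k) (sq_nonneg _)
  have hBC : r * ‖toL2 hη G‖ ^ 2 + B ≤ testConst hη N c r g := by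
    -- Two uses of (a + b)² ≤ 2a² + 2b²: 32 = 2 · 2 · 8 and 128 = 2 · 2 · 32, with 8 and 32 coming
    -- from θ².
    have e1 : ∀ k ∈ modes N, 2 * (y k ^ 2 / normSq k) ≤ normSq k * d k ^ 2 +
        (32 * c ^ 2 * (‖toL2 hη (antiQuad N g k)‖ ^ 2 / normSq k) +
        128 * c ^ 2 * (‖contraction N g k‖ ^ 2 / normSq k)) := by
      intro k hk
      have hk0 := normSq_pos (mem_modes.1 hk).1
      have e2 : y k ^ 2 ≤ 2 * (1 / 2 * normSq k * d k) ^ 2 + 2 * θ k ^ 2 := by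
        rw [hy]
        nlinarith [sq_nonneg (1 / 2 * normSq k * d k - θ k)]
      have e3 : θ k ^ 2 ≤ 8 * c ^ 2 * ‖toL2 hη (antiQuad N g k)‖ ^ 2 +
          32 * c ^ 2 * ‖contraction N g k‖ ^ 2 := by
        have e4 : θ k ^ 2 = 4 * c ^ 2 *
            (‖toL2 hη (antiQuad N g k)‖ + 2 * ‖contraction N g k‖) ^ 2 := by
          rw [hθ, mul_pow, mul_pow, sq_abs]; ring
        rw [e4]
        nlinarith [mul_nonneg (sq_nonneg c)
          (sq_nonneg (‖toL2 hη (antiQuad N g k)‖ - 2 * ‖contraction N g k‖))]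
      rw [mul_div_assoc', div_le_iff₀ hk0]
      have e5 : (normSq k * d k ^ 2 + (32 * c ^ 2 * (‖toL2 hη (antiQuad N g k)‖ ^ 2 / normSq k) +
        128 * c ^ 2 * (‖contraction N g k‖ ^ 2 / normSq k))) * normSq k =
        normSq k ^ 2 * d k ^ 2 + 32 * c ^ 2 * ‖toL2 hη (antiQuad N g k)‖ ^ 2 +
        128 * c ^ 2 * ‖contraction N g k‖ ^ 2 := by
        field_simp
        ring
      rw [e5]
      nlinarith
    have e6 : ∑ k ∈ modes N, normSq k * d k ^ 2 =
        ∑ k ∈ modes N, normSq k * ‖toL2 hη (D k G)‖ ^ 2 := by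
      refine Finset.sum_equiv (Equiv.neg Mode) (fun k => by simp [neg_mem_modes]) fun k _ => ?_
      simp [hd, normSq_neg]
    have e7 := Finset.sum_le_sum e1
    rw [Finset.sum_add_distrib, Finset.sum_add_distrib, ← Finset.mul_sum, ← Finset.mul_sum,
      ← Finset.mul_sum, e6] at e7
    rw [testConst, hB]
    linarith
  refine h4.trans ((add_le_add_right h5 _).trans ?_)
  have h6 : r * ‖toL2 hη V‖ * ‖toL2 hη G‖ + √A * √B ≤
      √((r * ‖toL2 hη G‖ ^ 2 + B) * (r * ‖toL2 hη V‖ ^ 2 + A)) := by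
    refine Real.le_sqrt_of_sq_le ?_
    have a1 := Real.sq_sqrt hA0
    have b1 := Real.sq_sqrt hB0
    have e : ∀ v w a b : ℝ, (r * v * w + a * b) ^ 2 ≤
        (r * w ^ 2 + b ^ 2) * (r * v ^ 2 + a ^ 2) := fun v w a b => by
      have : (r * w ^ 2 + b ^ 2) * (r * v ^ 2 + a ^ 2) - (r * v * w + a * b) ^ 2 =
        r * (v * b - w * a) ^ 2 := by ring
      linarith [mul_nonneg hr.le (sq_nonneg (v * b - w * a))]
    have := e ‖toL2 hη V‖ ‖toL2 hη G‖ (√A) (√B)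
    rwa [a1, b1] at this
  refine h6.trans ?_
  rw [Real.sqrt_mul (by positivity)]
  gcongr

end

/-! ### The quadratic test function -/

/-- Up to sign, c(l, m) is the real part of the product of l and m read as complex numbers; the
square added below is that of the imaginary part. -/
theorem abs_cForm_le (l m : Mode) : |cForm l m| ≤ euclNorm l * euclNorm m := by
  rw [euclNorm, euclNorm, ← Real.sqrt_mul (normSq_nonneg l)]
  refine Real.abs_le_sqrt ?_
  simp only [cForm, normSq]
  nlinarith [sq_nonneg ((l.1 : ℝ) * m.2 + l.2 * m.1)]

theorem abs_kernel_le (N : ℕ) (l m : Mode) : |kernel N l m| ≤ euclNorm (l + m) := by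
  unfold kernel
  split_ifs with h
  · have h1 := mul_pos (euclNorm_pos h.1) (euclNorm_pos h.2.1)
    rw [abs_div, abs_mul, abs_of_pos h1, abs_of_nonneg (euclNorm_nonneg _), div_le_iff₀ h1]
    exact mul_le_mul_of_nonneg_left (abs_cForm_le l m) (euclNorm_nonneg _)
  · rw [abs_zero]; exact euclNorm_nonneg _

theorem kernel_sq_le (N : ℕ) (l m : Mode) :
    kernel N l m ^ 2 ≤ if l + m ∈ modes N then normSq (l + m) else 0 := by
  by_cases h : kernel N l m = 0
  · rw [h, zero_pow two_ne_zero]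
    split_ifs
    · exact normSq_nonneg _
    · exact le_rfl
  · rw [if_pos (add_mem_modes_of_kernel_ne_zero h), ← sq_abs, ← euclNorm_sq]
    exact pow_le_pow_left₀ (abs_nonneg _) (abs_kernel_le N l m) 2

/-- The two kernels are bounded separately only by |i + j| and |i|, which are large for i far out.
By `cForm_cyclic` the leading parts cancel and the low frequency |j| remains; without this gain the
contraction would not be logarithmic. -/
theorem abs_kernel_add_kernel_le (N : ℕ) (i j : Mode) :
    |kernel N i j + kernel N (-i - j) j| ≤ euclNorm j := by
  have e1 : -i - j + j = -i := by abel
  have e2 : -i - j = -(i + j) := by abel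
  by_cases h : i ≠ 0 ∧ j ≠ 0 ∧ i ∈ box N ∧ j ∈ box N ∧ i + j ∈ box N ∧ i + j ≠ 0
  · obtain ⟨hi, hj, hi', hj', hij', hij⟩ := h
    have hk : kernel N (-i - j) j = euclNorm i * cForm (-(i + j)) j /
        (euclNorm (i + j) * euclNorm j) := by
      rw [kernel, if_pos, e1, e2, euclNorm_neg, euclNorm_neg]
      rw [e1, e2, neg_mem_box, neg_mem_box, neg_ne_zero]
      exact ⟨hij, hj, hij', hj', hi'⟩
    rw [hk, kernel, if_pos ⟨hi, hj, hi', hj', hij'⟩]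
    have hi0 := euclNorm_pos hi
    have hj0 := euclNorm_pos hj
    have hij0 := euclNorm_pos hij
    have hc := cForm_cyclic (m := i) (l := j) (p := -(i + j)) (by abel)
    rw [normSq_neg, ← euclNorm_sq, ← euclNorm_sq, ← euclNorm_sq, cForm_comm j] at hc
    have e3 : euclNorm (i + j) * cForm i j / (euclNorm i * euclNorm j) +
        euclNorm i * cForm (-(i + j)) j / (euclNorm (i + j) * euclNorm j) =
        -(euclNorm j * cForm (-(i + j)) i) / (euclNorm (i + j) * euclNorm i) := by
      field_simp
      linarith
    rw [e3, abs_div, abs_neg, abs_mul, abs_of_pos (mul_pos hij0 hi0), abs_of_pos hj0,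
      div_le_iff₀ (mul_pos hij0 hi0)]
    refine mul_le_mul_of_nonneg_left ?_ hj0.le
    rw [← euclNorm_neg (i + j)]
    exact abs_cForm_le _ _
  · have h1 : kernel N i j = 0 := by
      by_contra h0
      have := of_kernel_ne_zero h0
      tauto
    have h2 : kernel N (-i - j) j = 0 := by
      by_contra h0
      have := of_kernel_ne_zero h0
      rw [e1, e2, neg_mem_box, neg_mem_box, neg_ne_zero, neg_ne_zero] at this
      tauto
    rw [h1, h2, add_zero, abs_zero]
    exact euclNorm_nonneg j

theorem sum_shift_le (N : ℕ) {f : Mode → ℝ} (hf : ∀ k, 0 ≤ f k) (i : Mode) :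
    ∑ j ∈ modes N, (if i + j ∈ modes N then f (i + j) else 0) ≤ ∑ k ∈ modes N, f k := by
  rw [← Finset.sum_filter, ← Finset.sum_image (f := f) (g := fun j => i + j)
    fun a _ b _ h => add_left_cancel h]
  refine Finset.sum_le_sum_of_subset_of_nonneg (fun k hk => ?_) fun k _ _ => hf k
  obtain ⟨j, hj, rfl⟩ := Finset.mem_image.1 hk
  exact (Finset.mem_filter.1 hj).2

/-- The sum of the inverse squared lengths of the non-zero modes in the box. -/
def invSum (N : ℕ) : ℝ := ∑ k ∈ modes N, 1 / normSq k

theorem invSum_nonneg (N : ℕ) : 0 ≤ invSum N :=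
  Finset.sum_nonneg fun k _ => div_nonneg zero_le_one (normSq_nonneg k)

/-- The multiplier `K_{l, m} / (|l|² + |m|² + r)`. -/
def symbol (N : ℕ) (r : ℝ) (l m : Mode) : ℝ := kernel N l m / (normSq l + normSq m + r)

theorem symbol_comm (N : ℕ) (r : ℝ) (l m : Mode) : symbol N r l m = symbol N r m l := by
  rw [symbol, symbol, kernel_comm, add_comm (normSq l)]

theorem abs_symbol_le (N : ℕ) {r : ℝ} (hr : 0 < r) (l m : Mode) :
    |symbol N r l m| ≤ euclNorm (l + m) * (1 / normSq m) := by
  by_cases h : kernel N l m = 0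
  · rw [symbol, h, zero_div, abs_zero]
    exact mul_nonneg (euclNorm_nonneg _) (div_nonneg zero_le_one (normSq_nonneg m))
  · have hm := normSq_pos (of_kernel_ne_zero h).2.1
    have hl := normSq_nonneg l
    rw [symbol, abs_div, abs_of_pos (by linarith : 0 < normSq l + normSq m + r),
      mul_one_div]
    exact div_le_div₀ (euclNorm_nonneg _) (abs_kernel_le N l m) hm (by linarith)

/-- The coefficients of the test function: the first iterate of the resolvent of the symmetric
part applied to the nonlinearity. -/
def testCoef (N : ℕ) (c r : ℝ) (φ : Torus2 → ℝ) (l m : Mode) : ℂ :=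
  c * fourierCoef φ (-(l + m)) * symbol N r l m

theorem testCoef_comm (N : ℕ) (c r : ℝ) (φ : Torus2 → ℝ) (l m : Mode) :
    testCoef N c r φ l m = testCoef N c r φ m l := by
  rw [testCoef, testCoef, symbol_comm, add_comm l]

theorem norm_fourierCoef_neg (φ : Torus2 → ℝ) (k : Mode) :
    ‖fourierCoef φ (-k)‖ = ‖fourierCoef φ k‖ := by
  rw [← conj_fourierCoef, RCLike.norm_conj]

theorem norm_testCoef_sq (N : ℕ) (c r : ℝ) (φ : Torus2 → ℝ) (l m : Mode) :
    ‖testCoef N c r φ l m‖ ^ 2 = c ^ 2 * (‖fourierCoef φ (l + m)‖ ^ 2 * symbol N r l m ^ 2) := by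
  rw [testCoef, norm_mul, norm_mul, Complex.norm_real, Complex.norm_real, norm_fourierCoef_neg,
    mul_pow, mul_pow, Real.norm_eq_abs, Real.norm_eq_abs, sq_abs, sq_abs, mul_assoc]

/-- The pairing of the nonlinearity with its test function, up to a factor `2 c²`. -/
def testEnergy (N : ℕ) (r : ℝ) (φ : Torus2 → ℝ) : ℝ :=
  ∑ l ∈ modes N, ∑ m ∈ modes N,
    ‖fourierCoef φ (l + m)‖ ^ 2 * (kernel N l m ^ 2 / (normSq l + normSq m + r))

theorem weight_mul_norm_testCoef_sq (N : ℕ) (c : ℝ) {r : ℝ} (hr : 0 < r) (φ : Torus2 → ℝ)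
    (l m : Mode) :
    (normSq l + normSq m + r) * ‖testCoef N c r φ l m‖ ^ 2 = c ^ 2 *
      (‖fourierCoef φ (l + m)‖ ^ 2 * (kernel N l m ^ 2 / (normSq l + normSq m + r))) := by
  have h : normSq l + normSq m + r ≠ 0 := by
    linarith [normSq_nonneg l, normSq_nonneg m] |> fun h : 0 < normSq l + normSq m + r => h.ne'
  rw [norm_testCoef_sq, symbol]
  field_simp

theorem sum_weight_mul_norm_testCoef_sq (N : ℕ) (c : ℝ) {r : ℝ} (hr : 0 < r) (φ : Torus2 → ℝ) :
    2 * ∑ l ∈ modes N, ∑ m ∈ modes N, normSq l * ‖testCoef N c r φ l m‖ ^ 2 +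
      r * ∑ l ∈ modes N, ∑ m ∈ modes N, ‖testCoef N c r φ l m‖ ^ 2 =
      c ^ 2 * testEnergy N r φ := by
  have h1 : ∑ l ∈ modes N, ∑ m ∈ modes N, normSq l * ‖testCoef N c r φ l m‖ ^ 2 =
      ∑ l ∈ modes N, ∑ m ∈ modes N, normSq m * ‖testCoef N c r φ l m‖ ^ 2 := by
    rw [Finset.sum_comm]
    refine Finset.sum_congr rfl fun l _ => Finset.sum_congr rfl fun m _ => ?_
    rw [testCoef_comm]
  rw [two_mul]
  nth_rewrite 2 [h1]
  simp only [testEnergy, Finset.mul_sum, ← weight_mul_norm_testCoef_sq N c hr,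
    ← Finset.sum_add_distrib]
  refine Finset.sum_congr rfl fun l _ => Finset.sum_congr rfl fun m _ => ?_
  ring

/-- Bound K² by |l + m|² and the denominator below by |l|². The sum over m is then a shifted sum
over k = l + m, and the two sums decouple. -/
theorem testEnergy_le (N : ℕ) {r : ℝ} (hr : 0 < r) (φ : Torus2 → ℝ) :
    testEnergy N r φ ≤ invSum N * ∑ k ∈ modes N, normSq k * ‖fourierCoef φ k‖ ^ 2 := by
  rw [invSum, Finset.sum_mul]
  refine Finset.sum_le_sum fun l hl => ?_
  refine le_trans ?_ (mul_le_mul_of_nonneg_left (sum_shift_le N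
    (f := fun k => normSq k * ‖fourierCoef φ k‖ ^ 2)
    (fun k => mul_nonneg (normSq_nonneg k) (sq_nonneg _)) l)
    (div_nonneg zero_le_one (normSq_nonneg l)))
  rw [Finset.mul_sum]
  refine Finset.sum_le_sum fun m _ => ?_
  have hl0 := normSq_pos (mem_modes.1 hl).1
  have h1 : kernel N l m ^ 2 / (normSq l + normSq m + r) ≤
      (if l + m ∈ modes N then normSq (l + m) else 0) / normSq l :=
    div_le_div₀ (by split_ifs; exacts [normSq_nonneg _, le_rfl]) (kernel_sq_le N l m) hl0
      (by linarith [normSq_nonneg m])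
  refine (mul_le_mul_of_nonneg_left h1 (sq_nonneg _)).trans (le_of_eq ?_)
  split_ifs <;> ring

/-- The symbol at (i + j, -i) is invariant under i ↦ -i - j. Averaging over this reflection replaces
the kernel by half the sum in `abs_kernel_add_kernel_le`, of size |j|; the symbol adds |j|/|i|². -/
theorem norm_contraction_le (N : ℕ) (c : ℝ) {r : ℝ} (hr : 0 < r) (φ : Torus2 → ℝ) (j : Mode) :
    ‖contraction N (testCoef N c r φ) j‖ ≤
      |c| * ‖fourierCoef φ j‖ * (1 / 2 * normSq j * invSum N) := by
  set s : Mode → ℝ := fun i => kernel N i j * symbol N r (i + j) (-i) with hs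
  have h1 : contraction N (testCoef N c r φ) j =
      c * fourierCoef φ (-j) * ((∑ i ∈ modes N, s i : ℝ) : ℂ) := by
    rw [contraction, Complex.ofReal_sum, Finset.mul_sum]
    refine Finset.sum_congr rfl fun i _ => ?_
    rw [testCoef, show i + j + -i = j by abel, hs]
    push_cast
    ring
  have hne : ∀ i, s i ≠ 0 → i + j ∈ modes N := fun i hi =>
    add_mem_modes_of_kernel_ne_zero (left_ne_zero_of_mul hi)
  have h2 : ∑ i ∈ modes N, s i = ∑ i ∈ modes N, s (-i - j) := by
    -- The reflection does not preserve the box, but it preserves the set of indices with a nonzero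
    -- term.
    refine Finset.sum_bij_ne_zero (fun i _ _ => -i - j) (fun i _ hi => ?_) (fun a _ _ b _ _ h => ?_)
      (fun i hi hi0 => ⟨-i - j, ?_, ?_, by abel⟩) fun i _ _ => ?_
    · rw [show -i - j = -(i + j) by abel]
      exact neg_mem_modes.2 (hne i hi)
    · have : -a - j = -b - j := h
      simpa using this
    · obtain ⟨h0, -, -, hb, -⟩ := of_kernel_ne_zero (left_ne_zero_of_mul hi0)
      exact mem_modes.2 ⟨h0, hb⟩
    · exact hi0
    · congr 1
      abel
  have h3 : |∑ i ∈ modes N, s i| ≤ 1 / 2 * normSq j * invSum N := by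
    have h4 : 2 * ∑ i ∈ modes N, s i = ∑ i ∈ modes N,
        (kernel N i j + kernel N (-i - j) j) * symbol N r (i + j) (-i) := by
      rw [two_mul]
      nth_rewrite 2 [h2]
      rw [← Finset.sum_add_distrib]
      refine Finset.sum_congr rfl fun i _ => ?_
      simp only [hs]
      rw [show -i - j + j = -i by abel, show -(-i - j) = i + j by abel, symbol_comm N r (-i)]
      ring
    have h5 : |2 * ∑ i ∈ modes N, s i| ≤ normSq j * invSum N := by
      rw [h4, invSum, Finset.mul_sum]
      refine (Finset.abs_sum_le_sum_abs _ _).trans (Finset.sum_le_sum fun i _ => ?_)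
      have h6 := abs_symbol_le N hr (i + j) (-i)
      rw [show i + j + -i = j by abel, normSq_neg] at h6
      rw [abs_mul, ← euclNorm_sq, sq, mul_assoc]
      exact mul_le_mul (abs_kernel_add_kernel_le N i j) h6 (abs_nonneg _) (euclNorm_nonneg j)
    rw [abs_mul, abs_two] at h5
    linarith
  rw [h1, norm_mul, norm_mul, Complex.norm_real, Complex.norm_real, norm_fourierCoef_neg,
    Real.norm_eq_abs, Real.norm_eq_abs]
  exact mul_le_mul_of_nonneg_left h3 (mul_nonneg (abs_nonneg c) (norm_nonneg _))

section

variable {Ω : Type*} [MeasurableSpace Ω] {P : Measure Ω} {η : Mode → Ω → ℂ}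

/-- The kernel vanishes when l + m = 0, so the nonlinearity is already Wick ordered. The factor 2
counts the two pairings of two modes with two modes. -/
theorem expect_nonlinCyl_mul (hη : IsWhiteNoise P η) (N : ℕ) (c r : ℝ) (φ : Torus2 → ℝ) :
    expect hη ((c : ℂ) • nonlinCyl N φ * wickQuad N (testCoef N c r φ)) =
      ((2 * c ^ 2 * testEnergy N r φ : ℝ) : ℂ) := by
  have h1 : nonlinCyl N φ = ∑ l ∈ modes N, ∑ m ∈ modes N,
      ((kernel N l m : ℂ) * fourierCoef φ (-(l + m))) • wick l m := by
    rw [nonlinCyl, sum_box_eq_sum_modes]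
    · refine Finset.sum_congr rfl fun l _ => ?_
      rw [sum_box_eq_sum_modes (by simp [kernel_zero_right])]
      refine Finset.sum_congr rfl fun m _ => ?_
      by_cases hK : kernel N l m = 0
      · simp [hK]
      · rw [wick, if_neg (of_kernel_ne_zero hK).2.2.1, sub_zero]
    · simp [kernel_zero_left]
  rw [h1, smul_mul_assoc, map_smul, smul_eq_mul, Finset.sum_mul, map_sum, testEnergy]
  push_cast
  rw [Finset.mul_sum, Finset.mul_sum]
  refine Finset.sum_congr rfl fun l hl => ?_
  rw [Finset.sum_mul, map_sum, Finset.mul_sum, Finset.mul_sum]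
  refine Finset.sum_congr rfl fun m hm => ?_
  rw [smul_mul_assoc, map_smul, smul_eq_mul, expect_wick_mul_wickQuad hη hl hm,
    testCoef_comm N c r φ (-m), testCoef, symbol, kernel_neg, normSq_neg, normSq_neg,
    show -(-l + -m) = l + m by abel, ← conj_fourierCoef]
  push_cast
  rw [← Complex.mul_conj']
  ring

theorem testConst_le (hη : IsWhiteNoise P η) (N : ℕ) (c : ℝ) {r : ℝ} (hr : 0 < r)
    (φ : Torus2 → ℝ) :
    testConst hη N c r (testCoef N c r φ) ≤ (2 * (c ^ 2 * invSum N) + 64 * (c ^ 2 * invSum N) ^ 2) *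
      ∑ k ∈ modes N, normSq k * ‖fourierCoef φ k‖ ^ 2 := by
  set g := testCoef N c r φ with hg
  set S := ∑ k ∈ modes N, normSq k * ‖fourierCoef φ k‖ ^ 2 with hS
  set E := ∑ l ∈ modes N, ∑ m ∈ modes N, normSq l * ‖g l m‖ ^ 2 with hE
  set Q := ∑ l ∈ modes N, ∑ m ∈ modes N, ‖g l m‖ ^ 2 with hQ
  have hsum : 2 * E + r * Q = c ^ 2 * testEnergy N r φ := sum_weight_mul_norm_testCoef_sq N c hr φ
  have hQ0 : 0 ≤ Q := Finset.sum_nonneg fun l _ => Finset.sum_nonneg fun m _ => sq_nonneg _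
  have h1 : ‖toL2 hη (wickQuad N g)‖ ^ 2 ≤ 2 * Q := norm_wickQuad_sq_le hη N g
  have h2 : ∑ k ∈ modes N, normSq k * ‖toL2 hη (D k (wickQuad N g))‖ ^ 2 = 4 * E := by
    rw [hE, Finset.mul_sum]
    refine Finset.sum_equiv (Equiv.neg Mode) (fun k => by simp [neg_mem_modes]) fun k hk => ?_
    rw [norm_D_wickQuad_sq hη N (testCoef_comm N c r φ) hk, Equiv.neg_apply, normSq_neg,
      ← Finset.mul_sum]
    ring
  have h3 : ∑ k ∈ modes N, ‖toL2 hη (antiQuad N g k)‖ ^ 2 / normSq k ≤ invSum N * (2 * E) := by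
    rw [invSum, Finset.sum_mul]
    refine Finset.sum_le_sum fun i _ => ?_
    rw [div_eq_mul_one_div, mul_comm]
    refine mul_le_mul_of_nonneg_left ?_ (div_nonneg zero_le_one (normSq_nonneg i))
    refine (norm_wickQuad_sq_le hη N _).trans (mul_le_mul_of_nonneg_left ?_ zero_le_two)
    refine le_trans (Finset.sum_le_sum fun j _ => ?_) (sum_shift_le N
      (f := fun q => ∑ m ∈ modes N, normSq q * ‖g q m‖ ^ 2)
      (fun q => Finset.sum_nonneg fun m _ => mul_nonneg (normSq_nonneg q) (sq_nonneg _)) i)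
    have h4 := kernel_sq_le N i j
    simp only [norm_mul, mul_pow, Complex.norm_real, Real.norm_eq_abs, sq_abs]
    rw [← Finset.mul_sum]
    refine (mul_le_mul_of_nonneg_right h4 (Finset.sum_nonneg fun m _ => sq_nonneg _)).trans ?_
    split_ifs
    · rw [Finset.mul_sum]
    · rw [zero_mul]
  have h5 : ∑ k ∈ modes N, ‖contraction N g k‖ ^ 2 / normSq k ≤ c ^ 2 * invSum N ^ 2 / 4 * S := by
    rw [hS, Finset.mul_sum]
    refine Finset.sum_le_sum fun k hk => ?_
    rw [div_le_iff₀ (normSq_pos (mem_modes.1 hk).1)]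
    refine (pow_le_pow_left₀ (norm_nonneg _) (norm_contraction_le N c hr φ k) 2).trans
      (le_of_eq ?_)
    rw [mul_pow, mul_pow, sq_abs]
    ring
  have hJ := testEnergy_le N hr φ
  have hZ := invSum_nonneg N
  have h6 : c ^ 2 * testEnergy N r φ ≤ c ^ 2 * (invSum N * S) :=
    mul_le_mul_of_nonneg_left hJ (sq_nonneg c)
  have h7 : 2 * E ≤ c ^ 2 * (invSum N * S) := by nlinarith
  have h8 : r * ‖toL2 hη (wickQuad N g)‖ ^ 2 ≤ r * (2 * Q) := mul_le_mul_of_nonneg_left h1 hr.le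
  have h9 : 32 * c ^ 2 * ∑ k ∈ modes N, ‖toL2 hη (antiQuad N g k)‖ ^ 2 / normSq k ≤
      32 * c ^ 2 * (invSum N * (c ^ 2 * (invSum N * S))) :=
    mul_le_mul_of_nonneg_left (h3.trans (mul_le_mul_of_nonneg_left h7 hZ)) (by positivity)
  have h10 := mul_le_mul_of_nonneg_left h5 (by positivity : 0 ≤ 128 * c ^ 2)
  rw [testConst, h2]
  -- With x = c² `invSum N`: the first two terms of `testConst` are at most 2c² `testEnergy` ≤ 2xS,
  -- the cubic part at most 32x²S, and the contraction at most 128x²S/4 = 32x²S.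
  linarith

end

/-! ### Lattice sums -/

theorem card_box (N : ℕ) : (box N).card = (2 * N + 1) ^ 2 := by
  rw [box, Finset.card_product, Int.card_Icc, sq]
  congr 1 <;> omega

theorem box_subset_succ (N : ℕ) : box N ⊆ box (N + 1) := fun k hk => by
  simp only [box, Finset.mem_product, Finset.mem_Icc] at hk ⊢
  push_cast
  omega

theorem normSq_ge_of_notMem_box {N : ℕ} {k : Mode} (hk : k ∉ box N) :
    ((N : ℝ) + 1) ^ 2 ≤ normSq k := by
  have h1 : ((N : ℤ) + 1) ^ 2 ≤ k.1 ^ 2 ∨ ((N : ℤ) + 1) ^ 2 ≤ k.2 ^ 2 := by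
    by_contra! h
    refine hk ?_
    have h1 := abs_lt_of_sq_lt_sq h.1 (by positivity)
    have h2 := abs_lt_of_sq_lt_sq h.2 (by positivity)
    rw [abs_lt] at h1 h2
    simp only [box, Finset.mem_product, Finset.mem_Icc]
    omega
  rw [normSq]
  rcases h1 with h | h
  · have : ((N : ℝ) + 1) ^ 2 ≤ (k.1 : ℝ) ^ 2 := by exact_mod_cast h
    nlinarith [sq_nonneg (k.2 : ℝ)]
  · have : ((N : ℝ) + 1) ^ 2 ≤ (k.2 : ℝ) ^ 2 := by exact_mod_cast h
    nlinarith [sq_nonneg (k.1 : ℝ)]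

/-- The shell between consecutive boxes has 8(N + 1) points, each with |k|² ≥ (N + 1)². -/
theorem invSum_le_harmonic (N : ℕ) : invSum N ≤ 8 * harmonic N := by
  have h0 : ∀ N, invSum N = ∑ k ∈ box N, 1 / normSq k := fun N =>
    (sum_box_eq_sum_modes (by simp [normSq_zero])).symm
  induction N with
  | zero =>
    have : box 0 = {0} := by simp [box]
    simp [h0, this, normSq_zero]
  | succ N ih =>
    have h1 : ∑ k ∈ box (N + 1) \ box N, 1 / normSq k ≤ 8 * ((N : ℝ) + 1)⁻¹ := by
      have h2 : ∀ k ∈ box (N + 1) \ box N, 1 / normSq k ≤ 1 / ((N : ℝ) + 1) ^ 2 := fun k hk =>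
        one_div_le_one_div_of_le (by positivity)
          (normSq_ge_of_notMem_box (Finset.mem_sdiff.1 hk).2)
      refine (Finset.sum_le_card_nsmul _ _ _ h2).trans (le_of_eq ?_)
      rw [nsmul_eq_mul, Finset.card_sdiff_of_subset (box_subset_succ N),
        Nat.cast_sub (Finset.card_le_card (box_subset_succ N)), card_box, card_box]
      push_cast
      field_simp
      ring
    rw [h0, ← Finset.sum_sdiff (box_subset_succ N), ← h0, harmonic_succ]
    push_cast
    rw [mul_add]
    linarith

theorem eventually_invSum_le : ∀ᶠ N : ℕ in atTop, invSum N ≤ 16 * Real.log N := by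
  have h := (Real.tendsto_log_atTop.comp tendsto_natCast_atTop_atTop).eventually_ge_atTop 1
  filter_upwards [h] with N hN
  have h1 := invSum_le_harmonic N
  have h2 := harmonic_le_one_add_log N
  have h3 : 1 ≤ Real.log N := hN
  linarith

/-- The term b = 0 is 1/0 = 0, so the sum is a harmonic number. -/
theorem log_le_sum_range_one_div {n : ℕ} (hn : 1 ≤ n) :
    Real.log n ≤ ∑ b ∈ Finset.range n, 1 / (b : ℝ) := by
  obtain ⟨m, rfl⟩ := Nat.exists_eq_add_of_le' hn
  refine (log_add_one_le_harmonic m).trans (le_of_eq ?_)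
  rw [Finset.sum_range_succ', harmonic]
  push_cast
  simp

theorem eventually_half_log_le_sum_Ico (M q : ℕ) :
    ∀ᶠ N : ℕ in atTop, 1 / 2 * Real.log N ≤ ∑ b ∈ Finset.Ico M (N - q), 1 / (b : ℝ) := by
  have h := (Real.tendsto_log_atTop.comp tendsto_natCast_atTop_atTop).eventually_ge_atTop
    (2 * (Real.log 2 + ∑ b ∈ Finset.range M, 1 / (b : ℝ)))
  filter_upwards [h, eventually_ge_atTop (2 * q + M + 2)] with N hN hN'
  have h1 : 2 * (Real.log 2 + ∑ b ∈ Finset.range M, 1 / (b : ℝ)) ≤ Real.log N := hN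
  rw [Finset.sum_Ico_eq_sub _ (by omega : M ≤ N - q)]
  have h2 := log_le_sum_range_one_div (n := N - q) (by omega)
  have h3 : Real.log N - Real.log 2 ≤ Real.log ((N - q : ℕ) : ℝ) := by
    have hN0 : (N : ℝ) ≠ 0 := by
      have : N ≠ 0 := by omega
      exact_mod_cast this
    rw [← Real.log_div hN0 two_ne_zero]
    refine Real.log_le_log (by positivity) ?_
    rw [div_le_iff₀ two_pos]
    have : N ≤ (N - q) * 2 := by omega
    exact_mod_cast this
  linarith

theorem sum_natCast_le_sum_Icc {N : ℕ} {s : Finset ℕ} (hs : ∀ b ∈ s, b ≤ N) {f : ℤ → ℝ}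
    (hf : ∀ a, 0 ≤ f a) :
    ∑ b ∈ s, f b ≤ ∑ a ∈ Finset.Icc (-(N : ℤ)) N, f a := by
  rw [← Finset.sum_image (f := f) (g := fun b : ℕ => (b : ℤ)) fun a _ b _ h => Nat.cast_injective h]
  refine Finset.sum_le_sum_of_subset_of_nonneg (fun a ha => ?_) fun a _ _ => hf a
  obtain ⟨b, hb, rfl⟩ := Finset.mem_image.1 ha
  have := hs b hb
  simp only [Finset.mem_Icc]
  omega

/-- A lower bound of one term of the lattice sum, in a cone where the kernel does not degenerate. -/
theorem le_kernel_sq_div {N q a b : ℕ} {p : Mode} (hp : |p.1| ≤ q ∧ |p.2| ≤ q) (hp0 : p ≠ 0)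
    {r : ℝ} (hr : 0 < r) (hab : 2 * a ≤ b) (hq : 6 * q < b) (hrb : r ≤ b) (hN : b + q ≤ N) :
    normSq p / (50 * (b : ℝ) ^ 2) ≤
      kernel N ((a : ℤ), (b : ℤ)) (p - ((a : ℤ), (b : ℤ))) ^ 2 / (normSq ((a : ℤ), (b : ℤ)) + normSq (p - ((a : ℤ), (b : ℤ))) + r) := by
  obtain ⟨p1, p2⟩ := p
  simp only [abs_le] at hp
  have hb0 : (0 : ℝ) < b := by exact_mod_cast (by omega : 0 < b)
  have hl0 : (((a : ℤ), (b : ℤ)) : Mode) ≠ 0 := fun h => by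
    have : (b : ℤ) = 0 := congrArg Prod.snd h
    omega
  have hm0 : ((p1, p2) : Mode) - ((a : ℤ), (b : ℤ)) ≠ 0 := fun h => by
    have : p2 - (b : ℤ) = 0 := congrArg Prod.snd h
    omega
  have hK : kernel N ((a : ℤ), (b : ℤ)) ((p1, p2) - ((a : ℤ), (b : ℤ))) ^ 2 = normSq (p1, p2) *
      cForm ((a : ℤ), (b : ℤ)) ((p1, p2) - ((a : ℤ), (b : ℤ))) ^ 2 / (normSq ((a : ℤ), (b : ℤ)) * normSq ((p1, p2) - ((a : ℤ), (b : ℤ)))) := by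
    rw [kernel, if_pos, div_pow, mul_pow, mul_pow, euclNorm_sq, euclNorm_sq, euclNorm_sq,
      add_sub_cancel]
    refine ⟨hl0, hm0, ?_, ?_, ?_⟩
    · simp only [box, Finset.mem_product, Finset.mem_Icc]; omega
    · simp only [box, Finset.mem_product, Finset.mem_Icc, Prod.mk_sub_mk]; omega
    · rw [add_sub_cancel]
      simp only [box, Finset.mem_product, Finset.mem_Icc]; omega
  have ha' : 2 * (a : ℝ) ≤ b := by exact_mod_cast hab
  have ha0 : (0 : ℝ) ≤ a := Nat.cast_nonneg a
  have hq' : 6 * (q : ℝ) ≤ b := by exact_mod_cast hq.le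
  have h11 : -(q : ℝ) ≤ p1 := by exact_mod_cast hp.1.1
  have h12 : (p1 : ℝ) ≤ q := by exact_mod_cast hp.1.2
  have h21 : -(q : ℝ) ≤ p2 := by exact_mod_cast hp.2.1
  have h22 : (p2 : ℝ) ≤ q := by exact_mod_cast hp.2.2
  have hb1 : (1 : ℝ) ≤ b := by exact_mod_cast (by omega : 1 ≤ b)
  have hl : normSq ((a : ℤ), (b : ℤ)) ≤ 5 / 4 * (b : ℝ) ^ 2 := by
    simp only [normSq, Int.cast_natCast]
    nlinarith
  have hm : normSq ((p1, p2) - ((a : ℤ), (b : ℤ))) ≤ 2 * (b : ℝ) ^ 2 := by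
    simp only [normSq, Prod.mk_sub_mk, Int.cast_sub, Int.cast_natCast]
    have e1 : ((p1 : ℝ) - a) ^ 2 ≤ (2 / 3 * b) ^ 2 := sq_le_sq' (by linarith) (by linarith)
    have e2 : ((p2 : ℝ) - b) ^ 2 ≤ (7 / 6 * b) ^ 2 := sq_le_sq' (by linarith) (by linarith)
    nlinarith
  -- In the cone 2a ≤ b, -c = b² - a² - b p₂ + a p₁ ≥ b²(1 - 1/4 - 1/6 - 1/12) = b²/2.
  have hc : ((b : ℝ) ^ 2 / 2) ^ 2 ≤ cForm ((a : ℤ), (b : ℤ)) ((p1, p2) - ((a : ℤ), (b : ℤ))) ^ 2 := by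
    rw [← neg_sq (cForm _ _)]
    refine pow_le_pow_left₀ (by positivity) ?_ 2
    simp only [cForm, Prod.mk_sub_mk, Int.cast_sub, Int.cast_natCast]
    have e1 : (b : ℝ) * p2 ≤ b * (b / 6) := mul_le_mul_of_nonneg_left (by linarith) hb0.le
    have e2 : (a : ℝ) * -p1 ≤ b / 2 * (b / 6) :=
      (mul_le_mul_of_nonneg_left (by linarith : -(p1 : ℝ) ≤ b / 6) ha0).trans
        (mul_le_mul_of_nonneg_right (by linarith) (by linarith))
    nlinarith
  have hl1 := normSq_pos hl0
  have hm1 := normSq_pos hm0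
  have hp1 := normSq_pos hp0
  have hden : normSq ((a : ℤ), (b : ℤ)) + normSq ((p1, p2) - ((a : ℤ), (b : ℤ))) + r ≤ 17 / 4 * (b : ℝ) ^ 2 := by nlinarith
  rw [hK, div_div, div_le_div_iff₀ (by positivity) (by positivity), mul_assoc,
    mul_assoc (normSq (p1, p2))]
  refine mul_le_mul_of_nonneg_left ?_ hp1.le
  rw [← mul_assoc]
  calc normSq ((a : ℤ), (b : ℤ)) * normSq ((p1, p2) - ((a : ℤ), (b : ℤ))) *
        (normSq ((a : ℤ), (b : ℤ)) + normSq ((p1, p2) - ((a : ℤ), (b : ℤ))) + r)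
      ≤ (5 / 4 * (b : ℝ) ^ 2) * (2 * (b : ℝ) ^ 2) * (17 / 4 * (b : ℝ) ^ 2) := by gcongr
    _ ≤ ((b : ℝ) ^ 2 / 2) ^ 2 * (50 * (b : ℝ) ^ 2) := by nlinarith [pow_pos hb0 6]
    _ ≤ _ := by gcongr

/-- Keep only l = (a, b) with 0 ≤ a ≤ b/2. Each row has at least b/2 such points, contributing
|p|²/(100 b) in all, and the sum of 1/b over rows is eventually at least half of log N. The first
row `M` is chosen so that 6q < b and r ≤ R ≤ b, which makes the bound uniform in r. -/
theorem eventually_le_sum_kernel_sq {p : Mode} (hp0 : p ≠ 0) (R : ℝ) :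
    ∀ᶠ N : ℕ in atTop, ∀ r : ℝ, 0 < r → r ≤ R → normSq p / 200 * Real.log N ≤
      ∑ l ∈ modes N, kernel N l (p - l) ^ 2 / (normSq l + normSq (p - l) + r) := by
  set q := p.1.natAbs + p.2.natAbs with hq
  obtain ⟨M₀, hM₀⟩ := exists_nat_ge R
  set M := M₀ + 6 * q + 1 with hM
  filter_upwards [eventually_half_log_le_sum_Ico M q] with N hN r hr hrR
  have hF0 : ∀ l, 0 ≤ kernel N l (p - l) ^ 2 / (normSq l + normSq (p - l) + r) := fun l =>
    div_nonneg (sq_nonneg _) (by linarith [normSq_nonneg l, normSq_nonneg (p - l)])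
  rw [← sum_box_eq_sum_modes (by simp [kernel_zero_left]), box, Finset.sum_product_right]
  refine le_trans ?_ (sum_natCast_le_sum_Icc (s := Finset.Ico M (N - q))
    (fun b hb => by rw [Finset.mem_Ico] at hb; omega)
    fun b => Finset.sum_nonneg fun a _ => hF0 (a, b))
  have h1 : ∑ b ∈ Finset.Ico M (N - q), normSq p / 100 * (1 / (b : ℝ)) ≤
      ∑ b ∈ Finset.Ico M (N - q), ∑ a ∈ Finset.Icc (-(N : ℤ)) N,
        kernel N (a, (b : ℤ)) (p - (a, (b : ℤ))) ^ 2 /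
          (normSq (a, (b : ℤ)) + normSq (p - (a, (b : ℤ))) + r) := by
    refine Finset.sum_le_sum fun b hb => ?_
    rw [Finset.mem_Ico] at hb
    refine le_trans ?_ (sum_natCast_le_sum_Icc (s := Finset.range (b / 2 + 1))
      (fun a ha => by rw [Finset.mem_range] at ha; omega) fun a => hF0 (a, b))
    have hrb : r ≤ b := by
      have : M₀ ≤ b := by omega
      exact (hrR.trans hM₀).trans (by exact_mod_cast this)
    have h2 := Finset.card_nsmul_le_sum (Finset.range (b / 2 + 1)) (fun a : ℕ =>
      kernel N ((a : ℤ), (b : ℤ)) (p - ((a : ℤ), (b : ℤ))) ^ 2 /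
          (normSq ((a : ℤ), (b : ℤ)) + normSq (p - ((a : ℤ), (b : ℤ))) + r)) _ fun a ha =>
      le_kernel_sq_div (q := q) (a := a) (b := b) (by constructor <;> rw [Int.abs_eq_natAbs] <;> omega) hp0 hr
        (by rw [Finset.mem_range] at ha; omega) (by omega) hrb (by omega)
    refine le_trans ?_ h2
    rw [Finset.card_range, nsmul_eq_mul]
    have hb0 : (0 : ℝ) < b := by exact_mod_cast (by omega : 0 < b)
    have h3 : (b : ℝ) ≤ 2 * ((b / 2 + 1 : ℕ) : ℝ) := by
      exact_mod_cast (by omega : b ≤ 2 * (b / 2 + 1))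
    have hp1 := normSq_nonneg p
    calc normSq p / 100 * (1 / (b : ℝ)) ≤ b / 2 * (normSq p / (50 * (b : ℝ) ^ 2)) := by
          refine le_of_eq ?_
          field_simp
          ring
      _ ≤ _ := mul_le_mul_of_nonneg_right (by linarith) (by positivity)
  rw [← Finset.mul_sum] at h1
  have h4 := mul_le_mul_of_nonneg_left hN (by have := normSq_nonneg p; positivity :
    0 ≤ normSq p / 100)
  linarith

theorem sum_le_testEnergy (N : ℕ) {r : ℝ} (hr : 0 < r) (φ : Torus2 → ℝ) (T : Finset Mode) :
    ∑ p ∈ T, ‖fourierCoef φ p‖ ^ 2 * ∑ l ∈ modes N,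
      kernel N l (p - l) ^ 2 / (normSq l + normSq (p - l) + r) ≤ testEnergy N r φ := by
  simp only [Finset.mul_sum]
  rw [Finset.sum_comm, testEnergy]
  refine Finset.sum_le_sum fun l _ => ?_
  set h : Mode → ℝ := fun m =>
    ‖fourierCoef φ (l + m)‖ ^ 2 * (kernel N l m ^ 2 / (normSq l + normSq m + r)) with hh
  have h0 : ∀ m, 0 ≤ h m := fun m => mul_nonneg (sq_nonneg _)
    (div_nonneg (sq_nonneg _) (by linarith [normSq_nonneg l, normSq_nonneg m]))
  have h1 : ∀ m, h m ≠ 0 → m ∈ modes N := fun m hm => by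
    by_contra hm'
    have hK : kernel N l m = 0 := by
      by_contra hK
      obtain ⟨-, h2, -, -, h3, -⟩ := of_kernel_ne_zero hK
      exact hm' (mem_modes.2 ⟨h2, h3⟩)
    exact hm (by simp [hh, hK])
  calc _ = ∑ p ∈ T, h (p - l) := Finset.sum_congr rfl fun p _ => by simp [hh]
    _ = ∑ m ∈ T.image (fun p => p - l), h m :=
        (Finset.sum_image fun a _ b _ hab => sub_left_injective hab).symm
    _ = ∑ m ∈ (T.image fun p => p - l).filter (· ∈ modes N), h m :=
        (Finset.sum_filter_of_ne fun m _ hm => h1 m hm).symm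
    _ ≤ _ := Finset.sum_le_sum_of_subset_of_nonneg
        (fun m hm => (Finset.mem_filter.1 hm).2) fun m _ _ => h0 m

/-- The threshold in N depends on the mode p, hence the finite set `T`; this is where the dependence
of N₀ on φ comes from. -/
theorem eventually_le_testEnergy (φ : Torus2 → ℝ) (T : Finset Mode) (hT : 0 ∉ T) (R : ℝ) :
    ∀ᶠ N : ℕ in atTop, ∀ r : ℝ, 0 < r → r ≤ R →
      (∑ p ∈ T, normSq p * ‖fourierCoef φ p‖ ^ 2) / 200 * Real.log N ≤ testEnergy N r φ := by
  have h : ∀ p ∈ T, ∀ᶠ N : ℕ in atTop, ∀ r : ℝ, 0 < r → r ≤ R → normSq p / 200 * Real.log N ≤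
      ∑ l ∈ modes N, kernel N l (p - l) ^ 2 / (normSq l + normSq (p - l) + r) :=
    fun p hp => eventually_le_sum_kernel_sq (fun h => hT (h ▸ hp)) R
  filter_upwards [(eventually_all_finset T).2 h] with N hN r hr hrR
  refine le_trans ?_ (sum_le_testEnergy N hr φ T)
  rw [Finset.sum_div, Finset.sum_mul]
  refine Finset.sum_le_sum fun p hp => ?_
  have := mul_le_mul_of_nonneg_left (hN p hp r hr hrR) (sq_nonneg ‖fourierCoef φ p‖)
  linarith

/-! ### The Sobolev norm and the coupling constants -/

theorem sum_normSq_mul_le_h1NormSq {φ : Torus2 → ℝ} (hφ : MemH1 φ) (T : Finset Mode) :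
    ∑ k ∈ T, normSq k * ‖fourierCoef φ k‖ ^ 2 ≤ h1NormSq φ := by
  refine (Finset.sum_le_sum fun k _ => ?_).trans (hφ.2.sum_le_tsum T fun k _ =>
    mul_nonneg (by linarith [normSq_nonneg k]) (sq_nonneg _))
  exact mul_le_mul_of_nonneg_right (by linarith) (sq_nonneg _)

/-- One factor 1/2 is lost in truncating the series, another in 1 + |k|² ≤ 2|k|² for k ≠ 0. -/
theorem exists_h1NormSq_le_sum {φ : Torus2 → ℝ} (hφ : MemH1 φ) (h0 : fourierCoef φ 0 = 0)
    (hpos : 0 < h1NormSq φ) : ∃ T : Finset Mode, 0 ∉ T ∧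
      h1NormSq φ / 4 ≤ ∑ k ∈ T, normSq k * ‖fourierCoef φ k‖ ^ 2 := by
  obtain ⟨T, hT⟩ := (hφ.2.hasSum.eventually_const_lt
    (show h1NormSq φ / 2 < h1NormSq φ by linarith)).exists
  refine ⟨T.erase 0, Finset.notMem_erase 0 T, ?_⟩
  have h1 : ∑ k ∈ T, (1 + normSq k) * ‖fourierCoef φ k‖ ^ 2 =
      ∑ k ∈ T.erase 0, (1 + normSq k) * ‖fourierCoef φ k‖ ^ 2 :=
    (Finset.sum_erase _ (by simp [h0])).symm
  have h2 : ∑ k ∈ T.erase 0, (1 + normSq k) * ‖fourierCoef φ k‖ ^ 2 ≤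
      ∑ k ∈ T.erase 0, 2 * (normSq k * ‖fourierCoef φ k‖ ^ 2) := by
    refine Finset.sum_le_sum fun k hk => ?_
    have := one_le_normSq (Finset.ne_of_mem_erase hk)
    rw [← mul_assoc]
    exact mul_le_mul_of_nonneg_right (by linarith) (sq_nonneg _)
  rw [← Finset.mul_sum] at h2
  linarith

theorem tendsto_sq_mul_log {C : ℝ} (hC : 0 < C) {lam : ℕ → ℝ}
    (hlam : lam ~[atTop] fun N : ℕ => √(C / Real.log N)) :
    Tendsto (fun N : ℕ => lam N ^ 2 * Real.log N) atTop (𝓝 C) := by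
  have h1 : (fun N : ℕ => lam N ^ 2 * Real.log N) ~[atTop]
      fun N : ℕ => √(C / Real.log N) ^ 2 * Real.log N :=
    (hlam.pow 2).mul IsEquivalent.refl
  have h2 : (fun N : ℕ => √(C / Real.log N) ^ 2 * Real.log N) =ᶠ[atTop] fun _ => C := by
    filter_upwards [(Real.tendsto_log_atTop.comp tendsto_natCast_atTop_atTop).eventually_gt_atTop
      0] with N hN
    have hN' : 0 < Real.log N := hN
    rw [Real.sq_sqrt (by positivity)]
    field_simp
  exact (isEquivalent_const_iff_tendsto hC.ne').1 (h1.congr_right h2)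

section

variable {Ω : Type*} [MeasurableSpace Ω] {P : Measure Ω} {η : Mode → Ω → ℂ}

/-- The lower bound of the resolvent pairing in terms of the coupling constant, at fixed size. -/
theorem exists_resolvent_nonlin_le (hη : IsWhiteNoise P η) {N : ℕ} {c r s : ℝ} (hr : 0 < r)
    (hs : 0 < s) (hcs : c ^ 2 * invSum N ≤ s) {φ : Torus2 → ℝ} (hφ : MemH1 φ) :
    ∃ U : Lp ℝ 2 P,
      (∀ V : Lp ℝ 2 P, SolvesResolvent P η N c r (fun ω => c * nonlin N φ fun k => η k ω) V ↔
        V = U) ∧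
      0 ≤ ∫ ω, (c * nonlin N φ fun k => η k ω) * U ω ∂P ∧
      (2 * c ^ 2 * testEnergy N r φ) ^ 2 ≤ (2 * s + 64 * s ^ 2) * h1NormSq φ *
        ∫ ω, (c * nonlin N φ fun k => η k ω) * U ω ∂P := by
  obtain ⟨U, hU, hG⟩ := exists_resolvent_nonlin hη N c hr φ
  refine ⟨U, hU, ?_, ?_⟩
  -- The zero test function already yields nonnegativity of the pairing.
  · have := hG 0 1 fun V T _ _ => by
      rw [mul_zero, map_zero, norm_zero, one_mul]
      exact Real.sqrt_nonneg _
    simpa using this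
  · have hx0 : 0 ≤ c ^ 2 * invSum N := mul_nonneg (sq_nonneg c) (invSum_nonneg N)
    have hle : testConst hη N c r (testCoef N c r φ) ≤ (2 * s + 64 * s ^ 2) * h1NormSq φ := by
      refine (testConst_le hη N c hr φ).trans ?_
      refine mul_le_mul ?_ (sum_normSq_mul_le_h1NormSq hφ _)
        (Finset.sum_nonneg fun k _ => mul_nonneg (normSq_nonneg k) (sq_nonneg _)) (by positivity)
      gcongr
    have h := hG (wickQuad N (testCoef N c r φ)) (√((2 * s + 64 * s ^ 2) * h1NormSq φ))
      fun V T hV hT => (norm_expect_resolv_mul_le hη N c hr (testCoef_comm N c r φ) hV hT).trans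
        (mul_le_mul_of_nonneg_right (Real.sqrt_le_sqrt hle) (Real.sqrt_nonneg _))
    have hnn : 0 ≤ h1NormSq φ := by
      simpa using sum_normSq_mul_le_h1NormSq hφ ∅
    rwa [expect_nonlinCyl_mul, Complex.norm_real, Real.norm_eq_abs, sq_abs,
      Real.sq_sqrt (mul_nonneg (by positivity) hnn)] at h

end

end AKPZ

end

/-! ### Choice of the constants and conclusion. -/

theorem propositionp {Ω : Type*} [MeasurableSpace Ω] (P : Measure Ω) [IsProbabilityMeasure P]
    (η : AKPZ.Mode → Ω → ℂ) (hη : AKPZ.IsWhiteNoise P η)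
    (C : ℝ) (hC : 0 < C) (lam : ℕ → ℝ)
    (hlam : lam ~[atTop] fun N : ℕ => √(C / Real.log N)) :
    ∃ δ : ℝ, 0 < δ ∧
      ∀ φ : AKPZ.Torus2 → ℝ, AKPZ.MemH1 φ → AKPZ.fourierCoef φ 0 = 0 →
        ∀ R : ℝ, 0 < R → ∃ N₀ : ℕ, ∀ N : ℕ, N₀ ≤ N → ∀ r : ℝ, 0 < r → r ≤ R →
          ∃ U : Lp ℝ 2 P,
            (∀ V : Lp ℝ 2 P,
              AKPZ.SolvesResolvent P η N (lam N) r
                (fun ω => lam N * AKPZ.nonlin N φ fun k => η k ω) V ↔ V = U) ∧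
            C * Real.pi * δ * AKPZ.h1NormSq φ ≤
              ∫ ω, (lam N * AKPZ.nonlin N φ fun k => η k ω) * U ω ∂P := by
  -- 32C = 16 · 2C: eventually `invSum N` ≤ 16 log N and λ_N² log N < 2C.
  set s := 32 * C with hs
  have hs0 : 0 < s := by positivity
  set b := 2 * s + 64 * s ^ 2 with hb
  have hb0 : 0 < b := by positivity
  have hlim := AKPZ.tendsto_sq_mul_log hC hlam
  have hup : ∀ᶠ N : ℕ in atTop, lam N ^ 2 * AKPZ.invSum N ≤ s := by
    filter_upwards [AKPZ.eventually_invSum_le,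
      hlim.eventually_lt_const (show C < 2 * C by linarith)] with N h1 h2
    have := mul_le_mul_of_nonneg_left h1 (sq_nonneg (lam N))
    linarith
  refine ⟨(C / 800) ^ 2 / b / (C * Real.pi), by positivity, fun φ hφ hφ0 R _ => ?_⟩
  have hCδ : C * Real.pi * ((C / 800) ^ 2 / b / (C * Real.pi)) = (C / 800) ^ 2 / b :=
    mul_div_cancel₀ _ (by positivity)
  have hnn : 0 ≤ AKPZ.h1NormSq φ := by
    simpa using AKPZ.sum_normSq_mul_le_h1NormSq hφ ∅
  rw [hCδ]
  -- The main estimate is quadratic in the squared norm and one factor is divided out at the end, so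
  -- φ of zero norm is treated apart.
  rcases hnn.eq_or_lt with h0 | hpos
  · obtain ⟨N₀, hN₀⟩ := eventually_atTop.1 hup
    refine ⟨N₀, fun N hN r hr _ => ?_⟩
    obtain ⟨U, hU, hI, -⟩ := AKPZ.exists_resolvent_nonlin_le hη hr hs0 (hN₀ N hN) hφ
    exact ⟨U, hU, by rwa [← h0, mul_zero]⟩
  · obtain ⟨T, hT0, hT⟩ := AKPZ.exists_h1NormSq_le_sum hφ hφ0 hpos
    obtain ⟨N₀, hN₀⟩ := eventually_atTop.1 (hup.and ((AKPZ.eventually_le_testEnergy φ T hT0 R).and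
      (hlim.eventually_const_lt (show C / 2 < C by linarith))))
    refine ⟨N₀, fun N hN r hr hrR => ?_⟩
    obtain ⟨h1, h2, h3⟩ := hN₀ N hN
    obtain ⟨U, hU, -, hI⟩ := AKPZ.exists_resolvent_nonlin_le hη hr hs0 h1 hφ
    refine ⟨U, hU, ?_⟩
    -- C/800 = 2 · (1/200) · (C/2) · (1/4): the lattice sum, the lower bound on λ_N² log N, and the
    -- truncation to `T`.
    have h4 : C / 800 * AKPZ.h1NormSq φ ≤ 2 * lam N ^ 2 * AKPZ.testEnergy N r φ := by
      have h5 := mul_le_mul_of_nonneg_left (h2 r hr hrR) (sq_nonneg (lam N))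
      have h6 := mul_le_mul h3.le hT (by positivity) (by linarith)
      linarith
    have h7 := (pow_le_pow_left₀ (by positivity) h4 2).trans hI
    rw [div_mul_eq_mul_div, div_le_iff₀ hb0]
    have h8 : AKPZ.h1NormSq φ * ((C / 800) ^ 2 * AKPZ.h1NormSq φ) ≤ AKPZ.h1NormSq φ *
        ((∫ ω, (lam N * AKPZ.nonlin N φ fun k => η k ω) * U ω ∂P) * b) := by
      linarith
    exact le_of_mul_le_mul_left h8 hpos
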